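/- **Setting.** Let $X$ be a compact complex manifold and $A^\bullet(X)$ its algebra of smooth complex differential forms, with $d=\partial+\bar\partial$. Let $E^\bullet=\bigoplus_{k\in\mathbb Z}E^k$ be a finite dimensional $\mathbb Z$-graded smooth complex vector bundle on $X$ (each $E^k$ of constant rank), and let $A^\bullet(X,E^\bullet)$ and $A^\bullet(X,\mathrm{End}^\bullet E)$ be the spaces of smooth forms with values in $E^\bullet$ and in $\mathrm{End}^\bullet E$; they are spanned by the elements $e\otimes\omega$ and $L\otimes\tau$ (bundle degree of $e$, $L$ written $|e|$, $|L|$; form degree of $\omega$, $\tau$ written $|\omega|$, $|\tau|$), and $|s|$ denotes the total degree of $s\in A^\bullet(X,E^\bullet)$, so $|e\otimes\omega|=|e|+|\omega|$. The action is $(L\otimes\tau)(e\otimes\omega)=(-1)^{|\tau||e|}\,Le\otimes\tau\wedge\omega$. The *exotic degree* of $e\otimes\omega$, resp. $L\otimes\tau$, with the form of type $(p,q)$ and $e\in E^{c}$, resp. $L\in\mathrm{End}^{c}E$, is $-p+q+c$. A *cohesive structure* on $E^\bullet$ is a $\mathbb C$-linear operator $E''$ on $A^{0,\bullet}(X,E^\bullet)$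 of total degree $1$ with $$E''(e\otimes\omega)=(E''e)\wedge\omega+(-1)^{|e|}e\otimes\bar\partial\omega,\qquad E''\circ E''=0,$$ for $e\in A^0(X,E^\bullet)$ and $\omega\in A^{0,\bullet}(X)$. A *$\partial$-superconnection* $E':A^0(X,E^\bullet)\to A^{\bullet,0}(X,E^\bullet)$ is a $\mathbb C$-linear map with $E'(ef)=(E'e)f+(-1)^{|e|}e\otimes\partial f$ for all smooth functions $f$; it has exotic degree $-1$ if it maps sections of $E^k$ to elements of exotic degree $k-1$. Both $E'$ and $E''$ are extended to $A^\bullet(X,E^\bullet)$ by $E'(e\otimes\omega)=(E'e)\wedge\omega+(-1)^{|e|}e\otimes\partial\omega$ and $E''(e\otimes\omega)=(E''e)\wedge\omega+(-1)^{|e|}e\otimes\bar\partial\omega$. Let $h$ be a Hermitian metric on $E^\bullet$ (conjugate-linear in the first argument) for which $E^k\perp E^l$ if $k\ne l$. For a form $\omega$ of degree $k$ put $\omega^*=(-1)^{k(k+1)/2}\,\bar\omega$; extend $h$ additively by $h(e\otimes\omega,f\otimes\eta)=\omega^*\wedge h(e,f)\wedge\eta$; and put $(L\otimes\tau)^*=(-1)^{|L||\tau|}L^*\otimes\tau^*$,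 where $L^*$ is the $h$-adjoint of $L$. **Statement.** For every such $(E^\bullet,E'',h)$ there is a unique $\partial$-superconnection $E':A^0(X,E^\bullet)\to A^{\bullet,0}(X,E^\bullet)$ of exotic degree $-1$ such that $E=E'+E''$ is unitary, i.e. $$(-1)^{|s|}\,d\,h(s,t)=-h(Es,t)+h(s,Et)$$ for all $s,t\in A^\bullet(X,E^\bullet)$ with $s$ homogeneous of total degree $|s|$. For this $E'$ one has $E'\circ E'=0$. The curvature $E\circ E$ is the action of a unique element $R\in A^\bullet(X,\mathrm{End}^\bullet E)$; this $R$ is self-adjoint, $R^*=R$, acts as the supercommutator $[E',E'']=E'E''+E''E'$, and has exotic degree $0$. -/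

import Mathlib

open scoped Manifold ContDiff Topology TensorProduct DirectSum

noncomputable section

namespace ChernSuper

/-! ### Complex-valued exterior forms on a complex vector space -/

section Linear

variable (V : Type*) [AddCommGroup V] [Module ℂ V]

/-- Complex-valued real-linear functionals on a complex vector space. -/
abbrev Covec : Type _ := V →ₗ[ℝ] ℂ

/-- The algebra of complex-valued alternating forms on the real vector space underlying `V`, i.e.
the exterior algebra over `ℂ` of the complexified dual. Its product is the wedge product. -/
abbrev Alt : Type _ := ExteriorAlgebra ℂ (Covec V)

variable {V}

/-- Complex conjugation of functionals. -/
def conjCovec (f : Covec V) : Covec V where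
  toFun v := starRingEnd ℂ (f v)
  map_add' := by simp
  map_smul' := by simp

/-- A copy of `Alt V` with the conjugate `ℂ`-algebra structure. -/
def ConjAlt (V : Type*) [AddCommGroup V] [Module ℂ V] : Type _ := Alt V

instance : Ring (ConjAlt V) := inferInstanceAs (Ring (Alt V))

instance : Algebra ℂ (ConjAlt V) :=
  ((algebraMap ℂ (Alt V)).comp (starRingEnd ℂ)).toAlgebra' (fun c x =>
    Algebra.commutes (A := Alt V) (starRingEnd ℂ c) x)

theorem ConjAlt.smul_def (c : ℂ) (x : ConjAlt V) :
    c • x = (show ConjAlt V from (starRingEnd ℂ c) • (show Alt V from x)) := by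
  rw [Algebra.smul_def]
  exact (Algebra.smul_def (A := Alt V) (starRingEnd ℂ c) x).symm

/-- Complex conjugation `α ↦ ᾱ` of forms: the conjugate-linear ring homomorphism which is
`conjCovec` on functionals. -/
def conjAlt : Alt V →+* Alt V :=
  (ExteriorAlgebra.lift ℂ (A := ConjAlt V)
    ⟨{ toFun := fun f => (show ConjAlt V from ExteriorAlgebra.ι ℂ (conjCovec f))
       map_add' := fun f g => by
        have : conjCovec (f + g) = conjCovec f + conjCovec g := by
          ext v; simp [conjCovec]
        rw [this]; exact map_add (ExteriorAlgebra.ι ℂ) _ _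
       map_smul' := fun c f => by
        have : conjCovec (c • f) = (starRingEnd ℂ c) • conjCovec f := by
          ext v; simp [conjCovec]
        rw [this, RingHom.id_apply, ConjAlt.smul_def]
        exact map_smul (ExteriorAlgebra.ι ℂ) _ _ },
     fun f => ExteriorAlgebra.ι_sq_zero (R := ℂ) (conjCovec f)⟩).toRingHom

theorem conjAlt_ι (f : Covec V) :
    conjAlt (ExteriorAlgebra.ι ℂ f) = ExteriorAlgebra.ι ℂ (conjCovec f) :=
  ExteriorAlgebra.lift_ι_apply ℂ (A := ConjAlt V) _ _ f

theorem conjAlt_algebraMap (c : ℂ) :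
    conjAlt (algebraMap ℂ (Alt V) c) = algebraMap ℂ (Alt V) (starRingEnd ℂ c) :=
  AlgHom.commutes (ExteriorAlgebra.lift ℂ (A := ConjAlt V) _) c

theorem conjAlt_smul (c : ℂ) (a : Alt V) : conjAlt (c • a) = (starRingEnd ℂ c) • conjAlt a := by
  rw [Algebra.smul_def, map_mul, conjAlt_algebraMap, ← Algebra.smul_def]

/-- The linear map which multiplies the degree `k` component of a form by `c k`. -/
def weight (c : ℕ → ℂ) : Alt V →ₗ[ℂ] Alt V :=
  (DirectSum.toModule ℂ ℕ (Alt V) (fun k => c k • (⋀[ℂ]^k (Covec V)).subtype)) ∘ₗ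
    (DirectSum.decomposeLinearEquiv (fun k : ℕ => ⋀[ℂ]^k (Covec V))).toLinearMap

theorem weight_of_mem (c : ℕ → ℂ) {k : ℕ} {a : Alt V} (ha : a ∈ ⋀[ℂ]^k (Covec V)) :
    weight c a = c k • a := by
  simp only [weight, LinearMap.comp_apply, LinearEquiv.coe_coe, DirectSum.decomposeLinearEquiv_apply]
  rw [DirectSum.decompose_of_mem (fun k : ℕ => ⋀[ℂ]^k (Covec V)) ha]
  erw [DirectSum.toModule_lof]
  simp

/-- A form is determined by additive operations on its homogeneous components. -/
theorem alt_induction {P : Alt V → Prop} (h0 : P 0) (hadd : ∀ a b, P a → P b → P (a + b))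
    (hom : ∀ (k : ℕ) (a : Alt V), a ∈ ⋀[ℂ]^k (Covec V) → P a) (a : Alt V) : P a := by
  refine DirectSum.Decomposition.inductionOn (fun k : ℕ => ⋀[ℂ]^k (Covec V)) h0
    (fun {i} m => hom i m m.2) hadd a

/-- The involution `a* = (-1)^{k(k+1)/2} ā` for `a` of degree `k`, extended additively. -/
def starAlt (a : Alt V) : Alt V := conjAlt (weight (fun k => (-1) ^ (k * (k + 1) / 2)) a)

/-- Pullback of forms along a real-linear map. -/
def pull {V' : Type*} [AddCommGroup V'] [Module ℂ V'] (A : V →ₗ[ℝ] V') : Alt V' →ₐ[ℂ] Alt V :=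
  ExteriorAlgebra.map
    { toFun := fun f => f ∘ₗ A
      map_add' := fun f g => by ext; simp
      map_smul' := fun c f => by ext; simp }

/-- Functionals of type `(1,0)`: the complex-linear ones. -/
def covec10 (V : Type*) [AddCommGroup V] [Module ℂ V] : Submodule ℂ (Covec V) where
  carrier := {f | ∀ v, f (Complex.I • v) = Complex.I * f v}
  add_mem' := fun {f g} hf hg v => by simp [hf v, hg v, mul_add]
  zero_mem' := by simp
  smul_mem' := fun c f hf v => by simp [hf v]; ring

/-- Functionals of type `(0,1)`: the conjugate-linear ones. -/
def covec01 (V : Type*) [AddCommGroup V] [Module ℂ V] : Submodule ℂ (Covec V) where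
  carrier := {f | ∀ v, f (Complex.I • v) = -Complex.I * f v}
  add_mem' := fun {f g} hf hg v => by simp [hf v, hg v]; ring
  zero_mem' := by simp
  smul_mem' := fun c f hf v => by simp [hf v]; ring

/-- Forms of type `(p,q)`: spanned by the wedge products of `p` complex-linear and `q`
conjugate-linear functionals. -/
def altType (V : Type*) [AddCommGroup V] [Module ℂ V] (p q : ℕ) : Submodule ℂ (Alt V) :=
  (covec10 V).map (ExteriorAlgebra.ι ℂ) ^ p * (covec01 V).map (ExteriorAlgebra.ι ℂ) ^ q

variable {V' : Type*} [AddCommGroup V'] [Module ℂ V']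

theorem pull_ι (A : V →ₗ[ℝ] V') (f : Covec V') :
    pull A (ExteriorAlgebra.ι ℂ f) = ExteriorAlgebra.ι ℂ (f ∘ₗ A) :=
  ExteriorAlgebra.map_apply_ι _ _

theorem pull_id (a : Alt V) : pull (LinearMap.id : V →ₗ[ℝ] V) a = a := by
  have : pull (LinearMap.id : V →ₗ[ℝ] V) = AlgHom.id ℂ (Alt V) := by
    apply ExteriorAlgebra.hom_ext
    ext f
    simp [pull_ι]
  rw [this]; rfl

theorem pull_comp {V'' : Type*} [AddCommGroup V''] [Module ℂ V''] (A : V →ₗ[ℝ] V')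
    (B : V' →ₗ[ℝ] V'') (a : Alt V'') : pull (B ∘ₗ A) a = pull A (pull B a) := by
  have : pull (B ∘ₗ A) = (pull A).comp (pull B) := by
    apply ExteriorAlgebra.hom_ext
    ext f
    simp [pull_ι, LinearMap.comp_assoc]
  rw [this]; rfl

theorem pull_mem_degree (A : V →ₗ[ℝ] V') {k : ℕ} {a : Alt V'} (ha : a ∈ ⋀[ℂ]^k (Covec V')) :
    pull A a ∈ ⋀[ℂ]^k (Covec V) := by
  have h : (⋀[ℂ]^k (Covec V')).map (pull A).toLinearMap ≤ ⋀[ℂ]^k (Covec V) := by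
    rw [ExteriorAlgebra.exteriorPower, ExteriorAlgebra.exteriorPower, Submodule.map_pow]
    refine pow_le_pow_left' ?_ k
    rintro _ ⟨_, ⟨f, rfl⟩, rfl⟩
    exact ⟨f ∘ₗ A, (pull_ι A f).symm⟩
  exact h ⟨a, ha, rfl⟩

theorem pull_weight (A : V →ₗ[ℝ] V') (c : ℕ → ℂ) (a : Alt V') :
    pull A (weight c a) = weight c (pull A a) := by
  induction a using alt_induction with
  | h0 => simp
  | hadd a b ha hb => simp [ha, hb]
  | hom k a ha => rw [weight_of_mem c ha, weight_of_mem c (pull_mem_degree A ha), map_smul]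

theorem pull_conj (A : V →ₗ[ℝ] V') (a : Alt V') : pull A (conjAlt a) = conjAlt (pull A a) := by
  induction a using ExteriorAlgebra.induction with
  | algebraMap r => simp [conjAlt_algebraMap]
  | ι f => rw [conjAlt_ι, pull_ι, pull_ι, conjAlt_ι]; rfl
  | mul a b ha hb => simp [ha, hb]
  | add a b ha hb => simp [ha, hb]

end Linear

/-! ### The operators `d`, `∂`, `∂̄` on open subsets of a complex vector space -/

section Analysis

variable {V : Type*} [NormedAddCommGroup V] [NormedSpace ℂ V] [FiniteDimensional ℂ V]

instance : Module.Finite ℂ (Covec V) :=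
  Module.Finite.of_injective
    ({ toFun := fun f => (fun j => f (Module.finBasis ℝ V j))
       map_add' := fun _ _ => rfl
       map_smul' := fun _ _ => rfl } : Covec V →ₗ[ℂ] (Fin (Module.finrank ℝ V) → ℂ))
    (fun _ _ h => (Module.finBasis ℝ V).ext (fun j => congrFun h j))

instance : Module.Finite ℂ (Alt V) :=
  Module.Finite.of_basis (Module.finBasis ℂ (Covec V)).ExteriorAlgebra

/-- An auxiliary norm on the finite-dimensional space of forms (all norms are equivalent). -/
instance : NormedAddCommGroup (Alt V) :=
  NormedAddCommGroup.induced (Alt V) (Fin (Module.finrank ℂ (Alt V)) → ℂ)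
    (Module.finBasis ℂ (Alt V)).equivFun (Module.finBasis ℂ (Alt V)).equivFun.injective

instance : NormedSpace ℂ (Alt V) :=
  NormedSpace.induced ℂ (Alt V) (Fin (Module.finrank ℂ (Alt V)) → ℂ)
    (Module.finBasis ℂ (Alt V)).equivFun

instance : FiniteDimensional ℝ (Alt V) := FiniteDimensional.complexToReal _

/-- The real coordinate differential `dx_j`, for a fixed real basis of `V`. -/
def dx (j : Fin (Module.finrank ℝ V)) : Covec V where
  toFun v := (((Module.finBasis ℝ V).coord j v : ℝ) : ℂ)
  map_add' := by simp
  map_smul' := by simp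

/-- For `u` with differential `Du`, the form `∑_j dx_j ∧ (a Du(b_j) + b Du(i b_j))` at `y`. -/
def diffOp (a b : ℂ) (u : V → Alt V) (y : V) : Alt V :=
  ∑ j, ExteriorAlgebra.ι ℂ (dx (V := V) j) *
    (a • fderiv ℝ u y (Module.finBasis ℝ V j) +
      b • fderiv ℝ u y (Complex.I • Module.finBasis ℝ V j))

/-- Wedge multiplication as a continuous bilinear map. -/
def mulB : Alt V →L[ℝ] Alt V →L[ℝ] Alt V := (LinearMap.mul ℝ (Alt V)).toContinuousBilinearMap

theorem mulB_apply (a b : Alt V) : mulB a b = a * b := rfl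

theorem sum_dx_smul (w : Covec V) :
    ∑ j, (w (Module.finBasis ℝ V j)) • dx j = w := by
  refine (Module.finBasis ℝ V).ext (fun k => ?_)
  simp [LinearMap.sum_apply, dx, Finsupp.single_apply, apply_ite Complex.ofReal]

theorem ι_mul_involute (w : Covec V) (a : Alt V) :
    ExteriorAlgebra.ι ℂ w * a = CliffordAlgebra.involute a * ExteriorAlgebra.ι ℂ w := by
  induction a using ExteriorAlgebra.induction with
  | algebraMap r => rw [AlgHom.commutes]; exact (Algebra.commutes r _).symm
  | ι f =>
    have h1 : CliffordAlgebra.involute (ExteriorAlgebra.ι ℂ f) = -ExteriorAlgebra.ι ℂ f :=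
      CliffordAlgebra.involute_ι f
    rw [h1, neg_mul, eq_neg_iff_add_eq_zero]
    exact ExteriorAlgebra.ι_add_mul_swap w f
  | mul a b ha hb => rw [map_mul, ← mul_assoc, ha, mul_assoc, hb, mul_assoc]
  | add a b ha hb => rw [map_add, mul_add, add_mul, ha, hb]

theorem diffOp_add (a b : ℂ) {u v : V → Alt V} {y : V} (hu : DifferentiableAt ℝ u y)
    (hv : DifferentiableAt ℝ v y) :
    diffOp a b (fun z => u z + v z) y = diffOp a b u y + diffOp a b v y := by
  simp only [diffOp, ← Finset.sum_add_distrib]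
  refine Finset.sum_congr rfl (fun j _ => ?_)
  rw [fderiv_fun_add hu hv, ← mul_add]
  simp only [add_apply, smul_add]
  congr 1
  abel

theorem diffOp_sum (a b : ℂ) {ι : Type*} (s : Finset ι) {u : ι → V → Alt V} {y : V}
    (hu : ∀ i ∈ s, DifferentiableAt ℝ (u i) y) :
    diffOp a b (fun z => ∑ i ∈ s, u i z) y = ∑ i ∈ s, diffOp a b (u i) y := by
  classical
  induction s using Finset.induction_on with
  | empty => simp [diffOp]
  | insert i s hi ih =>
    simp only [Finset.sum_insert hi]
    rw [diffOp_add a b (hu i (Finset.mem_insert_self i s))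
      (DifferentiableAt.fun_sum fun j hj => hu j (Finset.mem_insert_of_mem hj)),
      ih (fun j hj => hu j (Finset.mem_insert_of_mem hj))]

theorem diffOp_congr (a b : ℂ) {u v : V → Alt V} {y : V} (h : u =ᶠ[𝓝 y] v) :
    diffOp a b u y = diffOp a b v y := by
  simp only [diffOp, h.fderiv_eq]

/-- The Leibniz rule. -/
theorem diffOp_mul (a b : ℂ) {u v : V → Alt V} {y : V} (hu : DifferentiableAt ℝ u y)
    (hv : DifferentiableAt ℝ v y) :
    diffOp a b (fun z => u z * v z) y =
      diffOp a b u y * v y + CliffordAlgebra.involute (u y) * diffOp a b v y := by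
  have h : ∀ w, fderiv ℝ (fun z => u z * v z) y w =
      fderiv ℝ u y w * v y + u y * fderiv ℝ v y w := fun w => by
    have := (mulB (V := V)).hasFDerivAt_of_bilinear hu.hasFDerivAt hv.hasFDerivAt
    simp only [mulB_apply] at this
    rw [this.fderiv]
    simp [mulB_apply, add_comm]
  simp only [diffOp, h, Finset.sum_mul, Finset.mul_sum, ← Finset.sum_add_distrib]
  refine Finset.sum_congr rfl (fun j _ => ?_)
  rw [← mul_assoc (CliffordAlgebra.involute (u y)), ← ι_mul_involute]
  simp only [mul_assoc, ← mul_add]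
  congr 1
  simp only [smul_add, mul_add, add_mul, smul_mul_assoc, mul_smul_comm]
  abel

theorem differentiableAt_mul {u v : V → Alt V} {y : V} (hu : DifferentiableAt ℝ u y)
    (hv : DifferentiableAt ℝ v y) : DifferentiableAt ℝ (fun z => u z * v z) y :=
  ((mulB (V := V)).hasFDerivAt_of_bilinear hu.hasFDerivAt hv.hasFDerivAt).differentiableAt

/-- The functional `v ↦ a Df(v) + b Df(i v)`. -/
def diffCovec (a b : ℂ) (f : V → ℂ) (y : V) : Covec V where
  toFun v := a * fderiv ℝ f y v + b * fderiv ℝ f y (Complex.I • v)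
  map_add' v w := by simp; ring
  map_smul' r v := by
    rw [smul_comm Complex.I r v]
    simp only [map_smul, Complex.real_smul, RingHom.id_apply]; ring

/-- The constant forms as a continuous linear map. -/
def constB : ℂ →L[ℝ] Alt V :=
  LinearMap.toContinuousLinearMap ((Algebra.linearMap ℂ (Alt V)).restrictScalars ℝ)

theorem constB_apply (c : ℂ) : (constB c : Alt V) = algebraMap ℂ (Alt V) c := rfl

theorem diffOp_function (a b : ℂ) {f : V → ℂ} {y : V} (hf : DifferentiableAt ℝ f y) :
    diffOp a b (fun z => algebraMap ℂ (Alt V) (f z)) y =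
      ExteriorAlgebra.ι ℂ (diffCovec a b f y) := by
  have h : ∀ w, fderiv ℝ (fun z => algebraMap ℂ (Alt V) (f z)) y w =
      algebraMap ℂ (Alt V) (fderiv ℝ f y w) := fun w => by
    have := ((constB (V := V)).hasFDerivAt (x := f y)).comp y hf.hasFDerivAt
    have h2 : fderiv ℝ (fun z => algebraMap ℂ (Alt V) (f z)) y = constB.comp (fderiv ℝ f y) :=
      this.fderiv
    rw [h2]; rfl
  conv_rhs => rw [← sum_dx_smul (diffCovec a b f y)]
  rw [map_sum, diffOp]
  refine Finset.sum_congr rfl (fun j _ => ?_)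
  rw [h, h, LinearMap.map_smul]
  simp only [diffCovec, LinearMap.coe_mk, AddHom.coe_mk, mul_add, mul_smul_comm,
    ← Algebra.commutes, ← Algebra.smul_def, add_smul, mul_smul]

/-- A symmetric bilinear form has vanishing antisymmetrization. -/
theorem sum_dx_symm (γ : V →ₗ[ℝ] Covec V) (hγ : ∀ v w, γ v w = γ w v) :
    ∑ j, ExteriorAlgebra.ι ℂ (dx (V := V) j) *
      ExteriorAlgebra.ι ℂ (γ (Module.finBasis ℝ V j)) = 0 := by
  set b := Module.finBasis ℝ V
  have h1 : ∀ j, ExteriorAlgebra.ι ℂ (γ (b j)) =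
      ∑ k, γ (b j) (b k) • ExteriorAlgebra.ι ℂ (dx (V := V) k) := fun j => by
    conv_lhs => rw [← sum_dx_smul (γ (b j))]
    rw [map_sum]
    simp only [map_smul]; rfl
  simp only [h1, Finset.mul_sum, mul_smul_comm]
  set S := ∑ j, ∑ k, γ (b j) (b k) •
    (ExteriorAlgebra.ι ℂ (dx (V := V) j) * ExteriorAlgebra.ι ℂ (dx (V := V) k)) with hS
  have h2 : S + S = 0 := by
    conv_lhs => rw [hS]; arg 2; rw [Finset.sum_comm]
    simp only [← Finset.sum_add_distrib]
    refine Finset.sum_eq_zero (fun j _ => Finset.sum_eq_zero (fun k _ => ?_))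
    rw [hγ (b k) (b j), ← smul_add, ExteriorAlgebra.ι_add_mul_swap, smul_zero]
  have h3 : (2 : ℂ) • S = 0 := by rw [two_smul]; exact h2
  exact (smul_eq_zero.1 h3).resolve_left two_ne_zero

end Analysis
section Naturality

variable {V : Type*} [NormedAddCommGroup V] [NormedSpace ℂ V]

theorem contDiffAt_real {φ : V → V} {y : V} {n : WithTop ℕ∞} (hφ : ContDiffAt ℂ n φ y) :
    ContDiffAt ℝ n φ y := hφ.restrict_scalars ℝ

theorem fderiv_I {φ : V → V} {y : V} (hφ : DifferentiableAt ℂ φ y) (v : V) :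
    fderiv ℝ φ y (Complex.I • v) = Complex.I • fderiv ℝ φ y v := by
  have h : fderiv ℝ φ y = (fderiv ℂ φ y).restrictScalars ℝ :=
    (hφ.hasFDerivAt.restrictScalars ℝ).fderiv
  rw [h]; simp

theorem ι_lin2 (a b : ℂ) (p q : Covec V) :
    a • ExteriorAlgebra.ι ℂ p + b • ExteriorAlgebra.ι ℂ q = ExteriorAlgebra.ι ℂ (a • p + b • q) := by
  simp

variable [FiniteDimensional ℂ V]

/-- Pullback of forms on open subsets of `V` along a map `φ`. -/
def pullMap (φ : V → V) (u : V → Alt V) (y : V) : Alt V :=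
  pull (fderiv ℝ φ y : V →ₗ[ℝ] V) (u (φ y))

/-- `A ↦ w ∘ A`, as a form of degree one, is continuous and linear. -/
def precompB (w : Covec V) : (V →L[ℝ] V) →L[ℝ] Alt V :=
  LinearMap.toContinuousLinearMap
    { toFun := fun A => ExteriorAlgebra.ι ℂ (w ∘ₗ (A : V →ₗ[ℝ] V))
      map_add' := fun A B => by
        rw [← map_add]; congr 1; ext v; simp
      map_smul' := fun r A => by
        have : w ∘ₗ ((r • A : V →L[ℝ] V) : V →ₗ[ℝ] V) = (r : ℂ) • (w ∘ₗ (A : V →ₗ[ℝ] V)) := by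
          ext v; simp
        rw [this, map_smul]; rfl }

theorem precompB_apply (w : Covec V) (A : V →L[ℝ] V) :
    precompB w A = ExteriorAlgebra.ι ℂ (w ∘ₗ (A : V →ₗ[ℝ] V)) := rfl

theorem pull_const {φ : V → V} {y : V} (hφ : ContDiffAt ℂ 2 φ y) (a b : ℂ) (c : Alt V) :
    DifferentiableAt ℝ (fun z => pull (fderiv ℝ φ z : V →ₗ[ℝ] V) c) y ∧
      diffOp a b (fun z => pull (fderiv ℝ φ z : V →ₗ[ℝ] V) c) y = 0 := by
  have hR : ContDiffAt ℝ 2 φ y := contDiffAt_real hφ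
  have hD : DifferentiableAt ℝ (fderiv ℝ φ) y :=
    (hR.fderiv_right (m := 1) (by norm_num)).differentiableAt (by norm_num)
  induction c using ExteriorAlgebra.induction with
  | algebraMap r =>
    simp only [AlgHom.commutes]
    refine ⟨differentiableAt_const _, ?_⟩
    simp [diffOp]
  | ι w =>
    simp only [pull_ι]
    have hder : HasFDerivAt (fun z => ExteriorAlgebra.ι ℂ (w ∘ₗ (fderiv ℝ φ z : V →ₗ[ℝ] V)))
        ((precompB w).comp (fderiv ℝ (fderiv ℝ φ) y)) y :=
      ((precompB w).hasFDerivAt (x := fderiv ℝ φ y)).comp y hD.hasFDerivAt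
    refine ⟨hder.differentiableAt, ?_⟩
    have hsym : ∀ v u, fderiv ℝ (fderiv ℝ φ) y v u = fderiv ℝ (fderiv ℝ φ) y u v :=
      fun v u => (hR.isSymmSndFDerivAt (by simp)).eq v u
    have hI : ∀ v u, fderiv ℝ (fderiv ℝ φ) y v (Complex.I • u) =
        Complex.I • fderiv ℝ (fderiv ℝ φ) y v u := fun v u => by
      have h1 : HasFDerivAt (fun z => fderiv ℝ φ z (Complex.I • u))
          ((fderiv ℝ (fderiv ℝ φ) y).flip (Complex.I • u)) y := by
        have := hD.hasFDerivAt.clm_apply (hasFDerivAt_const (Complex.I • u) y)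
        simpa using this
      have h2 : HasFDerivAt (fun z => Complex.I • fderiv ℝ φ z u)
          (Complex.I • (fderiv ℝ (fderiv ℝ φ) y).flip u) y := by
        have := hD.hasFDerivAt.clm_apply (hasFDerivAt_const u y)
        have h3 := this.const_smul Complex.I
        have e : (fderiv ℝ φ y).comp (0 : V →L[ℝ] V) + (fderiv ℝ (fderiv ℝ φ) y).flip u =
            (fderiv ℝ (fderiv ℝ φ) y).flip u := by simp
        rw [e] at h3
        exact h3
      have hev : (fun z => fderiv ℝ φ z (Complex.I • u)) =ᶠ[𝓝 y]
          (fun z => Complex.I • fderiv ℝ φ z u) := by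
        filter_upwards [hφ.eventually (by simp)] with z hz
        exact fderiv_I (hz.differentiableAt (by norm_num)) u
      have := (h1.congr_of_eventuallyEq hev.symm).unique h2
      have := congrArg (fun T : V →L[ℝ] V => T v) this
      simpa using this
    have key := sum_dx_symm (V := V)
      { toFun := fun v =>
          { toFun := fun u => a * w (fderiv ℝ (fderiv ℝ φ) y v u) +
              b * w (fderiv ℝ (fderiv ℝ φ) y (Complex.I • v) u)
            map_add' := fun u u' => by simp; ring
            map_smul' := fun r u => by simp; ring }
        map_add' := fun v v' => by ext u; simp; ring
        map_smul' := fun r v => by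
          ext u
          simp only [smul_comm Complex.I r v, map_smul, LinearMap.coe_mk, AddHom.coe_mk,
            smul_apply, Complex.real_smul, RingHom.id_apply, LinearMap.smul_apply]
          ring }
      (fun v u => by
        simp only [LinearMap.coe_mk, AddHom.coe_mk]
        rw [hsym v u, hsym (Complex.I • v) u, hI u v, hsym (Complex.I • u) v, hI v u, hsym v u])
    have hval : ∀ v, fderiv ℝ (fun z => ExteriorAlgebra.ι ℂ (w ∘ₗ (fderiv ℝ φ z : V →ₗ[ℝ] V))) y v =
        ExteriorAlgebra.ι ℂ (w ∘ₗ (fderiv ℝ (fderiv ℝ φ) y v : V →ₗ[ℝ] V)) := fun v =>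
      congrArg (fun T : V →L[ℝ] Alt V => T v) hder.fderiv
    refine Eq.trans (Finset.sum_congr rfl (fun j _ => ?_)) key
    congr 1
    refine Eq.trans (congrArg₂ (fun p q => a • p + b • q) (hval _) (hval _)) ?_
    exact (ι_lin2 a b _ _).trans (congrArg _ (LinearMap.ext fun v => rfl))
  | mul c c' hc hc' =>
    simp only [map_mul]
    refine ⟨differentiableAt_mul hc.1 hc'.1, ?_⟩
    rw [diffOp_mul a b hc.1 hc'.1, hc.2, hc'.2]; simp
  | add c c' hc hc' =>
    simp only [map_add]
    refine ⟨hc.1.add hc'.1, ?_⟩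
    rw [diffOp_add a b hc.1 hc'.1, hc.2, hc'.2]; simp

/-- `diffOp` commutes with pullback along holomorphic maps. -/
theorem diffOp_pullMap {φ : V → V} {y : V} (hφ : ContDiffAt ℂ 2 φ y) (a b : ℂ) {u : V → Alt V}
    (hu : DifferentiableAt ℝ u (φ y)) :
    diffOp a b (pullMap φ u) y = pull (fderiv ℝ φ y : V →ₗ[ℝ] V) (diffOp a b u (φ y)) := by
  set B := Module.finBasis ℂ (Alt V)
  have hφd : DifferentiableAt ℝ φ y := (contDiffAt_real hφ).differentiableAt (by norm_num)
  have hφc : DifferentiableAt ℂ φ y := hφ.differentiableAt (by norm_num)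
  set f : Fin (Module.finrank ℂ (Alt V)) → V → ℂ := fun i z => B.coord i (u z) with hf
  have hfd : ∀ i, DifferentiableAt ℝ (f i) (φ y) := fun i =>
    (LinearMap.toContinuousLinearMap ((B.coord i).restrictScalars ℝ)).differentiableAt.comp
      (φ y) hu
  have hexp : ∀ z, u z = ∑ i, algebraMap ℂ (Alt V) (f i z) * B i := fun z => by
    simp only [← Algebra.smul_def]
    exact (B.sum_repr (u z)).symm
  have hcd : ∀ {x : V} {g : V → ℂ}, DifferentiableAt ℝ g x →
      DifferentiableAt ℝ (fun z => algebraMap ℂ (Alt V) (g z)) x := fun {x g} hg =>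
    (constB (V := V)).differentiableAt.comp x hg
  have hinv : ∀ r : ℂ, CliffordAlgebra.involute (algebraMap ℂ (Alt V) r) =
      algebraMap ℂ (Alt V) r := fun r => AlgHom.commutes _ r
  have hr : diffOp a b u (φ y) =
      ∑ i, ExteriorAlgebra.ι ℂ (diffCovec a b (f i) (φ y)) * B i := by
    rw [diffOp_congr a b (Filter.Eventually.of_forall hexp), diffOp_sum]
    · refine Finset.sum_congr rfl (fun i _ => ?_)
      rw [diffOp_mul a b (hcd (hfd i)) (differentiableAt_const _), diffOp_function a b (hfd i)]
      have : diffOp a b (fun _ : V => B i) (φ y) = 0 := by simp [diffOp]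
      rw [this, mul_zero, add_zero]
    · exact fun i _ => differentiableAt_mul (hcd (hfd i)) (differentiableAt_const _)
  have hl : ∀ z, pullMap φ u z = ∑ i, algebraMap ℂ (Alt V) ((f i ∘ φ) z) *
      pull (fderiv ℝ φ z : V →ₗ[ℝ] V) (B i) := fun z => by
    rw [pullMap, hexp, map_sum]
    simp [map_mul]
  have hfφ : ∀ i, DifferentiableAt ℝ (f i ∘ φ) y := fun i => (hfd i).comp y hφd
  rw [hr, diffOp_congr a b (Filter.Eventually.of_forall hl), diffOp_sum, map_sum]
  · refine Finset.sum_congr rfl (fun i _ => ?_)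
    rw [diffOp_mul a b (hcd (hfφ i)) (pull_const hφ a b (B i)).1, diffOp_function a b (hfφ i),
      (pull_const hφ a b (B i)).2, mul_zero, add_zero, map_mul, pull_ι]
    congr 2
    ext v
    have hc : fderiv ℝ (f i ∘ φ) y = (fderiv ℝ (f i) (φ y)).comp (fderiv ℝ φ y) :=
      fderiv_comp y (hfd i) hφd
    simp [diffCovec, hc, fderiv_I hφc]
  · exact fun i _ => differentiableAt_mul (hcd (hfφ i)) (pull_const hφ a b (B i)).1

theorem contDiffOn_linear {s : Set V} {u : V → Alt V} (hu : ContDiffOn ℝ ∞ u s)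
    (T : Alt V →ₗ[ℝ] Alt V) : ContDiffOn ℝ ∞ (fun y => T (u y)) s :=
  (LinearMap.toContinuousLinearMap T).contDiff.comp_contDiffOn hu

theorem contDiffOn_mul {s : Set V} {u v : V → Alt V} (hu : ContDiffOn ℝ ∞ u s)
    (hv : ContDiffOn ℝ ∞ v s) : ContDiffOn ℝ ∞ (fun y => u y * v y) s :=
  (mulB (V := V)).isBoundedBilinearMap.contDiff.comp_contDiffOn (hu.prodMk hv)

theorem contDiffOn_diffOp (a b : ℂ) {s : Set V} (hs : IsOpen s) {u : V → Alt V}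
    (hu : ContDiffOn ℝ ∞ u s) : ContDiffOn ℝ ∞ (diffOp a b u) s := by
  have hd : ContDiffOn ℝ ∞ (fderiv ℝ u) s := hu.fderiv_of_isOpen hs (by simp)
  have hc : ∀ v, ContDiffOn ℝ ∞ (fun y => fderiv ℝ u y v) s := fun v =>
    hd.clm_apply contDiffOn_const
  refine ContDiffOn.sum (fun j _ => ?_)
  exact contDiffOn_mul contDiffOn_const
    (((hc _).const_smul a).add ((hc _).const_smul b))

end Naturality
/-! ### Differential forms on a complex manifold -/

section Manifold

/-- The smooth real manifold underlying a complex manifold. -/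
instance isManifold_real (V : Type*) [NormedAddCommGroup V] [NormedSpace ℂ V]
    (X : Type*) [TopologicalSpace X] [ChartedSpace V X] [IsManifold 𝓘(ℂ, V) ω X] :
    IsManifold 𝓘(ℝ, V) ∞ X := by
  refine isManifold_of_contDiffOn 𝓘(ℝ, V) ∞ X (fun e e' he he' => ?_)
  have h := (contDiffGroupoid ω 𝓘(ℂ, V)).compatible he he'
  rw [contDiffGroupoid, mem_groupoid_of_pregroupoid] at h
  have h1 : ContDiffOn ℂ ω (e.symm.trans e') (e.symm.trans e').source := by
    simpa [contDiffPregroupoid] using h.1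
  simpa using (h1.restrict_scalars ℝ).of_le le_top

variable (V : Type*) [NormedAddCommGroup V] [NormedSpace ℂ V]
variable (X : Type*) [TopologicalSpace X] [ChartedSpace V X]

/-- The smooth complex-valued functions, as a subalgebra of all functions. -/
def smoothFunAlg : Subalgebra ℂ (X → ℂ) where
  carrier := {f | ContMDiff 𝓘(ℝ, V) 𝓘(ℝ, ℂ) ∞ f}
  mul_mem' := fun hf hg => (contDiff_mul (𝕜 := ℝ) (𝔸 := ℂ)).contMDiff.comp (hf.prodMk_space hg)
  add_mem' := fun hf hg => ContMDiff.add hf hg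
  algebraMap_mem' := fun _ => contMDiff_const

/-- The `ℂ`-algebra `A^0(X)` of smooth complex-valued functions. -/
def SmoothFun : Type _ := smoothFunAlg V X

instance : CommRing (SmoothFun V X) := inferInstanceAs (CommRing (smoothFunAlg V X))

instance : Algebra ℂ (SmoothFun V X) := inferInstanceAs (Algebra ℂ (smoothFunAlg V X))

/-- Families of complex-valued alternating forms on the tangent spaces, not necessarily smooth.
Mathlib's tangent space `TangentSpace 𝓘(ℂ, V) x` is by definition `V`, through the preferred chart
at `x`; derivatives of maps are Mathlib's `mfderiv`. -/
abbrev PreForm : Type _ := X → Alt V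

variable {V X}

/-- The derivative of a map from `V` to `X`. -/
def derivTo (f : V → X) (y : V) : V →L[ℂ] V := mfderiv 𝓘(ℂ, V) 𝓘(ℂ, V) f y

/-- The derivative of a map from `X` to `V`. -/
def derivFrom (f : X → V) (x : X) : V →L[ℂ] V := mfderiv 𝓘(ℂ, V) 𝓘(ℂ, V) f x

/-- The pullback along `f : V → X` of a family of forms, as a family of forms on `V`. -/
def pullTo (f : V → X) (α : PreForm V X) (y : V) : Alt V :=
  pull ((derivTo f y).toLinearMap.restrictScalars ℝ) (α (f y))

/-- The expression of a family of forms in the preferred chart at `x₀`. -/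
def localRep (x₀ : X) (α : PreForm V X) : V → Alt V := pullTo (chartAt V x₀).symm α

theorem pullTo_congr {f g : V → X} {y : V} (h : f =ᶠ[𝓝 y] g) (α : PreForm V X) :
    pullTo f α y = pullTo g α y := by
  have h1 : derivTo f y = derivTo g y := h.mfderiv_eq
  have h2 : f y = g y := h.eq_of_nhds
  rw [pullTo, pullTo, h1, h2]

theorem restrict_fderiv {τ : V → V} {y : V} (hτ : DifferentiableAt ℂ τ y) :
    (fderiv ℂ τ y).toLinearMap.restrictScalars ℝ = (fderiv ℝ τ y : V →ₗ[ℝ] V) := by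
  rw [(hτ.hasFDerivAt.restrictScalars ℝ).fderiv]; rfl

theorem pull_comp_clm {T A B : V →L[ℂ] V} {R : V →ₗ[ℝ] V} (h : T = A.comp B)
    (hR : B.toLinearMap.restrictScalars ℝ = R) (w : Alt V) :
    pull (T.toLinearMap.restrictScalars ℝ) w =
      pull R (pull (A.toLinearMap.restrictScalars ℝ) w) := by
  subst h hR
  exact pull_comp (B.toLinearMap.restrictScalars ℝ) (A.toLinearMap.restrictScalars ℝ) w

theorem pullTo_comp {f : V → X} {τ : V → V} {y : V} (hτ : DifferentiableAt ℂ τ y)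
    (hf : MDifferentiableAt 𝓘(ℂ, V) 𝓘(ℂ, V) f (τ y)) (α : PreForm V X) :
    pullTo (f ∘ τ) α y = pullMap τ (pullTo f α) y := by
  have h : derivTo (f ∘ τ) y = (derivTo f (τ y)).comp (fderiv ℂ τ y) := by
    rw [show fderiv ℂ τ y = derivTo τ y from mfderiv_eq_fderiv.symm]
    exact mfderiv_comp (I := 𝓘(ℂ, V)) (I' := 𝓘(ℂ, V)) (I'' := 𝓘(ℂ, V)) y hf
      hτ.mdifferentiableAt
  exact pull_comp_clm h (restrict_fderiv hτ) (α (f (τ y)))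

section Ops

variable (f : V → X)

theorem pullTo_add (α β : PreForm V X) (y : V) :
    pullTo f (α + β) y = pullTo f α y + pullTo f β y := map_add _ _ _

theorem pullTo_mul (α β : PreForm V X) (y : V) :
    pullTo f (α * β) y = pullTo f α y * pullTo f β y := map_mul _ _ _

theorem pullTo_algebraMap (g : X → ℂ) (y : V) :
    pullTo f (fun x => algebraMap ℂ (Alt V) (g x)) y =
      algebraMap ℂ (Alt V) (g (f y)) :=
  AlgHom.commutes _ _

end Ops

variable [IsManifold 𝓘(ℂ, V) ω X]

/-- The transition map between preferred charts. -/
def trans (x₀ x₁ : X) : V → V := chartAt V x₁ ∘ (chartAt V x₀).symm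

theorem trans_contDiffAt {x₀ x₁ : X} {y : V} (hy : y ∈ (chartAt V x₀).target)
    (hy' : (chartAt V x₀).symm y ∈ (chartAt V x₁).source) : ContDiffAt ℂ 2 (trans x₀ x₁) y := by
  have h := (contDiffGroupoid ω 𝓘(ℂ, V)).compatible (chart_mem_atlas V x₀) (chart_mem_atlas V x₁)
  rw [contDiffGroupoid, mem_groupoid_of_pregroupoid] at h
  have h1 : ContDiffOn ℂ ω ((chartAt V x₀).symm.trans (chartAt V x₁))
      ((chartAt V x₀).symm.trans (chartAt V x₁)).source := by
    simpa [contDiffPregroupoid] using h.1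
  exact (h1.contDiffAt (((chartAt V x₀).symm.trans (chartAt V x₁)).open_source.mem_nhds
    (by simp [hy, hy']))).of_le le_top

theorem localRep_trans {x₀ x₁ : X} {y : V} (hy : y ∈ (chartAt V x₀).target)
    (hy' : (chartAt V x₀).symm y ∈ (chartAt V x₁).source) (α : PreForm V X) :
    localRep x₀ α y = pullMap (trans x₀ x₁) (localRep x₁ α) y := by
  have hm : MDifferentiableAt 𝓘(ℂ, V) 𝓘(ℂ, V) (chartAt V x₁).symm (trans x₀ x₁ y) :=
    ((contMDiffOn_chart_symm (I := 𝓘(ℂ, V)) (n := ω) (x := x₁)).contMDiffAt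
      ((chartAt V x₁).open_target.mem_nhds ((chartAt V x₁).map_source hy'))).mdifferentiableAt
      (by simp)
  rw [localRep, localRep,
    ← pullTo_comp ((trans_contDiffAt hy hy').differentiableAt (by norm_num)) hm]
  refine pullTo_congr ?_ α
  have h1 : ∀ᶠ z in 𝓝 y, z ∈ (chartAt V x₀).target := (chartAt V x₀).open_target.mem_nhds hy
  have h2 : ∀ᶠ z in 𝓝 y, (chartAt V x₀).symm z ∈ (chartAt V x₁).source :=
    ((chartAt V x₀).continuousAt_symm hy).eventually
      ((chartAt V x₁).open_source.mem_nhds hy')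
  filter_upwards [h1, h2] with z hz hz'
  simp only [Function.comp_apply, trans]
  exact ((chartAt V x₁).left_inv hz').symm

variable [FiniteDimensional ℂ V]

/-- A family of forms is smooth if its expressions in charts are. -/
def IsSmoothForm (α : PreForm V X) : Prop :=
  ∀ x₀ : X, ContDiffOn ℝ ∞ (localRep x₀ α) (chartAt V x₀).target

/-- The operator which is given by `diffOp a b` in charts: it is `d`, `∂` or `∂̄` for suitable
`a` and `b`. At `x`, it is computed in the preferred chart at `x`. -/
def preDiff (a b : ℂ) (α : PreForm V X) : PreForm V X := fun x =>
  pull ((derivFrom (chartAt V x) x).toLinearMap.restrictScalars ℝ)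
    (diffOp a b (localRep x α) (chartAt V x x))

/-- The operators are given by the same formula in every chart. -/
theorem localRep_preDiff (a b : ℂ) {α : PreForm V X} (hα : IsSmoothForm α) {x₀ : X} {y : V}
    (hy : y ∈ (chartAt V x₀).target) :
    localRep x₀ (preDiff a b α) y = diffOp a b (localRep x₀ α) y := by
  set p := (chartAt V x₀).symm y with hp
  have hps : p ∈ (chartAt V p).source := mem_chart_source V p
  have hτ := trans_contDiffAt (x₁ := p) hy hps
  have hm : MDifferentiableAt 𝓘(ℂ, V) 𝓘(ℂ, V) (chartAt V x₀).symm y :=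
    ((contMDiffOn_chart_symm (I := 𝓘(ℂ, V)) (n := ω) (x := x₀)).contMDiffAt
      ((chartAt V x₀).open_target.mem_nhds hy)).mdifferentiableAt (by simp)
  have hm' : MDifferentiableAt 𝓘(ℂ, V) 𝓘(ℂ, V) (chartAt V p) p :=
    ((contMDiffOn_chart (I := 𝓘(ℂ, V)) (n := ω) (x := p)).contMDiffAt
      ((chartAt V p).open_source.mem_nhds hps)).mdifferentiableAt (by simp)
  have hc : fderiv ℂ (trans x₀ p) y =
      (derivFrom (chartAt V p) p).comp (derivTo (chartAt V x₀).symm y) := by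
    rw [show fderiv ℂ (trans x₀ p) y = derivTo (trans x₀ p) y from mfderiv_eq_fderiv.symm]
    exact mfderiv_comp (I := 𝓘(ℂ, V)) (I' := 𝓘(ℂ, V)) (I'' := 𝓘(ℂ, V)) y hm' hm
  have hcongr : localRep x₀ α =ᶠ[𝓝 y] pullMap (trans x₀ p) (localRep p α) := by
    have h1 : ∀ᶠ z in 𝓝 y, z ∈ (chartAt V x₀).target := (chartAt V x₀).open_target.mem_nhds hy
    have h2 : ∀ᶠ z in 𝓝 y, (chartAt V x₀).symm z ∈ (chartAt V p).source :=
      ((chartAt V x₀).continuousAt_symm hy).eventually ((chartAt V p).open_source.mem_nhds hps)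
    filter_upwards [h1, h2] with z hz hz'
    exact localRep_trans hz hz' α
  have hdiff : DifferentiableAt ℝ (localRep p α) (trans x₀ p y) :=
    ((hα p).contDiffAt ((chartAt V p).open_target.mem_nhds
      ((chartAt V p).map_source hps))).differentiableAt (by simp)
  rw [diffOp_congr a b hcongr, diffOp_pullMap hτ a b hdiff,
    ← restrict_fderiv (hτ.differentiableAt (by norm_num))]
  exact (pull_comp_clm hc rfl _).symm

theorem IsSmoothForm.preDiff (a b : ℂ) {α : PreForm V X} (hα : IsSmoothForm α) :
    IsSmoothForm (preDiff a b α) := fun x₀ =>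
  (contDiffOn_diffOp a b (chartAt V x₀).open_target (hα x₀)).congr
    (fun _ hy => localRep_preDiff a b hα hy)

theorem isSmoothForm_function {f : X → ℂ} (hf : ContMDiff 𝓘(ℝ, V) 𝓘(ℝ, ℂ) ∞ f) :
    IsSmoothForm (V := V) (fun x => algebraMap ℂ (Alt V) (f x)) := by
  intro x₀
  have h1 : ContDiffOn ℝ ∞ (f ∘ (chartAt V x₀).symm) (chartAt V x₀).target :=
    (hf.comp_contMDiffOn (contMDiffOn_chart_symm (I := 𝓘(ℝ, V)) (x := x₀))).contDiffOn
  refine ((constB (V := V)).contDiff.comp_contDiffOn h1).congr (fun y _ => ?_)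
  exact pullTo_algebraMap _ _ _

variable (V X) in
/-- The smooth complex-valued differential forms, as a subalgebra of all families of forms. -/
def formAlg : Subalgebra ℂ (PreForm V X) where
  carrier := {α | IsSmoothForm α}
  mul_mem' := fun {α β} hα hβ x₀ => (contDiffOn_mul (hα x₀) (hβ x₀)).congr
    (fun y _ => pullTo_mul _ α β y)
  add_mem' := fun {α β} hα hβ x₀ => ((hα x₀).add (hβ x₀)).congr
    (fun y _ => pullTo_add _ α β y)
  algebraMap_mem' := fun c => isSmoothForm_function (f := fun _ => c) contMDiff_const

variable (V X) in
/-- The algebra `A^•(X)` of smooth complex-valued differential forms, with the wedge product. -/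
def Form : Type _ := formAlg V X

instance : Ring (Form V X) := inferInstanceAs (Ring (formAlg V X))

instance : Algebra ℂ (Form V X) := inferInstanceAs (Algebra ℂ (formAlg V X))

/-- Smooth functions as forms of degree zero. -/
def Form.ofFun : SmoothFun V X →+* Form V X where
  toFun f := ⟨fun x => algebraMap ℂ (Alt V) (f.1 x),
    isSmoothForm_function f.2⟩
  map_one' := Subtype.ext (funext fun _ => map_one _)
  map_mul' _ _ := Subtype.ext (funext fun _ => map_mul _ _ _)
  map_zero' := Subtype.ext (funext fun _ => map_zero _)
  map_add' _ _ := Subtype.ext (funext fun _ => map_add _ _ _)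

instance : Algebra (SmoothFun V X) (Form V X) :=
  Form.ofFun.toAlgebra' (fun f α => Subtype.ext (funext fun x =>
    Algebra.commutes (A := Alt V) (f.1 x) (α.1 x)))

theorem Form.fun_smul_apply (f : SmoothFun V X) (α : Form V X) (x : X) :
    (f • α).1 x = f.1 x • α.1 x :=
  (Algebra.smul_def (A := Alt V) (f.1 x) (α.1 x)).symm

instance : IsScalarTower ℂ (SmoothFun V X) (Form V X) :=
  ⟨fun c f α => Subtype.ext (funext fun x => by
    change _ = c • (f • α).1 x
    rw [Form.fun_smul_apply, Form.fun_smul_apply, smul_smul]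
    rfl)⟩

end Manifold
section FormOps

variable {V : Type*} [NormedAddCommGroup V] [NormedSpace ℂ V] [FiniteDimensional ℂ V]
variable {X : Type*} [TopologicalSpace X] [ChartedSpace V X]

theorem localRep_differentiableAt {α : PreForm V X} (hα : IsSmoothForm α) (x : X) :
    DifferentiableAt ℝ (localRep x α) (chartAt V x x) :=
  ((hα x).contDiffAt ((chartAt V x).open_target.mem_nhds
    (mem_chart_target V x))).differentiableAt (by simp)

theorem preDiff_add (a b : ℂ) {α β : PreForm V X} (hα : IsSmoothForm α) (hβ : IsSmoothForm β) :
    preDiff a b (α + β) = preDiff a b α + preDiff a b β := by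
  funext x
  have h : localRep x (α + β) = fun z => localRep x α z + localRep x β z :=
    funext fun z => pullTo_add _ _ _ _
  simp only [preDiff, Pi.add_apply]
  rw [h, diffOp_add a b (localRep_differentiableAt hα x) (localRep_differentiableAt hβ x), map_add]

variable [IsManifold 𝓘(ℂ, V) ω X]

/-- The Leibniz rule for the product of a function and a form. -/
theorem preDiff_fun_mul (a b : ℂ) (f : SmoothFun V X) {α : PreForm V X} (hα : IsSmoothForm α) :
    preDiff a b ((Form.ofFun f).1 * α) =
      preDiff a b (Form.ofFun f).1 * α + (Form.ofFun f).1 * preDiff a b α := by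
  funext x
  have h : localRep x ((Form.ofFun f).1 * α) =
      fun z => localRep x (Form.ofFun f).1 z * localRep x α z :=
    funext fun z => pullTo_mul _ _ _ _
  have hpt : ∀ β : PreForm V X,
      pull ((derivFrom (chartAt V x) x).toLinearMap.restrictScalars ℝ)
        (localRep x β (chartAt V x x)) = β x := fun β => by
    have hx := mem_chart_source V x
    have hm : MDifferentiableAt 𝓘(ℂ, V) 𝓘(ℂ, V) (chartAt V x).symm (chartAt V x x) :=
      ((contMDiffOn_chart_symm (I := 𝓘(ℂ, V)) (n := ω) (x := x)).contMDiffAt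
        ((chartAt V x).open_target.mem_nhds (mem_chart_target V x))).mdifferentiableAt (by simp)
    have hm' : MDifferentiableAt 𝓘(ℂ, V) 𝓘(ℂ, V) (chartAt V x) x :=
      ((contMDiffOn_chart (I := 𝓘(ℂ, V)) (n := ω) (x := x)).contMDiffAt
        ((chartAt V x).open_source.mem_nhds hx)).mdifferentiableAt (by simp)
    have hid : (ContinuousLinearMap.id ℂ V) =
        (derivTo (chartAt V x).symm (chartAt V x x)).comp (derivFrom (chartAt V x) x) := by
      have h1 : (mfderiv 𝓘(ℂ, V) 𝓘(ℂ, V) ((chartAt V x).symm ∘ chartAt V x) x : V →L[ℂ] V) =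
          (derivTo (chartAt V x).symm (chartAt V x x)).comp (derivFrom (chartAt V x) x) :=
        mfderiv_comp (I := 𝓘(ℂ, V)) (I' := 𝓘(ℂ, V)) (I'' := 𝓘(ℂ, V)) x hm hm'
      rw [← h1]
      have h2 : (chartAt V x).symm ∘ chartAt V x =ᶠ[𝓝 x] id :=
        (chartAt V x).eventually_left_inverse hx
      have h3 : (mfderiv 𝓘(ℂ, V) 𝓘(ℂ, V) ((chartAt V x).symm ∘ chartAt V x) x : V →L[ℂ] V) =
        mfderiv 𝓘(ℂ, V) 𝓘(ℂ, V) id x := h2.mfderiv_eq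
      rw [h3]
      exact mfderiv_id.symm
    have hpp : (chartAt V x).symm (chartAt V x x) = x := (chartAt V x).left_inv hx
    have := pull_comp_clm hid rfl (β x)
    rw [localRep, pullTo, hpp]
    rw [← this]
    exact pull_id (β x)
  have hinv : CliffordAlgebra.involute (localRep x (Form.ofFun f).1 (chartAt V x x)) =
      localRep x (Form.ofFun f).1 (chartAt V x x) := by
    have : localRep x (Form.ofFun f).1 (chartAt V x x) = algebraMap ℂ (Alt V) _ :=
      pullTo_algebraMap (V := V) _ f.1 _
    rw [this]
    exact AlgHom.commutes _ _
  rw [preDiff, h, diffOp_mul a b (localRep_differentiableAt (Form.ofFun f).2 x)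
    (localRep_differentiableAt hα x), hinv, map_add, map_mul, map_mul, hpt, hpt]
  rfl

/-- The operator `preDiff a b` on smooth forms. -/
def Form.diff (a b : ℂ) : Form V X →ₗ[ℂ] Form V X where
  toFun α := ⟨preDiff a b α.1, α.2.preDiff a b⟩
  map_add' α β := Subtype.ext (preDiff_add a b α.2 β.2)
  map_smul' c α := by
    apply Subtype.ext
    funext x
    have h : localRep x (c • α).1 = fun z => algebraMap ℂ (Alt V) c * localRep x α.1 z :=
      funext fun z => by
        rw [← Algebra.smul_def]
        exact map_smul (pull _) c _
    change preDiff a b (c • α).1 x = c • preDiff a b α.1 x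
    rw [preDiff, preDiff, h, diffOp_mul (V := V) a b (u := fun _ => algebraMap ℂ (Alt V) c)
      (differentiableAt_const _) (localRep_differentiableAt α.2 x)]
    have h0 : diffOp a b (fun _ : V => algebraMap ℂ (Alt V) c) (chartAt V x x) = 0 := by
      simp [diffOp]
    have h1 : CliffordAlgebra.involute (algebraMap ℂ (Alt V) c) = algebraMap ℂ (Alt V) c :=
      AlgHom.commutes _ _
    rw [h0, h1, zero_mul, zero_add, ← Algebra.smul_def, map_smul]

theorem Form.diff_fun_smul (a b : ℂ) (f : SmoothFun V X) (α : Form V X) :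
    Form.diff a b (f • α) = Form.diff a b (Form.ofFun f) * α + f • Form.diff a b α :=
  Subtype.ext (preDiff_fun_mul a b f α.2)

/-- The exterior derivative `d`: in a chart, `dα = ∑_j dx_j ∧ ∂α/∂x_j`. -/
def extD : Form V X →ₗ[ℂ] Form V X := Form.diff 1 0

/-- The operator `∂`: in a chart, the differential of the coefficients of a form is replaced
by its complex-linear part `v ↦ (Dα(v) - i Dα(iv)) / 2`. -/
def del : Form V X →ₗ[ℂ] Form V X := Form.diff (1 / 2) (-Complex.I / 2)

/-- The operator `∂̄`: in a chart, the differential of the coefficients of a form is replaced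
by its conjugate-linear part `v ↦ (Dα(v) + i Dα(iv)) / 2`. -/
def delbar : Form V X →ₗ[ℂ] Form V X := Form.diff (1 / 2) (Complex.I / 2)

/-- Forms of degree `k`. -/
def Form.ofDegree (V X : Type*) [NormedAddCommGroup V] [NormedSpace ℂ V] [FiniteDimensional ℂ V]
    [TopologicalSpace X] [ChartedSpace V X] [IsManifold 𝓘(ℂ, V) ω X] (k : ℕ) :
    Submodule ℂ (Form V X) where
  carrier := {α | ∀ x, α.1 x ∈ ⋀[ℂ]^k (Covec V)}
  add_mem' := fun hα hβ x => Submodule.add_mem _ (hα x) (hβ x)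
  zero_mem' := fun _ => Submodule.zero_mem _
  smul_mem' := fun c _ hα x => Submodule.smul_mem _ c (hα x)

/-- Forms of type `(p,q)`. -/
def Form.ofType (V X : Type*) [NormedAddCommGroup V] [NormedSpace ℂ V] [FiniteDimensional ℂ V]
    [TopologicalSpace X] [ChartedSpace V X] [IsManifold 𝓘(ℂ, V) ω X] (p q : ℕ) :
    Submodule ℂ (Form V X) where
  carrier := {α | ∀ x, α.1 x ∈ altType V p q}
  add_mem' := fun hα hβ x => Submodule.add_mem _ (hα x) (hβ x)
  zero_mem' := fun _ => Submodule.zero_mem _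
  smul_mem' := fun c _ hα x => Submodule.smul_mem _ c (hα x)

theorem Form.ofFun_mem_ofType (f : SmoothFun V X) : Form.ofFun f ∈ Form.ofType V X 0 0 := by
  intro x
  change algebraMap ℂ (Alt V) (f.1 x) ∈ altType V 0 0
  simp only [altType, pow_zero, one_mul]
  exact Submodule.algebraMap_mem _

/-- Complex conjugation of smooth functions. -/
def SmoothFun.conj (f : SmoothFun V X) : SmoothFun V X :=
  ⟨fun x => starRingEnd ℂ (f.1 x), Complex.conjCLE.contDiff.contMDiff.comp f.2⟩

/-- Degree-wise rescaling of a form. -/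
def Form.weightFun (c : ℕ → ℂ) (α : Form V X) : Form V X :=
  ⟨fun x => ChernSuper.weight c (α.1 x), fun x₀ =>
    (contDiffOn_linear (α.2 x₀) ((ChernSuper.weight c).restrictScalars ℝ)).congr
      (fun _ _ => pull_weight _ _ _)⟩

/-- Multiplication of the component of degree `j` of a form by `c j`, for all `j`. -/
def Form.weight (c : ℕ → ℂ) : Form V X →ₗ[SmoothFun V X] Form V X where
  toFun := Form.weightFun c
  map_add' _ _ := Subtype.ext (funext fun _ => map_add _ _ _)
  map_smul' f α := Subtype.ext (funext fun x =>
    (congrArg (ChernSuper.weight c) (Form.fun_smul_apply f α x)).trans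
      ((map_smul (ChernSuper.weight c) (f.1 x) (α.1 x)).trans
        (Form.fun_smul_apply f (Form.weightFun c α) x).symm))

/-- Multiplication of the component of degree `j` of a form by `(-1)^{kj}`. -/
def Form.twist (k : ℤ) : Form V X →ₗ[SmoothFun V X] Form V X :=
  Form.weight (fun j => (-1) ^ (k * j))

/-- `starAlt` as a real-linear map. -/
def starAltL : Alt V →ₗ[ℝ] Alt V where
  toFun := starAlt
  map_add' := by simp [starAlt]
  map_smul' r a := by
    change starAlt ((r : ℂ) • a) = (r : ℂ) • starAlt a
    rw [starAlt, map_smul, conjAlt_smul, Complex.conj_ofReal, starAlt]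

/-- The involution `α* = (-1)^{k(k+1)/2} ᾱ` (for `α` of degree `k`) on forms. -/
def Form.star : Form V X →+ Form V X where
  toFun α := ⟨fun x => starAlt (α.1 x), fun x₀ =>
    (contDiffOn_linear (α.2 x₀) starAltL).congr (fun y _ => by
      change pull _ (starAlt _) = starAlt (pull _ _)
      rw [starAlt, starAlt, pull_conj, pull_weight])⟩
  map_zero' := Subtype.ext (funext fun _ => map_zero starAltL)
  map_add' _ _ := Subtype.ext (funext fun _ => map_add starAltL _ _)

theorem Form.star_smul (f : SmoothFun V X) (α : Form V X) :
    Form.star (f • α) = SmoothFun.conj f • Form.star α :=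
  Subtype.ext (funext fun x => by
    rw [Form.fun_smul_apply]
    change starAlt ((f • α).1 x) = starRingEnd ℂ (f.1 x) • starAlt (α.1 x)
    rw [Form.fun_smul_apply, starAlt, map_smul, conjAlt_smul, starAlt])

end FormOps
/-! ### Smooth complex vector bundles, sections, homomorphisms and Hermitian metrics -/

section Bundles

section Scalar

variable {V : Type*} [NormedAddCommGroup V] [NormedSpace ℂ V]
variable {X : Type*} [TopologicalSpace X] [ChartedSpace V X]
variable {F : Type*} [NormedAddCommGroup F] [NormedSpace ℂ F] {U : Set X}

/-- Smoothness on a set, with values in a complex normed space. -/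
abbrev SmoothOn (V : Type*) [NormedAddCommGroup V] [NormedSpace ℂ V]
    {X : Type*} [TopologicalSpace X] [ChartedSpace V X]
    {F : Type*} [NormedAddCommGroup F] [NormedSpace ℂ F] (f : X → F) (U : Set X) : Prop :=
  ContMDiffOn 𝓘(ℝ, V) 𝓘(ℝ, F) ∞ f U

theorem SmoothOn.mul {f g : X → ℂ} (hf : SmoothOn V f U) (hg : SmoothOn V g U) :
    SmoothOn V (fun x => f x * g x) U :=
  (contDiff_mul (𝕜 := ℝ) (𝔸 := ℂ)).contMDiff.comp_contMDiffOn (hf.prodMk_space hg)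

theorem SmoothOn.smul {f : X → ℂ} {g : X → F} (hf : SmoothOn V f U) (hg : SmoothOn V g U) :
    SmoothOn V (fun x => f x • g x) U :=
  (isBoundedBilinearMap_smul (𝕜 := ℝ) (A := ℂ) (E := F)).contDiff.contMDiff.comp_contMDiffOn
    (hf.prodMk_space hg)

theorem SmoothOn.conj {f : X → ℂ} (hf : SmoothOn V f U) :
    SmoothOn V (fun x => starRingEnd ℂ (f x)) U :=
  Complex.conjCLE.contDiff.contMDiff.comp_contMDiffOn hf

theorem SmoothOn.inv {f : X → ℂ} (hf : SmoothOn V f U) (h0 : ∀ x ∈ U, f x ≠ 0) :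
    SmoothOn V (fun x => (f x)⁻¹) U := fun x hx =>
  ((contDiffAt_inv ℝ (h0 x hx)).contMDiffAt).comp_contMDiffWithinAt x (hf x hx)

theorem SmoothOn.sum {ι : Type*} (s : Finset ι) {f : ι → X → F}
    (hf : ∀ i ∈ s, SmoothOn V (f i) U) : SmoothOn V (fun x => ∑ i ∈ s, f i x) U :=
  contMDiffOn_finsetSum hf

theorem SmoothOn.prod {ι : Type*} (s : Finset ι) {f : ι → X → ℂ}
    (hf : ∀ i ∈ s, SmoothOn V (f i) U) : SmoothOn V (fun x => ∏ i ∈ s, f i x) U := by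
  classical
  induction s using Finset.induction_on with
  | empty => simpa using contMDiffOn_const
  | insert i s hi ih =>
    simp only [Finset.prod_insert hi]
    exact (hf i (Finset.mem_insert_self i s)).mul (ih fun j hj => hf j (Finset.mem_insert_of_mem hj))

theorem SmoothOn.det {n : ℕ} {M : X → Matrix (Fin n) (Fin n) ℂ}
    (hM : ∀ i j, SmoothOn V (fun x => M x i j) U) : SmoothOn V (fun x => (M x).det) U := by
  simp only [Matrix.det_apply']
  exact SmoothOn.sum _ fun σ _ => SmoothOn.mul contMDiffOn_const (SmoothOn.prod _ fun i _ => hM _ _)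

variable [FiniteDimensional ℂ F]

theorem SmoothOn.coord {g : X → F} (hg : SmoothOn V g U) (ℓ : F →ₗ[ℂ] ℂ) :
    SmoothOn V (fun x => ℓ (g x)) U :=
  haveI : FiniteDimensional ℝ F := FiniteDimensional.complexToReal F
  (LinearMap.toContinuousLinearMap (ℓ.restrictScalars ℝ)).contDiff.contMDiff.comp_contMDiffOn hg

theorem SmoothOn.of_coord {g : X → F}
    (hg : ∀ i, SmoothOn V (fun x => (Module.finBasis ℂ F).coord i (g x)) U) : SmoothOn V g U := by
  have h : g = fun x => ∑ i, (Module.finBasis ℂ F).coord i (g x) • Module.finBasis ℂ F i :=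
    funext fun x => ((Module.finBasis ℂ F).sum_repr (g x)).symm
  rw [h]
  exact SmoothOn.sum _ fun i _ => (hg i).smul contMDiffOn_const

end Scalar

variable (V : Type*) [NormedAddCommGroup V] [NormedSpace ℂ V]
variable {X : Type*} [TopologicalSpace X] [ChartedSpace V X]

section Defs

variable (F : Type*) [NormedAddCommGroup F] [NormedSpace ℂ F]
  (E : X → Type*) [∀ x, AddCommGroup (E x)] [∀ x, Module ℂ (E x)]
  [TopologicalSpace (Bundle.TotalSpace F E)] [∀ x, TopologicalSpace (E x)]
  [FiberBundle F E] [VectorBundle ℂ F E]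
variable (F' : Type*) [NormedAddCommGroup F'] [NormedSpace ℂ F']
  (E' : X → Type*) [∀ x, AddCommGroup (E' x)] [∀ x, Module ℂ (E' x)]
  [TopologicalSpace (Bundle.TotalSpace F' E')] [∀ x, TopologicalSpace (E' x)]
  [FiberBundle F' E'] [VectorBundle ℂ F' E']

/-- A complex vector bundle on `X` is smooth if its coordinate changes are smooth in the real
sense. -/
class SmoothComplexBundle : Prop where
  smoothOn_coordChangeL : ∀ (e e' : Bundle.Trivialization F (Bundle.TotalSpace.proj (E := E)))
    [MemTrivializationAtlas e] [MemTrivializationAtlas e'],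
    SmoothOn V (fun x => (e.coordChangeL ℂ e' x : F →L[ℂ] F)) (e.baseSet ∩ e'.baseSet)

instance : Module (SmoothFun V X) ((x : X) → E x) :=
  inferInstanceAs (Module (smoothFunAlg V X) ((x : X) → E x))

/-- The smooth sections of a vector bundle, as a submodule of all sections. -/
def sectModule : Submodule (SmoothFun V X) ((x : X) → E x) where
  carrier := {s | ∀ (e : Bundle.Trivialization F (Bundle.TotalSpace.proj (E := E)))
    [MemTrivializationAtlas e], SmoothOn V (fun x => e.linearMapAt ℂ x (s x)) e.baseSet}
  add_mem' := fun {s t} hs ht e _ => by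
    simp only [Pi.add_apply, map_add]
    exact (hs e).add (ht e)
  zero_mem' := fun e _ => by
    simpa only [Pi.zero_apply, map_zero] using contMDiffOn_const
  smul_mem' := fun f s hs e _ => by
    change SmoothOn V (fun x => e.linearMapAt ℂ x (f.1 x • s x)) e.baseSet
    simp only [map_smul]
    exact SmoothOn.smul f.2.contMDiffOn (hs e)

/-- The module of smooth sections of a vector bundle. -/
def Sect : Type _ := sectModule V F E

instance : AddCommGroup (Sect V F E) := inferInstanceAs (AddCommGroup (sectModule V F E))

instance : Module (SmoothFun V X) (Sect V F E) :=
  inferInstanceAs (Module (SmoothFun V X) (sectModule V F E))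

/-- The smooth homomorphisms between two vector bundles: families of linear maps of the
fibres with smooth matrix coefficients in local trivializations. -/
def homSectModule : Submodule (SmoothFun V X) ((x : X) → E x →ₗ[ℂ] E' x) where
  carrier := {L | ∀ (e : Bundle.Trivialization F (Bundle.TotalSpace.proj (E := E)))
    (e' : Bundle.Trivialization F' (Bundle.TotalSpace.proj (E := E')))
    [MemTrivializationAtlas e] [MemTrivializationAtlas e'] (v : F),
    SmoothOn V (fun x => e'.linearMapAt ℂ x (L x (e.symmₗ ℂ x v))) (e.baseSet ∩ e'.baseSet)}
  add_mem' := fun {s t} hs ht e e' _ _ v => by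
    simp only [Pi.add_apply, LinearMap.add_apply, map_add]
    exact (hs e e' v).add (ht e e' v)
  zero_mem' := fun e e' _ _ v => by
    simpa only [Pi.zero_apply, LinearMap.zero_apply, map_zero] using contMDiffOn_const
  smul_mem' := fun f s hs e e' _ _ v => by
    change SmoothOn V (fun x => e'.linearMapAt ℂ x (f.1 x • s x (e.symmₗ ℂ x v))) _
    simp only [map_smul]
    exact SmoothOn.smul f.2.contMDiffOn (hs e e' v)

/-- The module of smooth homomorphisms between two vector bundles. -/
def HomSect : Type _ := homSectModule V F E F' E'

instance : AddCommGroup (HomSect V F E F' E') :=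
  inferInstanceAs (AddCommGroup (homSectModule V F E F' E'))

instance : Module (SmoothFun V X) (HomSect V F E F' E') :=
  inferInstanceAs (Module (SmoothFun V X) (homSectModule V F E F' E'))

/-- A smooth Hermitian metric on a vector bundle, conjugate-linear in the first argument. -/
structure HermitianMetric where
  /-- the inner product on each fibre -/
  form : (x : X) → E x →ₗ⋆[ℂ] E x →ₗ[ℂ] ℂ
  symm : ∀ x v w, form x v w = starRingEnd ℂ (form x w v)
  pos : ∀ x v, v ≠ 0 → 0 < (form x v v).re
  smooth : ∀ (e : Bundle.Trivialization F (Bundle.TotalSpace.proj (E := E)))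
    [MemTrivializationAtlas e] (v w : F),
    SmoothOn V (fun x => form x (e.symmₗ ℂ x v) (e.symmₗ ℂ x w)) e.baseSet

end Defs

variable {V}
variable {F : Type*} [NormedAddCommGroup F] [NormedSpace ℂ F]
  {E : X → Type*} [∀ x, AddCommGroup (E x)] [∀ x, Module ℂ (E x)]
  [TopologicalSpace (Bundle.TotalSpace F E)] [∀ x, TopologicalSpace (E x)]
  [FiberBundle F E] [VectorBundle ℂ F E]
variable {F' : Type*} [NormedAddCommGroup F'] [NormedSpace ℂ F']
  {E' : X → Type*} [∀ x, AddCommGroup (E' x)] [∀ x, Module ℂ (E' x)]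
  [TopologicalSpace (Bundle.TotalSpace F' E')] [∀ x, TopologicalSpace (E' x)]
  [FiberBundle F' E'] [VectorBundle ℂ F' E']

theorem HermitianMetric.definite (h : HermitianMetric V F E) {x : X} {v : E x}
    (hv : h.form x v v = 0) : v = 0 := by
  by_contra hne
  have := h.pos x v hne
  rw [hv] at this
  simp at this

theorem HermitianMetric.nondeg (h : HermitianMetric V F E) {x : X} {g g' : E x}
    (hgg : ∀ v, h.form x v g = h.form x v g') : g = g' := by
  refine sub_eq_zero.1 (h.definite ?_)
  rw [map_sub, hgg, sub_self]

variable [FiniteDimensional ℂ F]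

theorem sect_expand (e : Bundle.Trivialization F (Bundle.TotalSpace.proj (E := E)))
    [MemTrivializationAtlas e] {x : X} (hx : x ∈ e.baseSet) (v : E x) :
    v = ∑ i, (Module.finBasis ℂ F).coord i (e.linearMapAt ℂ x v) •
      e.symmₗ ℂ x (Module.finBasis ℂ F i) := by
  conv_lhs => rw [← e.symmₗ_linearMapAt (R := ℂ) hx v,
    ← (Module.finBasis ℂ F).sum_repr (e.linearMapAt ℂ x v), map_sum]
  simp only [map_smul]
  rfl

theorem HermitianMetric.smoothOn_pair (h : HermitianMetric V F E)
    (e : Bundle.Trivialization F (Bundle.TotalSpace.proj (E := E)))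
    [MemTrivializationAtlas e] {U : Set X} (hU : U ⊆ e.baseSet) {s t : (x : X) → E x}
    (hs : SmoothOn V (fun x => e.linearMapAt ℂ x (s x)) U)
    (ht : SmoothOn V (fun x => e.linearMapAt ℂ x (t x)) U) :
    SmoothOn V (fun x => h.form x (s x) (t x)) U := by
  have key : SmoothOn V (fun x => ∑ i, ∑ j,
      starRingEnd ℂ ((Module.finBasis ℂ F).coord i (e.linearMapAt ℂ x (s x))) *
        ((Module.finBasis ℂ F).coord j (e.linearMapAt ℂ x (t x)) *
          h.form x (e.symmₗ ℂ x (Module.finBasis ℂ F i)) (e.symmₗ ℂ x (Module.finBasis ℂ F j)))) U :=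
    SmoothOn.sum _ fun i _ => SmoothOn.sum _ fun j _ =>
      (hs.coord _).conj.mul ((ht.coord _).mul ((h.smooth e _ _).mono hU))
  refine key.congr (fun x hx => ?_)
  conv_lhs => rw [sect_expand e (hU hx) (s x), sect_expand e (hU hx) (t x)]
  simp only [map_sum, LinearMap.sum_apply, map_smul, LinearMap.map_smulₛₗ, LinearMap.smul_apply,
    smul_eq_mul, Finset.mul_sum]
  rw [Finset.sum_comm]
  refine Finset.sum_congr rfl fun i _ => Finset.sum_congr rfl fun j _ => ?_
  ring

/-- The function `h(s,t)` for two smooth sections. -/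
def HermitianMetric.pair (h : HermitianMetric V F E) (s t : Sect V F E) : SmoothFun V X :=
  ⟨fun x => h.form x (s.1 x) (t.1 x), fun x =>
    (h.smoothOn_pair (trivializationAt F E x) subset_rfl (s.2 _) (t.2 _)).contMDiffAt
      ((trivializationAt F E x).open_baseSet.mem_nhds (mem_baseSet_trivializationAt F E x))⟩

/-- The action of a bundle homomorphism on a section. -/
def HomSect.app (L : HomSect V F E F' E') (s : Sect V F E) : Sect V F' E' :=
  ⟨fun x => L.1 x (s.1 x), fun e' _ x hx => by
    refine ContMDiffAt.contMDiffWithinAt ?_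
    have key : SmoothOn V (fun z => ∑ i, (Module.finBasis ℂ F).coord i
        ((trivializationAt F E x).linearMapAt ℂ z (s.1 z)) •
        e'.linearMapAt ℂ z (L.1 z ((trivializationAt F E x).symmₗ ℂ z (Module.finBasis ℂ F i))))
        ((trivializationAt F E x).baseSet ∩ e'.baseSet) :=
      SmoothOn.sum _ fun i _ => SmoothOn.smul
        (SmoothOn.coord ((s.2 (trivializationAt F E x)).mono Set.inter_subset_left) _) (L.2 _ _ _)
    refine (key.congr (fun z hz => ?_)).contMDiffAt
      (((trivializationAt F E x).open_baseSet.inter e'.open_baseSet).mem_nhds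
        ⟨mem_baseSet_trivializationAt F E x, hx⟩)
    change e'.linearMapAt ℂ z (L.1 z (s.1 z)) = _
    conv_lhs => rw [sect_expand (trivializationAt F E x) hz.1 (s.1 z)]
    simp only [map_sum, map_smul]⟩

/-- A section whose products with the vectors of local frames are smooth is smooth. -/
theorem HermitianMetric.smoothOn_of_pair (h : HermitianMetric V F E)
    (e : Bundle.Trivialization F (Bundle.TotalSpace.proj (E := E)))
    [MemTrivializationAtlas e] {U : Set X} (hU : U ⊆ e.baseSet) {g : (x : X) → E x}
    (hg : ∀ v : F, SmoothOn V (fun x => h.form x (e.symmₗ ℂ x v) (g x)) U) :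
    SmoothOn V (fun x => e.linearMapAt ℂ x (g x)) U := by
  set b := Module.finBasis ℂ F with hb
  set G : X → Matrix (Fin (Module.finrank ℂ F)) (Fin (Module.finrank ℂ F)) ℂ := fun x =>
    Matrix.of fun i j => h.form x (e.symmₗ ℂ x (b i)) (e.symmₗ ℂ x (b j)) with hG
  set y : X → Fin (Module.finrank ℂ F) → ℂ := fun x i => h.form x (e.symmₗ ℂ x (b i)) (g x) with hy
  set c : X → Fin (Module.finrank ℂ F) → ℂ := fun x j => b.coord j (e.linearMapAt ℂ x (g x)) with hc
  have hGs : ∀ i j, SmoothOn V (fun x => G x i j) U := fun i j => (h.smooth e _ _).mono hU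
  have hmul : ∀ x ∈ U, ∀ d : Fin (Module.finrank ℂ F) → ℂ, ∀ i,
      (G x).mulVec d i = h.form x (e.symmₗ ℂ x (b i)) (∑ j, d j • e.symmₗ ℂ x (b j)) :=
    fun x hx d i => by
      simp only [Matrix.mulVec, dotProduct, hG, Matrix.of_apply, map_sum, map_smul, smul_eq_mul]
      exact Finset.sum_congr rfl fun j _ => mul_comm _ _
  have hGc : ∀ x ∈ U, (G x).mulVec (c x) = y x := fun x hx => funext fun i => by
    rw [hmul x hx, ← sect_expand e (hU hx) (g x)]
  have hdet : ∀ x ∈ U, (G x).det ≠ 0 := fun x hx h0 => by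
    obtain ⟨d, hd, hd0⟩ := Matrix.exists_mulVec_eq_zero_iff.2 h0
    have h1 : ∀ i, h.form x (e.symmₗ ℂ x (b i)) (∑ j, d j • e.symmₗ ℂ x (b j)) = 0 := fun i => by
      rw [← hmul x hx, hd0]; rfl
    have h2 : h.form x (∑ j, d j • e.symmₗ ℂ x (b j)) (∑ j, d j • e.symmₗ ℂ x (b j)) = 0 := by
      conv_lhs => arg 1; rw [map_sum]
      simp only [LinearMap.map_smulₛₗ, LinearMap.sum_apply, LinearMap.smul_apply, h1, smul_zero,
        Finset.sum_const_zero]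
    have h3 := h.definite h2
    apply hd
    have h4 : ∑ j, d j • b j = 0 := by
      have := congrArg (e.linearMapAt ℂ x) h3
      simp only [map_sum, map_smul, map_zero, e.linearMapAt_symmₗ (R := ℂ) (hU hx)] at this
      exact this
    funext j
    have h5 := congrArg (fun v => b.repr v j) h4
    simpa [Finsupp.single_apply] using h5
  refine SmoothOn.of_coord fun j => ?_
  have hcr : SmoothOn V (fun x => ((G x).det)⁻¹ * ((G x).updateCol j (y x)).det) U := by
    refine ((SmoothOn.det hGs).inv hdet).mul (SmoothOn.det fun i k => ?_)
    by_cases hk : k = j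
    · subst hk
      simpa only [Matrix.updateCol_self] using hg (b i)
    · simpa only [Matrix.updateCol_ne hk] using hGs i k
  refine hcr.congr fun x hx => ?_
  have h6 : ((G x).updateCol j (y x)).det = (G x).det * c x j := by
    rw [← Matrix.cramer_apply, ← hGc x hx, Matrix.cramer_eq_adjugate_mulVec, Matrix.mulVec_mulVec,
      Matrix.adjugate_mul, Matrix.smul_mulVec, Matrix.one_mulVec]
    rfl
  rw [h6, ← mul_assoc, inv_mul_cancel₀ (hdet x hx), one_mul]

/-- Existence of adjoints of linear maps on fibres. -/
theorem HermitianMetric.exists_adjoint (h : HermitianMetric V F E) (h' : HermitianMetric V F' E')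
    (x : X) (T : E x →ₗ[ℂ] E' x) :
    ∃ S : E' x →ₗ[ℂ] E x, ∀ v w, h'.form x (T v) w = h.form x v (S w) := by
  have e := (trivializationAt F E x).linearEquivAt ℂ x (mem_baseSet_trivializationAt F E x)
  have : FiniteDimensional ℂ (E x) := e.symm.finiteDimensional
  have : FiniteDimensional ℝ (E x) := FiniteDimensional.complexToReal _
  have : FiniteDimensional ℝ (Module.Dual ℂ (E x)) := FiniteDimensional.complexToReal _
  let Φ : E x →ₗ[ℝ] Module.Dual ℂ (E x) :=
    { toFun := fun g => h.form x g
      map_add' := map_add _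
      map_smul' := fun r g => by
        change h.form x ((r : ℂ) • g) = (r : ℂ) • h.form x g
        rw [LinearMap.map_smulₛₗ, Complex.conj_ofReal] }
  have hinj : Function.Injective Φ := by
    rw [← LinearMap.ker_eq_bot, LinearMap.ker_eq_bot']
    intro g hg
    exact h.definite (congrArg (fun φ : Module.Dual ℂ (E x) => φ g) hg)
  have hsurj : Function.Surjective Φ := by
    refine (LinearMap.injective_iff_surjective_of_finrank_eq_finrank ?_).1 hinj
    rw [finrank_real_of_complex, finrank_real_of_complex, Subspace.dual_finrank_eq]
  have hex : ∀ w : E' x, ∃ g : E x, ∀ v, h'.form x (T v) w = h.form x v g := fun w => by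
    obtain ⟨g, hg⟩ := hsurj ((h'.form x w) ∘ₗ T)
    refine ⟨g, fun v => ?_⟩
    have := congrArg (fun φ : Module.Dual ℂ (E x) => φ v) hg
    change h.form x g v = h'.form x w (T v) at this
    rw [h'.symm, ← this, ← h.symm]
  choose S hS using hex
  exact ⟨{ toFun := S
           map_add' := fun w w' => h.nondeg fun v => by
            rw [map_add, ← hS, ← hS, ← hS, map_add]
           map_smul' := fun c w => h.nondeg fun v => by
            rw [RingHom.id_apply, map_smul, ← hS, ← hS, map_smul] }, fun v w => hS w v⟩

variable [FiniteDimensional ℂ F']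

/-- The adjoint of a bundle homomorphism with respect to Hermitian metrics: it is characterized by
`h'(L v, w) = h(v, L* w)`. -/
def HomSect.adjoint (h : HermitianMetric V F E) (h' : HermitianMetric V F' E')
    (L : HomSect V F E F' E') : HomSect V F' E' F E :=
  ⟨fun x => (h.exists_adjoint h' x (L.1 x)).choose, fun e' e _ _ w => by
    refine h.smoothOn_of_pair e Set.inter_subset_right fun v => ?_
    have hs := h'.smoothOn_pair e' (U := e'.baseSet ∩ e.baseSet) Set.inter_subset_left
      (s := fun x => L.1 x (e.symmₗ ℂ x v)) (t := fun x => e'.symmₗ ℂ x w)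
      ((L.2 e e' v).mono fun x hx => ⟨hx.2, hx.1⟩)
      ((contMDiffOn_const (c := w)).congr fun x hx => e'.linearMapAt_symmₗ (R := ℂ) hx.1 w)
    exact hs.congr fun x _ => ((h.exists_adjoint h' x (L.1 x)).choose_spec _ _).symm⟩

theorem HomSect.adjoint_spec (h : HermitianMetric V F E) (h' : HermitianMetric V F' E')
    (L : HomSect V F E F' E') (x : X) (v : E x) (w : E' x) :
    h'.form x (L.1 x v) w = h.form x v ((HomSect.adjoint h h' L).1 x w) :=
  (h.exists_adjoint h' x (L.1 x)).choose_spec v w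

end Bundles
/-! ### Forms with values in graded bundles, superconnections, cohesive modules -/

section Graded

universe u v w z

/-- A finite-dimensional `ℤ`-graded smooth complex vector bundle `E^•` on `X`: smooth complex
vector bundles `E^k`, only finitely many of which are non-zero. -/
structure GradedBundle (V : Type u) [NormedAddCommGroup V] [NormedSpace ℂ V]
    (X : Type v) [TopologicalSpace X] [ChartedSpace V X] where
  /-- the model fibre in degree `k` -/
  fib : ℤ → Type w
  /-- the fibres of the bundle in degree `k` -/
  bundle : ℤ → X → Type z
  [fibNormed : ∀ k, NormedAddCommGroup (fib k)]
  [fibSpace : ∀ k, NormedSpace ℂ (fib k)]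
  [fibFinite : ∀ k, FiniteDimensional ℂ (fib k)]
  [addCommGroup : ∀ k x, AddCommGroup (bundle k x)]
  [module : ∀ k x, Module ℂ (bundle k x)]
  [topTotal : ∀ k, TopologicalSpace (Bundle.TotalSpace (fib k) (bundle k))]
  [topFibre : ∀ k x, TopologicalSpace (bundle k x)]
  [fiberBundle : ∀ k, FiberBundle (fib k) (bundle k)]
  [vectorBundle : ∀ k, VectorBundle ℂ (fib k) (bundle k)]
  [smoothBundle : ∀ k, SmoothComplexBundle V (fib k) (bundle k)]
  finite : {k : ℤ | Nontrivial (fib k)}.Finite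

attribute [instance] GradedBundle.fibNormed GradedBundle.fibSpace GradedBundle.fibFinite
  GradedBundle.addCommGroup GradedBundle.module GradedBundle.topTotal GradedBundle.topFibre
  GradedBundle.fiberBundle GradedBundle.vectorBundle GradedBundle.smoothBundle

variable {V : Type u} [NormedAddCommGroup V] [NormedSpace ℂ V] [FiniteDimensional ℂ V]
variable {X : Type v} [TopologicalSpace X] [ChartedSpace V X] [IsManifold 𝓘(ℂ, V) ω X]

namespace GradedBundle

variable (E : GradedBundle.{u, v, w, z} V X)

/-- Smooth sections of `E^k`. -/
abbrev Sec (k : ℤ) : Type _ := Sect V (E.fib k) (E.bundle k)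

/-- Smooth homomorphisms from `E^k` to `E^l`. -/
abbrev Hom (k l : ℤ) : Type _ := HomSect V (E.fib k) (E.bundle k) (E.fib l) (E.bundle l)

/-- The space `A^0(X, E^•)` of smooth sections of `E^•`. -/
def Sections : Type _ := ⨁ k : ℤ, E.Sec k

/-- The space `A^•(X, E^•)` of smooth forms with values in `E^•`: the direct sum of the tensor
products `A^0(X, E^k) ⊗ A^•(X)` over the smooth functions. -/
def Forms : Type _ := ⨁ k : ℤ, (E.Sec k ⊗[SmoothFun V X] Form V X)

/-- The space `A^•(X, End^• E)`: the direct sum of the tensor products of the homomorphisms from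
`E^k` to `E^l` with `A^•(X)`; the summand with index `(k,l)` lies in `End^{l-k} E`. -/
def EndForms : Type _ := ⨁ p : ℤ × ℤ, (E.Hom p.1 p.2 ⊗[SmoothFun V X] Form V X)

instance : AddCommGroup E.Sections := inferInstanceAs (AddCommGroup (⨁ k : ℤ, E.Sec k))

instance : AddCommGroup E.Forms :=
  inferInstanceAs (AddCommGroup (⨁ k : ℤ, (E.Sec k ⊗[SmoothFun V X] Form V X)))

instance : AddCommGroup E.EndForms :=
  inferInstanceAs (AddCommGroup (⨁ p : ℤ × ℤ, (E.Hom p.1 p.2 ⊗[SmoothFun V X] Form V X)))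

instance : Module (SmoothFun V X) E.Sections :=
  inferInstanceAs (Module (SmoothFun V X) (⨁ k : ℤ, E.Sec k))

instance : Module (SmoothFun V X) E.Forms :=
  inferInstanceAs (Module (SmoothFun V X) (⨁ k : ℤ, (E.Sec k ⊗[SmoothFun V X] Form V X)))

instance : Module (SmoothFun V X) E.EndForms :=
  inferInstanceAs (Module (SmoothFun V X)
    (⨁ p : ℤ × ℤ, (E.Hom p.1 p.2 ⊗[SmoothFun V X] Form V X)))

/-- Complex scalars act as constant functions. -/
instance : Module ℂ E.Sections := Module.compHom E.Sections (algebraMap ℂ (SmoothFun V X))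

instance : Module ℂ E.Forms := Module.compHom E.Forms (algebraMap ℂ (SmoothFun V X))

instance : Module ℂ E.EndForms := Module.compHom E.EndForms (algebraMap ℂ (SmoothFun V X))

/-- A section of `E^k` as a section of `E^•`. -/
def ofSec (k : ℤ) : E.Sec k →ₗ[SmoothFun V X] E.Sections :=
  DirectSum.lof (SmoothFun V X) ℤ (fun k => E.Sec k) k

/-- The inclusion of the summand of index `k`. -/
def ofForm (k : ℤ) : (E.Sec k ⊗[SmoothFun V X] Form V X) →ₗ[SmoothFun V X] E.Forms :=
  DirectSum.lof (SmoothFun V X) ℤ (fun k => E.Sec k ⊗[SmoothFun V X] Form V X) k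

/-- The projection to the summand of index `k`. -/
def component (k : ℤ) : E.Forms →ₗ[SmoothFun V X] (E.Sec k ⊗[SmoothFun V X] Form V X) :=
  DirectSum.component (SmoothFun V X) ℤ (fun k => E.Sec k ⊗[SmoothFun V X] Form V X) k

/-- The inclusion of the summand of index `(k,l)`. -/
def ofEndForm (k l : ℤ) : (E.Hom k l ⊗[SmoothFun V X] Form V X) →ₗ[SmoothFun V X] E.EndForms :=
  DirectSum.lof (SmoothFun V X) (ℤ × ℤ)
    (fun p => E.Hom p.1 p.2 ⊗[SmoothFun V X] Form V X) (k, l)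

variable {E}

/-- The additive map on `A^•(X, E^•)` with given restrictions to the summands. -/
def liftForms {M : Type*} [AddCommMonoid M]
    (φ : ∀ k : ℤ, (E.Sec k ⊗[SmoothFun V X] Form V X) →+ M) : E.Forms →+ M :=
  DirectSum.toAddMonoid φ

theorem liftForms_of {M : Type*} [AddCommMonoid M]
    (φ : ∀ k : ℤ, (E.Sec k ⊗[SmoothFun V X] Form V X) →+ M) (k : ℤ)
    (x : E.Sec k ⊗[SmoothFun V X] Form V X) : liftForms φ (E.ofForm k x) = φ k x :=
  DirectSum.toAddMonoid_of φ k x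

/-- The additive map on `A^•(X, End^• E)` with given restrictions to the summands. -/
def liftEndForms {M : Type*} [AddCommMonoid M]
    (φ : ∀ k l : ℤ, (E.Hom k l ⊗[SmoothFun V X] Form V X) →+ M) : E.EndForms →+ M :=
  DirectSum.toAddMonoid fun p => φ p.1 p.2

/-- The element `e ⊗ α` for a section `e` of `E^k` and a form `α`. -/
def tmul (k : ℤ) (e : E.Sec k) (α : Form V X) : E.Forms := E.ofForm k (e ⊗ₜ α)

/-- The element `L ⊗ τ` for a homomorphism `L` from `E^k` to `E^l` and a form `τ`. -/
def endTmul (k l : ℤ) (L : E.Hom k l) (τ : Form V X) : E.EndForms := E.ofEndForm k l (L ⊗ₜ τ)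

variable (E)

/-- Elements of total degree `n`: spanned by `e ⊗ α` with `|e| + |α| = n`. -/
def totalDegree (n : ℤ) : Submodule ℂ E.Forms :=
  Submodule.span ℂ {s | ∃ (k : ℤ) (j : ℕ) (e : E.Sec k) (α : Form V X),
    α ∈ Form.ofDegree V X j ∧ k + j = n ∧ s = tmul k e α}

/-- Elements of exotic degree `n`: spanned by `e ⊗ α` with `e` of degree `k` and `α` of type
`(p,q)`, where `-p + q + k = n`. -/
def exoticDegree (n : ℤ) : Submodule ℂ E.Forms :=
  Submodule.span ℂ {s | ∃ (k : ℤ) (p q : ℕ) (e : E.Sec k) (α : Form V X),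
    α ∈ Form.ofType V X p q ∧ -(p : ℤ) + q + k = n ∧ s = tmul k e α}

/-- Endomorphism-valued forms of exotic degree `n`: spanned by `L ⊗ τ` with `L` of degree `d` and
`τ` of type `(p,q)`, where `-p + q + d = n`. -/
def endExoticDegree (n : ℤ) : Submodule ℂ E.EndForms :=
  Submodule.span ℂ {R | ∃ (k l : ℤ) (p q : ℕ) (L : E.Hom k l) (τ : Form V X),
    τ ∈ Form.ofType V X p q ∧ -(p : ℤ) + q + (l - k) = n ∧ R = endTmul k l L τ}

/-- The space `A^{0,•}(X, E^•)`. -/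
def antiForms : Submodule ℂ E.Forms :=
  Submodule.span ℂ {s | ∃ (k : ℤ) (q : ℕ) (e : E.Sec k) (α : Form V X),
    α ∈ Form.ofType V X 0 q ∧ s = tmul k e α}

/-- The space `A^{•,0}(X, E^•)`. -/
def holoForms : Submodule ℂ E.Forms :=
  Submodule.span ℂ {s | ∃ (k : ℤ) (p : ℕ) (e : E.Sec k) (α : Form V X),
    α ∈ Form.ofType V X p 0 ∧ s = tmul k e α}

variable {E}

theorem tmul_mem_antiForms {k : ℤ} {q : ℕ} (e : E.Sec k) {α : Form V X}
    (hα : α ∈ Form.ofType V X 0 q) : tmul k e α ∈ E.antiForms :=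
  Submodule.subset_span ⟨k, q, e, α, hα, rfl⟩

theorem one_mem_ofType : (1 : Form V X) ∈ Form.ofType V X 0 0 := by
  have := Form.ofFun_mem_ofType (1 : SmoothFun V X)
  rwa [map_one] at this

/-- Right multiplication `s ↦ s ∧ α` on forms with values in `E^•`. -/
def rmul (α : Form V X) : E.Forms →+ E.Forms :=
  liftForms fun k => ((E.ofForm k) ∘ₗ
    (LinearMap.lTensor (E.Sec k) (LinearMap.mulRight (SmoothFun V X) α))).toAddMonoidHom

theorem rmul_tmul (α : Form V X) (k : ℤ) (e : E.Sec k) (β : Form V X) :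
    rmul α (tmul k e β) = tmul k e (β * α) :=
  liftForms_of _ _ _

/-- An additive identity on `A^•(X, E^•)` may be checked on the elements `e ⊗ α`. -/
theorem forms_ext {M : Type*} [AddCommMonoid M] {f g : E.Forms →+ M}
    (h : ∀ k e α, f (tmul k e α) = g (tmul k e α)) : f = g := by
  refine DirectSum.addHom_ext' fun k => AddMonoidHom.ext fun x => ?_
  induction x using TensorProduct.induction_on with
  | zero => simp
  | tmul e α => exact h k e α
  | add x y hx hy => rw [map_add, map_add, hx, hy]

theorem fun_smul_tmul (f : SmoothFun V X) (k : ℤ) (e : E.Sec k) (α : Form V X) :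
    f • tmul k e α = tmul k e (f • α) := by
  rw [tmul, ← map_smul, tmul, TensorProduct.tmul_smul]

theorem smul_tmul_fun (f : SmoothFun V X) (k : ℤ) (e : E.Sec k) (α : Form V X) :
    tmul k (f • e) α = tmul k e (f • α) := by
  rw [tmul, tmul, TensorProduct.smul_tmul]

/-- Right multiplication by a function is the module structure. -/
theorem rmul_ofFun (f : SmoothFun V X) (s : E.Forms) : rmul (Form.ofFun f) s = f • s := by
  have : (rmul (Form.ofFun f) : E.Forms →+ E.Forms) = DistribSMul.toAddMonoidHom E.Forms f :=
    forms_ext fun k e α => by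
      change _ = f • tmul k e α
      rw [rmul_tmul, fun_smul_tmul, Algebra.smul_def]
      congr 1
      exact (Algebra.commutes f α).symm
  exact congrArg (fun φ : E.Forms →+ E.Forms => φ s) this

/-- The inclusion `e ↦ e ⊗ 1` of `A^0(X, E^•)` in `A^•(X, E^•)`. -/
def incl : E.Sections →ₗ[SmoothFun V X] E.Forms :=
  DirectSum.toModule (SmoothFun V X) ℤ E.Forms fun k =>
    E.ofForm k ∘ₗ (TensorProduct.mk (SmoothFun V X) (E.Sec k) (Form V X)).flip 1

theorem incl_ofSec (k : ℤ) (e : E.Sec k) : incl (E.ofSec k e) = tmul k e 1 :=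
  DirectSum.toModule_lof _ _ _

theorem incl_mem_antiForms (s : E.Sections) : incl s ∈ E.antiForms := by
  refine DirectSum.induction_on (motive := fun s => incl (E := E) s ∈ E.antiForms) s ?_ ?_ ?_
  · exact (map_zero (incl (E := E))).symm ▸ Submodule.zero_mem _
  · intro k e
    exact (incl_ofSec k e).symm ▸ tmul_mem_antiForms e one_mem_ofType
  · intro x y hx hy
    exact (map_add (incl (E := E)) x y).symm ▸ Submodule.add_mem _ hx hy

end GradedBundle

open GradedBundle

variable (E : GradedBundle.{u, v, w, z} V X)

/-- A cohesive structure on `E^•`: a flat `∂̄`-superconnection of total degree `1`, i.e. a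
`ℂ`-linear operator on `A^{0,•}(X, E^•)` with these properties. -/
structure CohesiveStructure where
  /-- the operator on `A^{0,•}(X, E^•)` -/
  toLin : E.antiForms →ₗ[ℂ] E.antiForms
  total_degree : ∀ (n : ℤ) (s : E.antiForms), (s : E.Forms) ∈ E.totalDegree n →
    (toLin s : E.Forms) ∈ E.totalDegree (n + 1)
  leibniz : ∀ (k : ℤ) (e : E.Sec k) (q : ℕ) (α : Form V X) (hα : α ∈ Form.ofType V X 0 q),
    (toLin ⟨tmul k e α, tmul_mem_antiForms e hα⟩ : E.Forms) =
      rmul α (toLin ⟨tmul k e 1, tmul_mem_antiForms e one_mem_ofType⟩ : E.Forms) +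
        (-1 : ℂ) ^ k • tmul k e (delbar α)
  flat : ∀ s, toLin (toLin s) = 0

/-- A superconnection on `E^•` over an operator `δ` on forms (one of `d`, `∂`, `∂̄`), given on
sections: a `ℂ`-linear map `A^0(X, E^•) → A^•(X, E^•)` with the Leibniz formula
`D(e f) = (D e) f + (-1)^{|e|} e ⊗ δ f`. -/
structure Superconnection (δ : Form V X →ₗ[ℂ] Form V X) where
  /-- the operator on sections -/
  toLin : E.Sections →ₗ[ℂ] E.Forms
  leibniz : ∀ (k : ℤ) (e : E.Sec k) (f : SmoothFun V X),
    toLin (E.ofSec k (f • e)) =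
      rmul (Form.ofFun f) (toLin (E.ofSec k e)) + (-1 : ℂ) ^ k • tmul k e (δ (Form.ofFun f))


end Graded
section Operators

universe u v w z

variable {V : Type u} [NormedAddCommGroup V] [NormedSpace ℂ V] [FiniteDimensional ℂ V]
variable {X : Type v} [TopologicalSpace X] [ChartedSpace V X] [IsManifold 𝓘(ℂ, V) ω X]
variable {E : GradedBundle.{u, v, w, z} V X}

open GradedBundle

theorem rmul_add (α β : Form V X) (s : E.Forms) : rmul (α + β) s = rmul α s + rmul β s := by
  have : (rmul (α + β) : E.Forms →+ E.Forms) = rmul α + rmul β := forms_ext fun k e γ => by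
    rw [AddMonoidHom.add_apply, rmul_tmul, rmul_tmul, rmul_tmul, mul_add, tmul, tmul, tmul,
      TensorProduct.tmul_add, map_add]
  exact congrArg (fun φ : E.Forms →+ E.Forms => φ s) this

theorem rmul_rmul (α β : Form V X) (s : E.Forms) : rmul β (rmul α s) = rmul (α * β) s := by
  have : (rmul β : E.Forms →+ E.Forms).comp (rmul α) = rmul (α * β) := forms_ext fun k e γ => by
    rw [AddMonoidHom.comp_apply, rmul_tmul, rmul_tmul, rmul_tmul, mul_assoc]
  exact congrArg (fun φ : E.Forms →+ E.Forms => φ s) this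

theorem rmul_smul (c : ℂ) (α : Form V X) (s : E.Forms) : rmul α (c • s) = c • rmul α s := by
  have h : ∀ t : E.Forms, c • t = rmul (Form.ofFun (algebraMap ℂ (SmoothFun V X) c)) t :=
    fun t => (rmul_ofFun _ t).symm
  rw [h, h, rmul_rmul, rmul_rmul]
  exact congrArg (fun β => rmul β s) (Algebra.commutes (algebraMap ℂ (SmoothFun V X) c) α)

theorem tmul_add_form (k : ℤ) (e : E.Sec k) (α β : Form V X) :
    tmul k e (α + β) = tmul k e α + tmul k e β := by
  rw [tmul, TensorProduct.tmul_add, map_add]; rfl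

theorem tmul_add_sec (k : ℤ) (e e' : E.Sec k) (α : Form V X) :
    tmul k (e + e') α = tmul k e α + tmul k e' α := by
  rw [tmul, TensorProduct.add_tmul, map_add]; rfl

/-- The extension of a superconnection to all of `A^•(X, E^•)` by the Leibniz formula
`D(e ⊗ α) = (D e) ∧ α + (-1)^{|e|} e ⊗ δ α`. -/
def Superconnection.extend {δ : Form V X →ₗ[ℂ] Form V X}
    (hδ : ∀ (f : SmoothFun V X) (α : Form V X), δ (f • α) = δ (Form.ofFun f) * α + f • δ α)
    (D : Superconnection E δ) : E.Forms →+ E.Forms :=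
  liftForms fun k => TensorProduct.liftAddHom
    (AddMonoidHom.mk' (fun e : E.Sec k => AddMonoidHom.mk'
        (fun α : Form V X => rmul α (D.toLin (E.ofSec k e)) + (-1 : ℂ) ^ k • tmul k e (δ α))
        (fun α β => by rw [rmul_add, map_add, tmul_add_form, smul_add]; abel))
      (fun e e' => AddMonoidHom.ext fun α => by
        simp only [AddMonoidHom.mk'_apply, AddMonoidHom.add_apply]
        rw [map_add, map_add, map_add, tmul_add_sec, smul_add]; abel))
    (fun f e α => by
      simp only [AddMonoidHom.mk'_apply]
      rw [D.leibniz, map_add, rmul_smul, rmul_tmul, rmul_rmul, hδ, tmul_add_form, smul_tmul_fun,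
        smul_add, Algebra.smul_def f α, add_assoc]
      rfl)

theorem Superconnection.extend_tmul {δ : Form V X →ₗ[ℂ] Form V X}
    (hδ : ∀ (f : SmoothFun V X) (α : Form V X), δ (f • α) = δ (Form.ofFun f) * α + f • δ α)
    (D : Superconnection E δ) (k : ℤ) (e : E.Sec k) (α : Form V X) :
    D.extend hδ (tmul k e α) =
      rmul α (D.toLin (E.ofSec k e)) + (-1 : ℂ) ^ k • tmul k e (δ α) :=
  liftForms_of _ _ _

theorem del_fun_smul (f : SmoothFun V X) (α : Form V X) :
    del (f • α) = del (Form.ofFun f) * α + f • del α := Form.diff_fun_smul _ _ f α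

theorem delbar_fun_smul (f : SmoothFun V X) (α : Form V X) :
    delbar (f • α) = delbar (Form.ofFun f) * α + f • delbar α := Form.diff_fun_smul _ _ f α

/-- The inclusion of `A^0(X, E^•)` in `A^{0,•}(X, E^•)`. -/
def inclAnti : E.Sections →ₗ[ℂ] E.antiForms where
  toFun s := ⟨incl s, incl_mem_antiForms s⟩
  map_add' s t := Subtype.ext (map_add incl s t)
  map_smul' c s := Subtype.ext (map_smul incl (algebraMap ℂ (SmoothFun V X) c) s)

/-- The `∂̄`-superconnection of a cohesive structure, restricted to sections. -/
def CohesiveStructure.toSuperconnection (D : CohesiveStructure E) :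
    Superconnection E (delbar (V := V) (X := X)) where
  toLin := E.antiForms.subtype ∘ₗ D.toLin ∘ₗ inclAnti
  leibniz k e f := by
    have h1 : (inclAnti (E.ofSec k (f • e)) : E.antiForms) =
        ⟨tmul k e (Form.ofFun f), tmul_mem_antiForms e (Form.ofFun_mem_ofType f)⟩ :=
      Subtype.ext (by
        change incl (E.ofSec k (f • e)) = _
        rw [incl_ofSec, smul_tmul_fun, Algebra.smul_def, mul_one]; rfl)
    have h2 : (inclAnti (E.ofSec k e) : E.antiForms) =
        ⟨tmul k e 1, tmul_mem_antiForms e one_mem_ofType⟩ := Subtype.ext (incl_ofSec k e)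
    simp only [LinearMap.comp_apply]
    rw [h1, h2]
    exact D.leibniz k e 0 _ (Form.ofFun_mem_ofType f)

/-- The operator `E''` of a cohesive structure on all of `A^•(X, E^•)`. -/
def CohesiveStructure.op (D : CohesiveStructure E) : E.Forms →+ E.Forms :=
  D.toSuperconnection.extend delbar_fun_smul

/-- The operator `E'` of a `∂`-superconnection on all of `A^•(X, E^•)`. -/
def Superconnection.opDel (D : Superconnection E (del (V := V) (X := X))) : E.Forms →+ E.Forms :=
  D.extend del_fun_smul

/-- The extension of `E''` to `A^•(X, E^•)` restricts to the given operator. -/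
theorem CohesiveStructure.op_eq (D : CohesiveStructure E) (s : E.antiForms) :
    D.op (s : E.Forms) = D.toLin s := by
  have key : ∀ t : E.Forms, ∀ ht : t ∈ E.antiForms, D.op t = D.toLin ⟨t, ht⟩ := by
    intro t ht
    induction ht using Submodule.span_induction with
    | mem t h =>
      obtain ⟨k, q, e, α, hα, rfl⟩ := h
      have h2 : (inclAnti (E.ofSec k e) : E.antiForms) =
        ⟨tmul k e 1, tmul_mem_antiForms e one_mem_ofType⟩ := Subtype.ext (incl_ofSec k e)
      rw [CohesiveStructure.op, Superconnection.extend_tmul, D.leibniz k e q α hα, ← h2]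
      rfl
    | zero => rw [map_zero]; exact (congrArg Subtype.val (map_zero D.toLin)).symm
    | add x y hx hy ihx ihy =>
      rw [map_add, ihx, ihy]
      exact (congrArg Subtype.val (map_add D.toLin ⟨x, hx⟩ ⟨y, hy⟩)).symm
    | smul c x hx ih =>
      have hsm : D.op (c • x) = c • D.op x := by
        let f : E.Forms →+ E.Forms := D.op.comp (DistribSMul.toAddMonoidHom E.Forms c)
        let g : E.Forms →+ E.Forms := (DistribSMul.toAddMonoidHom E.Forms c).comp D.op
        have hfg : f = g := forms_ext fun k e α => by
          change D.op (c • tmul k e α) = c • D.op (tmul k e α)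
          have hc : ∀ β : Form V X, c • tmul k e β = tmul k e (c • β) := fun β => by
            change algebraMap ℂ (SmoothFun V X) c • tmul k e β = _
            rw [fun_smul_tmul, algebraMap_smul]
          have hr : ∀ (β : Form V X) (s : E.Forms), rmul (c • β) s = c • rmul β s := fun β s => by
            have e1 : c • β = β * Form.ofFun (algebraMap ℂ (SmoothFun V X) c) := by
              rw [← algebraMap_smul (SmoothFun V X) c β, Algebra.smul_def]
              exact Algebra.commutes _ _
            rw [e1, ← rmul_rmul, rmul_ofFun]; rfl
          rw [hc, CohesiveStructure.op, Superconnection.extend_tmul, Superconnection.extend_tmul,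
            hr, map_smul, smul_add, ← hc, smul_comm]
        exact congrArg (fun φ : E.Forms →+ E.Forms => φ x) hfg
      rw [hsm, ih]
      exact (congrArg Subtype.val (map_smul D.toLin c ⟨x, hx⟩)).symm
  exact key s.1 s.2

/-- A Hermitian metric on `E^•` for which the bundles `E^k` are mutually orthogonal, i.e. a
Hermitian metric on each `E^k`. -/
abbrev GradedMetric (E : GradedBundle.{u, v, w, z} V X) : Type _ :=
  ∀ k : ℤ, HermitianMetric V (E.fib k) (E.bundle k)

section Metric

variable {k l : ℤ}

theorem pair_add_left (h : HermitianMetric V (E.fib k) (E.bundle k)) (s s' t : E.Sec k) :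
    h.pair (s + s') t = h.pair s t + h.pair s' t :=
  Subtype.ext (funext fun x => by
    change h.form x (s.1 x + s'.1 x) (t.1 x) = _
    rw [map_add]; rfl)

theorem pair_add_right (h : HermitianMetric V (E.fib k) (E.bundle k)) (s t t' : E.Sec k) :
    h.pair s (t + t') = h.pair s t + h.pair s t' :=
  Subtype.ext (funext fun x => map_add (h.form x (s.1 x)) (t.1 x) (t'.1 x))

theorem pair_smul_left (h : HermitianMetric V (E.fib k) (E.bundle k)) (f : SmoothFun V X)
    (s t : E.Sec k) : h.pair (f • s) t = SmoothFun.conj f * h.pair s t :=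
  Subtype.ext (funext fun x => by
    change h.form x (f.1 x • s.1 x) (t.1 x) = starRingEnd ℂ (f.1 x) * h.form x (s.1 x) (t.1 x)
    rw [LinearMap.map_smulₛₗ]; rfl)

theorem pair_smul_right (h : HermitianMetric V (E.fib k) (E.bundle k)) (f : SmoothFun V X)
    (s t : E.Sec k) : h.pair s (f • t) = f * h.pair s t :=
  Subtype.ext (funext fun x => map_smul (h.form x (s.1 x)) (f.1 x) (t.1 x))

theorem tensor_addHom_ext {M : Type*} [AddCommGroup M]
    {f g : (E.Sec k ⊗[SmoothFun V X] Form V X) →+ M}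
    (hfg : ∀ e α, f (e ⊗ₜ α) = g (e ⊗ₜ α)) : f = g :=
  AddMonoidHom.ext fun t => by
    induction t using TensorProduct.induction_on with
    | zero => rw [map_zero, map_zero]
    | tmul e α => exact hfg e α
    | add a b ha hb => rw [map_add, map_add, ha, hb]

/-- The pairing `h(e ⊗ α, f ⊗ η) = α* ∧ h(e,f) ∧ η` for sections of a single bundle `E^k`. -/
def formPairing (h : HermitianMetric V (E.fib k) (E.bundle k)) :
    (E.Sec k ⊗[SmoothFun V X] Form V X) →+ (E.Sec k ⊗[SmoothFun V X] Form V X) →+ Form V X :=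
  TensorProduct.liftAddHom
    (AddMonoidHom.mk' (fun e : E.Sec k => AddMonoidHom.mk' (fun α : Form V X =>
        TensorProduct.liftAddHom
          (AddMonoidHom.mk' (fun f : E.Sec k => AddMonoidHom.mk'
              (fun η : Form V X => Form.star α * Form.ofFun (h.pair e f) * η)
              (fun η η' => mul_add _ _ _))
            (fun f f' => AddMonoidHom.ext fun η => by
              simp only [AddMonoidHom.mk'_apply, AddMonoidHom.add_apply]
              rw [pair_add_right, map_add, mul_add, add_mul]))
          (fun r f η => by
            simp only [AddMonoidHom.mk'_apply]
            rw [pair_smul_right, mul_comm r, map_mul, Algebra.smul_def]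
            simp only [mul_assoc]
            rfl))
        (fun α α' => by
          refine tensor_addHom_ext fun f η => ?_
          simp only [AddMonoidHom.add_apply]
          change Form.star (α + α') * _ * _ = Form.star α * _ * _ + Form.star α' * _ * _
          rw [map_add, add_mul, add_mul]))
      (fun e e' => AddMonoidHom.ext fun α => tensor_addHom_ext fun f η => by
        change Form.star α * Form.ofFun (h.pair (e + e') f) * η =
          Form.star α * Form.ofFun (h.pair e f) * η + Form.star α * Form.ofFun (h.pair e' f) * η
        rw [pair_add_left, map_add, mul_add, add_mul]))
    (fun r e α => tensor_addHom_ext fun f η => by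
      change Form.star α * Form.ofFun (h.pair (r • e) f) * η =
        Form.star (r • α) * Form.ofFun (h.pair e f) * η
      rw [pair_smul_left, map_mul, Form.star_smul, Algebra.smul_def, ← mul_assoc]
      congr 2
      exact (Algebra.commutes (SmoothFun.conj r) (Form.star α)).symm)

/-- The extension of a Hermitian metric to `A^•(X, E^•)`, with values in `A^•(X)`:
`h(e ⊗ α, f ⊗ η) = α* ∧ h(e,f) ∧ η`, and `h(e ⊗ α, f ⊗ η) = 0` if `e` and `f` have different
degrees. -/
def GradedMetric.pairing (h : GradedMetric E) : E.Forms →+ E.Forms →+ Form V X :=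
  liftForms fun k => AddMonoidHom.mk'
    (fun s => (formPairing (h k) s).comp (E.component k).toAddMonoidHom)
    (fun s t => AddMonoidHom.ext fun r => by
      rw [map_add]; rfl)

end Metric

/-- A bundle homomorphism as a linear map on sections. -/
def homApp (k l : ℤ) : E.Hom k l →ₗ[SmoothFun V X] E.Sec k →ₗ[SmoothFun V X] E.Sec l where
  toFun L :=
    { toFun := fun s => HomSect.app L s
      map_add' := fun s t => Subtype.ext (funext fun x => map_add (L.1 x) (s.1 x) (t.1 x))
      map_smul' := fun f s => Subtype.ext (funext fun x => map_smul (L.1 x) (f.1 x) (s.1 x)) }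
  map_add' _ _ := LinearMap.ext fun _ => Subtype.ext (funext fun _ => rfl)
  map_smul' _ _ := LinearMap.ext fun _ => Subtype.ext (funext fun _ => rfl)

/-- The action of `L ⊗ τ` on `e ⊗ α` for fixed degrees. -/
def homFormAct (k l : ℤ) : (E.Hom k l ⊗[SmoothFun V X] Form V X) →ₗ[SmoothFun V X]
    (E.Sec k ⊗[SmoothFun V X] Form V X) →ₗ[SmoothFun V X]
      (E.Sec l ⊗[SmoothFun V X] Form V X) :=
  TensorProduct.lift
    ((TensorProduct.mapBilinear (RingHom.id (SmoothFun V X)) (E.Sec k) (Form V X) (E.Sec l) (Form V X)).compl₁₂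
      (homApp k l) (LinearMap.mul (SmoothFun V X) (Form V X) ∘ₗ Form.twist k))

/-- The action of `A^•(X, End^• E)` on `A^•(X, E^•)`:
`(L ⊗ τ)(e ⊗ α) = (-1)^{|τ||e|} (L e) ⊗ (τ ∧ α)`. -/
def endAct : E.EndForms →+ E.Forms →+ E.Forms :=
  liftEndForms fun k l => AddMonoidHom.mk'
    (fun R => (E.ofForm l ∘ₗ homFormAct k l R ∘ₗ E.component k).toAddMonoidHom)
    (fun R R' => AddMonoidHom.ext fun s => by
      rw [map_add]
      change E.ofForm l (homFormAct k l R (E.component k s) +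
        homFormAct k l R' (E.component k s)) = _
      rw [map_add]; rfl)

theorem adjoint_add {k l : ℤ} (h : GradedMetric E) (L L' : E.Hom k l) :
    HomSect.adjoint (h k) (h l) (L + L') =
      HomSect.adjoint (h k) (h l) L + HomSect.adjoint (h k) (h l) L' :=
  Subtype.ext (funext fun x => LinearMap.ext fun w => (h k).nondeg fun v => by
    rw [← HomSect.adjoint_spec]
    change (h l).form x (L.1 x v + L'.1 x v) w = (h k).form x v
      ((HomSect.adjoint (h k) (h l) L).1 x w + (HomSect.adjoint (h k) (h l) L').1 x w)
    rw [map_add, map_add, ← HomSect.adjoint_spec, ← HomSect.adjoint_spec]; rfl)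

theorem adjoint_smul {k l : ℤ} (h : GradedMetric E) (f : SmoothFun V X) (L : E.Hom k l) :
    HomSect.adjoint (h k) (h l) (f • L) =
      SmoothFun.conj f • HomSect.adjoint (h k) (h l) L :=
  Subtype.ext (funext fun x => LinearMap.ext fun w => (h k).nondeg fun v => by
    rw [← HomSect.adjoint_spec]
    change (h l).form x (f.1 x • L.1 x v) w = (h k).form x v
      (starRingEnd ℂ (f.1 x) • (HomSect.adjoint (h k) (h l) L).1 x w)
    rw [LinearMap.map_smulₛₗ, map_smul, ← HomSect.adjoint_spec]; rfl)

/-- The involution on `A^•(X, End^• E)` defined by a Hermitian metric: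
`(L ⊗ τ)* = (-1)^{|L||τ|} L* ⊗ τ*`. -/
def GradedMetric.star (h : GradedMetric E) : E.EndForms →+ E.EndForms :=
  liftEndForms fun k l => TensorProduct.liftAddHom
    (AddMonoidHom.mk' (fun L : E.Hom k l => AddMonoidHom.mk' (fun τ : Form V X =>
        endTmul l k (HomSect.adjoint (h k) (h l) L) (Form.star (Form.twist (l - k) τ)))
        (fun τ τ' => by
          rw [map_add, map_add, endTmul, TensorProduct.tmul_add, map_add]; rfl))
      (fun L L' => AddMonoidHom.ext fun τ => by
        change endTmul l k (HomSect.adjoint (h k) (h l) (L + L')) _ = _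
        rw [adjoint_add, endTmul, TensorProduct.add_tmul, map_add]; rfl))
    (fun f L τ => by
      change endTmul l k (HomSect.adjoint (h k) (h l) (f • L)) _ =
        endTmul l k _ (Form.star (Form.twist (l - k) (f • τ)))
      rw [adjoint_smul, map_smul, Form.star_smul, endTmul, endTmul, TensorProduct.smul_tmul])

/-- The superconnection `E = E' + E''` on `A^•(X, E^•)`. -/
def totalOp (D' : Superconnection E (del (V := V) (X := X))) (D'' : CohesiveStructure E) :
    E.Forms →+ E.Forms := D'.opDel + D''.op

/-- An operator `D` on `A^•(X, E^•)` is unitary if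
`(-1)^{|s|} d h(s,t) = -h(D s, t) + h(s, D t)`, where `|s|` is the total degree. -/
def IsUnitary (h : GradedMetric E) (D : E.Forms →+ E.Forms) : Prop :=
  ∀ (n : ℤ) (s t : E.Forms), s ∈ E.totalDegree n →
    (-1 : ℂ) ^ n • extD (h.pairing s t) = -h.pairing (D s) t + h.pairing s (D t)

/-- `E'` is a `∂`-superconnection `A^0(X, E^•) → A^{•,0}(X, E^•)` of exotic degree `-1` such that
`E' + E''` is unitary. -/
structure IsChern (D'' : CohesiveStructure E) (h : GradedMetric E)
    (D' : Superconnection E (del (V := V) (X := X))) : Prop where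
  mem_holoForms : ∀ s : E.Sections, D'.toLin s ∈ E.holoForms
  exotic_degree : ∀ (k : ℤ) (e : E.Sec k), D'.toLin (E.ofSec k e) ∈ E.exoticDegree (k - 1)
  unitary : IsUnitary h (totalOp D' D'')

end Operators

end ChernSuper

end

/-!
Write `A` for the algebra of forms and `*` for its involution `α ↦ (-1)^{k(k+1)/2} ᾱ`. The sign is
chosen so that `*` reverses products (`starAlt_mul`); hence the extension of the metric to
`A^•(X, E^•)` is a Hermitian form over `A`, in the sense that `h(s ∧ α, t ∧ β) = α^* h(s,t) β` and
`h(s,t)^* = h(t,s)`. Two facts make it usable like a non-degenerate form on a free module of finite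
rank. Over a compact base, cutting off local frames gives finitely many sections `e_i` of each
`E^k`, with dual sections `f_i`, such that `v = ∑ h(f_i, v) e_i` on all fibres (`exists_frame`); so
every `s` in `A^•(X, E^•)` has the expansion `s = ∑ e_i ⊗ h(f_i, s)` (`forms_expand`), and `h` is
non-degenerate (`pairing_nondeg`). The `e_i` need not be independent.

Unitarity is a sum of a `∂̄`-part and a `∂`-part. On sections the former reads
`h(E'e, f) = h(e, E''f) - (-1)^{|e|} ∂̄ h(e, f)`, whose right side `chernFun` does not involve `E'`.
That it follows from unitarity is seen from the circle action, i.e. pullback by multiplication with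
`u` on tangent vectors, twisted by `u^{-k}` on `E^k`: it acts by `u^{-n}` in exotic degree `n`, and
`h` is equivariant; at `u = i` the two parts are eigenvectors with opposite eigenvalues
(`IsChern.isAdjoint`). With non-degeneracy this gives uniqueness. For existence, `chernFun` is
linear over functions in `f`, because the derivatives of a function cancel (`chernFun_smul_right`),
so the expansion in frames produces `E'e` with this pairing (`pairing_chernSec`). The Leibniz rules
extend the `∂̄`-part from sections to all of `A^•(X, E^•)` (`IsAdjoint.delbar_pairing`), applying
`*` turns it into the `∂`-part (`IsAdjoint.del_pairing`), and the sum is unitarity.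

Since `E''` squares to zero, and `∂̄` as well, adjunction yields `E' ∘ E' = 0`
(`IsAdjoint.opDel_opDel`), so that `E ∘ E` is the supercommutator. As `E` is an odd derivation over
`d` and `d² = 0`, its square is linear over `A` (`IsOddDerivation.sq_rmul`); the operators linear
over `A` are exactly the actions of unique endomorphism-valued forms, read off from the frames
(`endAct_symbol`, `symbol_endAct`). Applying unitarity twice and `d² = 0` shows
`h(E²s, t) = h(s, E²t)` (`IsAdjoint.pairing_sq`), and `R ↦ R^*` is the adjoint for `h`
(`pairing_endAct`), whence `R^* = R`. Finally `E'` lowers and `E''` raises the exotic degree by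
one, so that their supercommutator preserves it.
-/

noncomputable section

namespace ChernSuper

universe u v w z

set_option linter.unusedSectionVars false

/-! ### Exterior forms on a vector space: the involution `*`, types and the circle action -/

section LinearForms

variable {V : Type*} [AddCommGroup V] [Module ℂ V]

theorem involute_of_mem {k : ℕ} {a : Alt V} (ha : a ∈ ⋀[ℂ]^k (Covec V)) :
    CliffordAlgebra.involute a = (-1 : ℂ) ^ k • a := by
  induction ha using Submodule.pow_induction_on_left' with
  | algebraMap r => simp
  | add x y i hx hy ihx ihy => rw [map_add, ihx, ihy, smul_add]
  | mem_mul m hm i x hx ih =>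
    obtain ⟨f, rfl⟩ := hm
    have h1 : CliffordAlgebra.involute (ExteriorAlgebra.ι ℂ f) = -ExteriorAlgebra.ι ℂ f :=
      CliffordAlgebra.involute_ι f
    rw [map_mul, h1, ih, pow_succ]
    simp

theorem mul_ι_of_mem {k : ℕ} {a : Alt V} (ha : a ∈ ⋀[ℂ]^k (Covec V)) (f : Covec V) :
    a * ExteriorAlgebra.ι ℂ f = (-1 : ℂ) ^ k • (ExteriorAlgebra.ι ℂ f * a) := by
  induction ha using Submodule.pow_induction_on_left' with
  | algebraMap r => rw [pow_zero, one_smul]; exact Algebra.commutes r _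
  | add x y i hx hy ihx ihy => rw [add_mul, ihx, ihy, mul_add, smul_add]
  | mem_mul m hm i x hx ih =>
    obtain ⟨g, rfl⟩ := hm
    rw [mul_assoc, ih, mul_smul_comm, ← mul_assoc, ← mul_assoc,
      eq_neg_of_add_eq_zero_left (ExteriorAlgebra.ι_add_mul_swap g f), Nat.succ_eq_add_one,
      pow_succ, mul_neg_one, neg_smul, neg_mul, smul_neg]

/-- The sign `(-1)^{k(k+1)/2}` is the composition of the main involution and the reversal of
products. -/
theorem weight_eq_reverse (a : Alt V) :
    weight (fun k => (-1) ^ (k * (k + 1) / 2)) a =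
      CliffordAlgebra.reverse (CliffordAlgebra.involute a) := by
  induction a using alt_induction with
  | h0 => simp
  | hadd a b ha hb => simp [ha, hb]
  | hom k a ha =>
    rw [weight_of_mem _ ha]
    induction ha using Submodule.pow_induction_on_left' with
    | algebraMap r =>
      rw [AlgHom.commutes, CliffordAlgebra.reverse.commutes]
      simp
    | add x y i hx hy ihx ihy => rw [map_add, map_add, smul_add, ihx, ihy]
    | mem_mul m hm i x hx ih =>
      obtain ⟨f, rfl⟩ := hm
      have h1 : CliffordAlgebra.involute (ExteriorAlgebra.ι ℂ f) = -ExteriorAlgebra.ι ℂ f :=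
        CliffordAlgebra.involute_ι f
      have h2 : CliffordAlgebra.reverse (ExteriorAlgebra.ι ℂ f) = ExteriorAlgebra.ι ℂ f :=
        CliffordAlgebra.reverse_ι f
      have h3 : (i + 1) * (i + 1 + 1) / 2 = i * (i + 1) / 2 + (i + 1) := by
        rw [show (i + 1) * (i + 1 + 1) = i * (i + 1) + (i + 1) * 2 by ring,
          Nat.add_mul_div_right _ _ two_pos]
      rw [map_mul, CliffordAlgebra.reverse.map_mul, ← ih, h1, map_neg, h2, smul_mul_assoc,
        mul_neg, Nat.succ_eq_add_one, h3, mul_ι_of_mem hx, pow_add, pow_succ, mul_smul]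
      rw [mul_neg_one, neg_smul, smul_neg]

/-- The involution `*` reverses products. -/
theorem starAlt_mul (a b : Alt V) : starAlt (a * b) = starAlt b * starAlt a := by
  simp only [starAlt, weight_eq_reverse, map_mul, CliffordAlgebra.reverse.map_mul]

theorem starAlt_add (a b : Alt V) : starAlt (a + b) = starAlt a + starAlt b := by
  simp [starAlt]

theorem starAlt_smul (c : ℂ) (a : Alt V) : starAlt (c • a) = starRingEnd ℂ c • starAlt a := by
  rw [starAlt, map_smul, conjAlt_smul, starAlt]

theorem starAlt_algebraMap (c : ℂ) :
    starAlt (algebraMap ℂ (Alt V) c) = algebraMap ℂ (Alt V) (starRingEnd ℂ c) := by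
  rw [starAlt, weight_eq_reverse, AlgHom.commutes, CliffordAlgebra.reverse.commutes,
    conjAlt_algebraMap]

theorem starAlt_ι (f : Covec V) :
    starAlt (ExteriorAlgebra.ι ℂ f) = -ExteriorAlgebra.ι ℂ (conjCovec f) := by
  have h1 : CliffordAlgebra.involute (ExteriorAlgebra.ι ℂ f) = -ExteriorAlgebra.ι ℂ f :=
    CliffordAlgebra.involute_ι f
  have h2 : CliffordAlgebra.reverse (ExteriorAlgebra.ι ℂ f) = ExteriorAlgebra.ι ℂ f :=
    CliffordAlgebra.reverse_ι f
  rw [starAlt, weight_eq_reverse, h1, map_neg, h2, map_neg, conjAlt_ι]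

theorem starAlt_starAlt (a : Alt V) : starAlt (starAlt a) = a := by
  induction a using ExteriorAlgebra.induction with
  | algebraMap r => simp [starAlt_algebraMap]
  | ι f =>
    have h : ∀ a : Alt V, starAlt (-a) = -starAlt a := fun a => by simp [starAlt]
    rw [starAlt_ι, h, starAlt_ι, neg_neg]
    congr 1
    ext v
    simp [conjCovec]
  | mul a b ha hb => rw [starAlt_mul, starAlt_mul, ha, hb]
  | add a b ha hb => rw [starAlt_add, starAlt_add, ha, hb]

theorem altType_le_degree (p q : ℕ) : altType V p q ≤ ⋀[ℂ]^(p + q) (Covec V) := by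
  have h : ∀ W : Submodule ℂ (Covec V), W.map (ExteriorAlgebra.ι ℂ) ≤
      LinearMap.range (ExteriorAlgebra.ι ℂ (M := Covec V)) := fun W => LinearMap.map_le_range
  rw [altType, ExteriorAlgebra.exteriorPower, pow_add]
  exact mul_le_mul' (pow_le_pow_left' (h _) p) (pow_le_pow_left' (h _) q)

theorem commute_map_ι (W W' : Submodule ℂ (Covec V)) :
    Commute (W.map (ExteriorAlgebra.ι ℂ)) (W'.map (ExteriorAlgebra.ι ℂ)) := by
  have h : ∀ W W' : Submodule ℂ (Covec V),
      W.map (ExteriorAlgebra.ι ℂ) * W'.map (ExteriorAlgebra.ι ℂ) ≤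
        W'.map (ExteriorAlgebra.ι ℂ) * W.map (ExteriorAlgebra.ι ℂ) := fun W W' => by
    rw [Submodule.mul_le]
    rintro _ ⟨f, hf, rfl⟩ _ ⟨g, hg, rfl⟩
    rw [eq_neg_of_add_eq_zero_left (ExteriorAlgebra.ι_add_mul_swap f g)]
    exact Submodule.neg_mem _ (Submodule.mul_mem_mul ⟨g, hg, rfl⟩ ⟨f, hf, rfl⟩)
  exact le_antisymm (h W W') (h W' W)

theorem altType_mul (p q p' q' : ℕ) :
    altType V p q * altType V p' q' = altType V (p + p') (q + q') := by
  rw [altType, altType, altType, pow_add, pow_add, mul_assoc, mul_assoc, ← mul_assoc (_ ^ q),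
    ((commute_map_ι (covec01 V) (covec10 V)).pow_pow q p').eq]
  simp only [mul_assoc]

theorem mul_mem_altType {p q p' q' : ℕ} {a b : Alt V} (ha : a ∈ altType V p q)
    (hb : b ∈ altType V p' q') : a * b ∈ altType V (p + p') (q + q') :=
  altType_mul (V := V) p q p' q' ▸ Submodule.mul_mem_mul ha hb

theorem ι_mem_altType_one_zero {f : Covec V} (hf : f ∈ covec10 V) :
    ExteriorAlgebra.ι ℂ f ∈ altType V 1 0 := by
  rw [altType, pow_one, pow_zero, mul_one]
  exact ⟨f, hf, rfl⟩

theorem ι_mem_altType_zero_one {f : Covec V} (hf : f ∈ covec01 V) :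
    ExteriorAlgebra.ι ℂ f ∈ altType V 0 1 := by
  rw [altType, pow_one, pow_zero, one_mul]
  exact ⟨f, hf, rfl⟩

theorem algebraMap_mem_altType (c : ℂ) : algebraMap ℂ (Alt V) c ∈ altType V 0 0 := by
  simp only [altType, pow_zero, one_mul]
  exact Submodule.algebraMap_mem _

/-- Forms of type `(p,q)` are generated from scalars by multiplication with functionals. -/
theorem altType_induction {P : ℕ → ℕ → Alt V → Prop}
    (scalar : ∀ c : ℂ, P 0 0 (algebraMap ℂ (Alt V) c))
    (add : ∀ p q a b, P p q a → P p q b → P p q (a + b))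
    (holo : ∀ p q f a, f ∈ covec10 V → P p q a → P (p + 1) q (ExteriorAlgebra.ι ℂ f * a))
    (anti : ∀ q f a, f ∈ covec01 V → P 0 q a → P 0 (q + 1) (ExteriorAlgebra.ι ℂ f * a))
    {p q : ℕ} {a : Alt V} (ha : a ∈ altType V p q) : P p q a := by
  have h1 : ∀ q, ∀ b ∈ ((covec01 V).map (ExteriorAlgebra.ι ℂ)) ^ q, P 0 q b := fun q b hb => by
    clear ha
    induction hb using Submodule.pow_induction_on_left' with
    | algebraMap r => exact scalar r
    | add x y i hx hy ihx ihy => exact add _ _ _ _ ihx ihy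
    | mem_mul m hm i x hx ih =>
      obtain ⟨f, hf, rfl⟩ := hm
      exact anti _ _ _ hf ih
  have h0 : P p q 0 := by
    clear ha
    have hz : P 0 0 0 := by simpa using scalar 0
    have hq : ∀ q, P 0 q 0 := fun q => by
      induction q with
      | zero => exact hz
      | succ q ih => simpa using anti q 0 0 (Submodule.zero_mem _) ih
    induction p with
    | zero => exact hq q
    | succ p ih => simpa using holo p q 0 0 (Submodule.zero_mem _) ih
  refine Submodule.mul_induction_on ha (fun m hm b hb => ?_) (fun x y => add p q x y)
  clear h0 ha
  induction hm using Submodule.pow_induction_on_left' with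
  | algebraMap r =>
    rw [← Algebra.smul_def]
    exact h1 _ _ (Submodule.smul_mem _ r hb)
  | add x y i hx hy ihx ihy => rw [add_mul]; exact add _ _ _ _ ihx ihy
  | mem_mul m hm i x hx ih =>
    obtain ⟨f, hf, rfl⟩ := hm
    rw [mul_assoc]
    exact holo _ _ _ _ hf ih

theorem conjCovec_mem_covec10 {f : Covec V} (hf : f ∈ covec01 V) : conjCovec f ∈ covec10 V :=
  fun v => by
    change starRingEnd ℂ (f (Complex.I • v)) = Complex.I * starRingEnd ℂ (f v)
    rw [hf v]
    simp

theorem conjCovec_mem_covec01 {f : Covec V} (hf : f ∈ covec10 V) : conjCovec f ∈ covec01 V :=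
  fun v => by
    change starRingEnd ℂ (f (Complex.I • v)) = -Complex.I * starRingEnd ℂ (f v)
    rw [hf v]
    simp

/-- The involution `*` exchanges the types `(p,q)` and `(q,p)`. -/
theorem starAlt_mem_altType {p q : ℕ} {a : Alt V} (ha : a ∈ altType V p q) :
    starAlt a ∈ altType V q p := by
  refine altType_induction (P := fun p q a => starAlt a ∈ altType V q p) ?_ ?_ ?_ ?_ ha
  · intro c
    rw [starAlt_algebraMap]
    exact algebraMap_mem_altType _
  · intro p q a b ha hb
    rw [starAlt_add]
    exact Submodule.add_mem _ ha hb
  · intro p q f a hf ih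
    rw [starAlt_mul, starAlt_ι, mul_neg]
    have h := mul_mem_altType ih (ι_mem_altType_zero_one (conjCovec_mem_covec01 hf))
    rw [add_zero] at h
    exact Submodule.neg_mem _ h
  · intro q f a hf ih
    rw [starAlt_mul, starAlt_ι, mul_neg]
    have h := mul_mem_altType ih (ι_mem_altType_one_zero (conjCovec_mem_covec10 hf))
    rw [add_zero] at h
    exact Submodule.neg_mem _ h

/-- Multiplication by a complex number, as a real-linear map. -/
def scale (V : Type*) [AddCommGroup V] [Module ℂ V] (u : ℂ) : V →ₗ[ℝ] V :=
  (u • LinearMap.id : V →ₗ[ℂ] V).restrictScalars ℝ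

theorem scale_apply (u : ℂ) (v : V) : scale V u v = u • v := rfl

theorem covec10_scale {f : Covec V} (hf : f ∈ covec10 V) (u : ℂ) : f ∘ₗ scale V u = u • f := by
  ext v
  have h : u • v = u.re • v + u.im • Complex.I • v := by
    conv_lhs => rw [← Complex.re_add_im u]
    rw [add_smul, mul_smul]
    rfl
  rw [LinearMap.comp_apply, scale_apply, h, map_add, map_smul, map_smul, hf v]
  simp only [Complex.real_smul, LinearMap.smul_apply, smul_eq_mul]
  conv_rhs => rw [← Complex.re_add_im u]
  ring

theorem covec01_scale {f : Covec V} (hf : f ∈ covec01 V) (u : ℂ) :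
    f ∘ₗ scale V u = starRingEnd ℂ u • f := by
  have h : conjCovec (conjCovec f) = f := by ext v; simp [conjCovec]
  have h2 := congrArg conjCovec (covec10_scale (conjCovec_mem_covec10 hf) u)
  rw [← h]
  ext v
  have := congrArg (fun g : Covec V => g v) h2
  simpa [conjCovec] using this

/-- Pullback along multiplication by `u`. -/
def rotAlt (u : ℂ) : Alt V →ₐ[ℂ] Alt V := pull (scale V u)

theorem rotAlt_of_mem {p q : ℕ} {a : Alt V} (ha : a ∈ altType V p q) (u : ℂ) :
    rotAlt u a = (u ^ p * starRingEnd ℂ u ^ q) • a := by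
  refine altType_induction (P := fun p q a => rotAlt u a = (u ^ p * starRingEnd ℂ u ^ q) • a)
    ?_ ?_ ?_ ?_ ha
  · intro c
    simp [AlgHom.commutes]
  · intro p q a b ha hb
    rw [map_add, ha, hb, smul_add]
  · intro p q f a hf ih
    rw [map_mul, ih, rotAlt, pull_ι, covec10_scale hf, map_smul, smul_mul_smul_comm]
    congr 1; ring
  · intro q f a hf ih
    rw [map_mul, ih, rotAlt, pull_ι, covec01_scale hf, map_smul, smul_mul_smul_comm]
    congr 1; ring

theorem rotAlt_neg_one (a : Alt V) : rotAlt (-1) a = CliffordAlgebra.involute a := by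
  have : (rotAlt (-1) : Alt V →ₐ[ℂ] Alt V) = CliffordAlgebra.involute := by
    apply ExteriorAlgebra.hom_ext
    ext f
    have h1 : CliffordAlgebra.involute (ExteriorAlgebra.ι ℂ f) = -ExteriorAlgebra.ι ℂ f :=
      CliffordAlgebra.involute_ι f
    simp only [LinearMap.comp_apply, AlgHom.toLinearMap_apply]
    rw [h1, rotAlt, pull_ι, ← map_neg]
    congr 1
    ext v
    simp [scale_apply]
  rw [this]

theorem starAlt_rotAlt (u : ℂ) (a : Alt V) : starAlt (rotAlt u a) = rotAlt u (starAlt a) := by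
  rw [starAlt, starAlt, rotAlt, pull_conj, pull_weight]

theorem pull_rotAlt (A : V →ₗ[ℂ] V) (u : ℂ) (a : Alt V) :
    pull (A.restrictScalars ℝ) (rotAlt u a) = rotAlt u (pull (A.restrictScalars ℝ) a) := by
  have h : scale V u ∘ₗ A.restrictScalars ℝ = A.restrictScalars ℝ ∘ₗ scale V u := by
    ext v
    simp [scale_apply]
  rw [rotAlt, ← pull_comp, h, pull_comp]

theorem pull_mem_altType (A : V →ₗ[ℂ] V) {p q : ℕ} {a : Alt V} (ha : a ∈ altType V p q) :
    pull (A.restrictScalars ℝ) a ∈ altType V p q := by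
  refine altType_induction (P := fun p q a => pull (A.restrictScalars ℝ) a ∈ altType V p q)
    ?_ ?_ ?_ ?_ ha
  · intro c
    rw [AlgHom.commutes]
    exact algebraMap_mem_altType _
  · intro p q a b ha hb
    rw [map_add]
    exact Submodule.add_mem _ ha hb
  · intro p q f a hf ih
    have hA : f ∘ₗ A.restrictScalars ℝ ∈ covec10 V := fun v => by
      simpa using hf (A v)
    rw [map_mul, pull_ι, add_comm p]
    simpa using mul_mem_altType (ι_mem_altType_one_zero hA) ih
  · intro q f a hf ih
    have hA : f ∘ₗ A.restrictScalars ℝ ∈ covec01 V := fun v => by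
      simpa using hf (A v)
    rw [map_mul, pull_ι, add_comm q]
    simpa using mul_mem_altType (ι_mem_altType_zero_one hA) ih

/-- A form of degree `j` which is a sum of forms of types `(0,q)` is of type `(0,j)`. -/
theorem mem_altType_of_degree {j : ℕ} {a : Alt V} (ha : a ∈ ⋀[ℂ]^j (Covec V))
    (ha' : a ∈ ⨆ q, altType V 0 q) : a ∈ altType V 0 j := by
  have h : ∀ b ∈ ⨆ q, altType V 0 q, weight (Pi.single j 1) b ∈ altType V 0 j := fun b hb => by
    refine Submodule.iSup_induction _ (motive := fun b => weight (Pi.single j 1) b ∈ altType V 0 j)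
      hb (fun q b hb => ?_) ?_ (fun b c hb hc => ?_)
    · rw [weight_of_mem _ (altType_le_degree 0 q hb), zero_add]
      by_cases hq : q = j
      · subst hq
        exact Submodule.smul_mem _ _ hb
      · rw [Pi.single_eq_of_ne hq, zero_smul]
        exact Submodule.zero_mem _
    · rw [map_zero]; exact Submodule.zero_mem _
    · rw [map_add]; exact Submodule.add_mem _ hb hc
  have h1 := h a ha'
  rwa [weight_of_mem _ ha, Pi.single_eq_same, one_smul] at h1

end LinearForms

/-! ### The operators `diffOp a b` on open subsets of a vector space -/

section DiffOp

variable {V : Type*} [NormedAddCommGroup V] [NormedSpace ℂ V] [FiniteDimensional ℂ V]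

/-- The derivative of `u` in the direction `a v + b i v`, with complex coefficients. -/
def dirDeriv (a b : ℂ) (u : V → Alt V) (v : V) (y : V) : Alt V :=
  a • fderiv ℝ u y v + b • fderiv ℝ u y (Complex.I • v)

theorem diffOp_eq (a b : ℂ) (u : V → Alt V) (y : V) :
    diffOp a b u y = ∑ j, ExteriorAlgebra.ι ℂ (dx (V := V) j) *
      dirDeriv a b u (Module.finBasis ℝ V j) y := rfl

/-- The operators `diffOp a b` square to zero, since second derivatives are symmetric. -/
theorem diffOp_diffOp (a b : ℂ) {s : Set V} (hs : IsOpen s) {u : V → Alt V}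
    (hu : ContDiffOn ℝ ∞ u s) {y : V} (hy : y ∈ s) : diffOp a b (diffOp a b u) y = 0 := by
  have huy : ContDiffAt ℝ ∞ u y := hu.contDiffAt (hs.mem_nhds hy)
  have hu2 : ContDiffAt ℝ 2 u y := huy.of_le (WithTop.coe_le_coe.2 le_top)
  have hD : DifferentiableAt ℝ (fderiv ℝ u) y :=
    (hu2.fderiv_right (m := 1) (by norm_num)).differentiableAt (by norm_num)
  have hsym : ∀ v w, fderiv ℝ (fderiv ℝ u) y v w = fderiv ℝ (fderiv ℝ u) y w v := fun v w =>
    (hu2.isSymmSndFDerivAt (by simp)).eq v w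
  have hdv : ∀ v, HasFDerivAt (fun z => fderiv ℝ u z v)
      ((fderiv ℝ (fderiv ℝ u) y).flip v) y := fun v => by
    have := hD.hasFDerivAt.clm_apply (hasFDerivAt_const v y)
    simpa using this
  have hdir : ∀ v, HasFDerivAt (dirDeriv a b u v)
      (a • (fderiv ℝ (fderiv ℝ u) y).flip v +
        b • (fderiv ℝ (fderiv ℝ u) y).flip (Complex.I • v)) y := fun v =>
    ((hdv v).const_smul a).add ((hdv _).const_smul b)
  set B : V → V → Alt V := fun v w => dirDeriv a b (dirDeriv a b u w) v y with hB
  have hBsym : ∀ v w, B v w = B w v := fun v w => by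
    simp only [hB]
    rw [dirDeriv, dirDeriv, (hdir w).fderiv, (hdir v).fderiv]
    simp only [add_apply, smul_apply, ContinuousLinearMap.flip_apply]
    rw [hsym w v, hsym w (Complex.I • v), hsym (Complex.I • w) v,
      hsym (Complex.I • w) (Complex.I • v)]
    simp only [smul_add]
    rw [smul_comm a b (fderiv ℝ (fderiv ℝ u) y v (Complex.I • w)),
      smul_comm a b (fderiv ℝ (fderiv ℝ u) y (Complex.I • v) w)]
    abel
  have h1 : diffOp a b (diffOp a b u) y =
      -∑ j, ∑ k, ExteriorAlgebra.ι ℂ (dx (V := V) j) * ExteriorAlgebra.ι ℂ (dx (V := V) k) *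
        B (Module.finBasis ℝ V k) (Module.finBasis ℝ V j) := by
    have h2 : diffOp a b u = fun z => ∑ j, ExteriorAlgebra.ι ℂ (dx (V := V) j) *
      dirDeriv a b u (Module.finBasis ℝ V j) z := rfl
    rw [h2, diffOp_sum (V := V) a b _ (fun j _ => differentiableAt_mul (V := V)
      (differentiableAt_const _) (hdir _).differentiableAt), ← Finset.sum_neg_distrib]
    refine Finset.sum_congr rfl fun j _ => ?_
    have h3 : CliffordAlgebra.involute (ExteriorAlgebra.ι ℂ (dx (V := V) j)) =
      -ExteriorAlgebra.ι ℂ (dx (V := V) j) := CliffordAlgebra.involute_ι _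
    have h4 : diffOp a b (fun _ : V => ExteriorAlgebra.ι ℂ (dx (V := V) j)) y = 0 := by
      simp [diffOp]
    rw [diffOp_mul (V := V) a b (u := fun _ => ExteriorAlgebra.ι ℂ (dx (V := V) j))
      (differentiableAt_const _) (hdir _).differentiableAt, h4, h3, zero_mul,
      zero_add, diffOp_eq, neg_mul, Finset.mul_sum]
    simp only [mul_assoc]
    rfl
  rw [h1, neg_eq_zero]
  -- `dx_j ∧ dx_k` is antisymmetric and the coefficient `B` is symmetric in `j` and `k`
  set S := ∑ j, ∑ k, ExteriorAlgebra.ι ℂ (dx (V := V) j) * ExteriorAlgebra.ι ℂ (dx (V := V) k) *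
        B (Module.finBasis ℝ V k) (Module.finBasis ℝ V j) with hS
  have h2 : S + S = 0 := by
    conv_lhs => rw [hS]; arg 2; rw [Finset.sum_comm]
    simp only [← Finset.sum_add_distrib]
    refine Finset.sum_eq_zero (fun j _ => Finset.sum_eq_zero (fun k _ => ?_))
    rw [hBsym (Module.finBasis ℝ V j), ← add_mul, ExteriorAlgebra.ι_add_mul_swap, zero_mul]
  have h3 : (2 : ℂ) • S = 0 := by rw [two_smul]; exact h2
  exact (smul_eq_zero.1 h3).resolve_left two_ne_zero

theorem map_dirDeriv (a b a' b' : ℂ) (T : Alt V →ₗ[ℝ] Alt V) (ha : ∀ x, T (a • x) = a' • T x)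
    (hb : ∀ x, T (b • x) = b' • T x) {u : V → Alt V} {y : V} (hu : DifferentiableAt ℝ u y) (v : V) :
    T (dirDeriv a b u v y) = dirDeriv a' b' (fun z => T (u z)) v y := by
  have h : ∀ w, fderiv ℝ (fun z => T (u z)) y w = T (fderiv ℝ u y w) := fun w => by
    have h1 := (LinearMap.toContinuousLinearMap T).hasFDerivAt.comp y hu.hasFDerivAt
    exact congrArg (fun L : V →L[ℝ] Alt V => L w) h1.fderiv
  rw [dirDeriv, dirDeriv, h, h, map_add, ha, hb]

theorem involute_diffOp (a b : ℂ) {u : V → Alt V} {y : V} (hu : DifferentiableAt ℝ u y) :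
    rotAlt (-1) (diffOp a b u y) = -diffOp a b (fun z => rotAlt (-1) (u z)) y := by
  rw [diffOp_eq, diffOp_eq, map_sum, ← Finset.sum_neg_distrib]
  refine Finset.sum_congr rfl fun j _ => ?_
  have h3 : CliffordAlgebra.involute (ExteriorAlgebra.ι ℂ (dx (V := V) j)) =
      -ExteriorAlgebra.ι ℂ (dx (V := V) j) := CliffordAlgebra.involute_ι _
  have h4 := map_dirDeriv a b a b ((rotAlt (V := V) (-1)).toLinearMap.restrictScalars ℝ)
    (fun x => map_smul (rotAlt (V := V) (-1)) a x)
    (fun x => map_smul (rotAlt (V := V) (-1)) b x) hu (Module.finBasis ℝ V j)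
  rw [map_mul, rotAlt_neg_one (ExteriorAlgebra.ι ℂ _), h3, neg_mul]
  exact congrArg (fun t => -(ExteriorAlgebra.ι ℂ (dx (V := V) j) * t)) h4

/-- Under `*`, which reverses products, the `dx_j` move to the right; moving them back to the left
produces the parity involution. -/
theorem starAlt_diffOp (a b : ℂ) {u : V → Alt V} {y : V} (hu : DifferentiableAt ℝ u y) :
    starAlt (diffOp a b u y) = -diffOp (starRingEnd ℂ a) (starRingEnd ℂ b)
      (fun z => rotAlt (-1) (starAlt (u z))) y := by
  rw [diffOp_eq, diffOp_eq, ← Finset.sum_neg_distrib]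
  refine (map_sum (starAltL (V := V)) _ _).trans (Finset.sum_congr rfl fun j _ => ?_)
  have h3 : conjCovec (dx (V := V) j) = dx j := by
    ext v
    simp [conjCovec, dx]
  have h4 := map_dirDeriv a b (starRingEnd ℂ a) (starRingEnd ℂ b)
    ((rotAlt (V := V) (-1)).toLinearMap.restrictScalars ℝ ∘ₗ starAltL)
    (fun x => (congrArg (rotAlt (-1)) (starAlt_smul a x)).trans (map_smul (rotAlt (V := V) (-1)) _ _))
    (fun x => (congrArg (rotAlt (-1)) (starAlt_smul b x)).trans (map_smul (rotAlt (V := V) (-1)) _ _))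
    hu (Module.finBasis ℝ V j)
  refine (starAlt_mul _ _).trans ?_
  rw [starAlt_ι, h3, mul_neg]
  refine congrArg Neg.neg
    (Eq.trans ?_ (congrArg (fun t => ExteriorAlgebra.ι ℂ (dx (V := V) j) * t) h4))
  change _ = ExteriorAlgebra.ι ℂ (dx (V := V) j) * rotAlt (-1) (starAlt _)
  rw [rotAlt_neg_one, ι_mul_involute, CliffordAlgebra.involute_involute]

/-- The form `∑_j dx_j ∧ T(b_j)` for a real-linear map `T` with values in a subspace `W` lies in
`C ∧ W`, if all coefficients of `T` lie in the space `C` of functionals. -/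
theorem sum_dx_mul_mem (W : Submodule ℂ (Alt V)) (C : Submodule ℂ (Covec V)) (T : V →ₗ[ℝ] Alt V)
    (hT : ∀ v, T v ∈ W) (hC : ∀ (ℓ : Alt V →ₗ[ℂ] ℂ), (ℓ.restrictScalars ℝ ∘ₗ T : Covec V) ∈ C) :
    ∑ j, ExteriorAlgebra.ι ℂ (dx (V := V) j) * T (Module.finBasis ℝ V j) ∈
      C.map (ExteriorAlgebra.ι ℂ) * W := by
  obtain ⟨W', hW⟩ := Submodule.exists_isCompl W
  set π : Alt V →ₗ[ℂ] W := Submodule.projectionOnto W W' hW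
  set B := Module.finBasis ℂ W
  have hexp : ∀ v, T v = ∑ m, (((B.coord m ∘ₗ π).restrictScalars ℝ ∘ₗ T : Covec V) v) •
      ((B m : W) : Alt V) := fun v => by
    have h1 : π (T v) = ⟨T v, hT v⟩ := Submodule.projectionOnto_apply_left hW ⟨T v, hT v⟩
    have h2 := congrArg (Submodule.subtype W) (B.sum_repr (π (T v)))
    rw [map_sum] at h2
    simp only [map_smul] at h2
    rw [h1] at h2
    refine h2.symm.trans ?_
    rw [← h1]
    rfl
  have hsum : ∑ j, ExteriorAlgebra.ι ℂ (dx (V := V) j) * T (Module.finBasis ℝ V j) =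
      ∑ m, ExteriorAlgebra.ι ℂ ((B.coord m ∘ₗ π).restrictScalars ℝ ∘ₗ T : Covec V) *
        ((B m : W) : Alt V) := by
    have h1 : ∀ j, ExteriorAlgebra.ι ℂ (dx (V := V) j) * T (Module.finBasis ℝ V j) =
        ∑ m, ExteriorAlgebra.ι ℂ ((((B.coord m ∘ₗ π).restrictScalars ℝ ∘ₗ T : Covec V)
          (Module.finBasis ℝ V j)) • dx (V := V) j) * ((B m : W) : Alt V) := fun j => by
      conv_lhs => rw [hexp]
      rw [Finset.mul_sum]
      refine Finset.sum_congr rfl fun m _ => ?_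
      rw [mul_smul_comm, map_smul, smul_mul_assoc]
    simp only [h1]
    rw [Finset.sum_comm]
    refine Finset.sum_congr rfl fun m _ => ?_
    rw [← Finset.sum_mul, ← map_sum, sum_dx_smul]
  rw [hsum]
  exact Submodule.sum_mem _ fun m _ =>
    Submodule.mul_mem_mul ⟨_, hC (B.coord m ∘ₗ π), rfl⟩ (B m).2

theorem dirDeriv_linear (a b : ℂ) (u : V → Alt V) (y : V) :
    ∃ T : V →ₗ[ℝ] Alt V, ∀ v, T v = dirDeriv a b u v y :=
  ⟨{ toFun := fun v => dirDeriv a b u v y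
     map_add' := fun v w => by simp only [dirDeriv, smul_add, map_add]; abel
     map_smul' := fun r v => by
      simp only [dirDeriv, smul_comm Complex.I r v, RingHom.id_apply, smul_add]
      rw [map_smul, map_smul, smul_comm a r, smul_comm b r]
      rfl }, fun _ => rfl⟩

/-- The derivative of a function with values in a subspace has values in the subspace. -/
theorem fderiv_mem_submodule (W : Submodule ℂ (Alt V)) {u : V → Alt V} {y : V}
    (hu : DifferentiableAt ℝ u y) (hW : ∀ᶠ z in 𝓝 y, u z ∈ W) (v : V) : fderiv ℝ u y v ∈ W := by
  obtain ⟨W', hW'⟩ := Submodule.exists_isCompl W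
  set q : Alt V →ₗ[ℂ] Alt V :=
    LinearMap.id - W.subtype ∘ₗ Submodule.projectionOnto W W' hW' with hq
  have h0 : ∀ x ∈ W, q x = 0 := fun x hx => by
    have h1 := Submodule.projectionOnto_apply_left hW' ⟨x, hx⟩
    simp only [hq, LinearMap.sub_apply, LinearMap.comp_apply, LinearMap.id_apply, h1,
      Submodule.subtype_apply, sub_self]
  have h1 := (LinearMap.toContinuousLinearMap (q.restrictScalars ℝ)).hasFDerivAt.comp y
    hu.hasFDerivAt
  have h2 : HasFDerivAt (fun z => q (u z)) (0 : V →L[ℝ] Alt V) y :=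
    (hasFDerivAt_const (0 : Alt V) y).congr_of_eventuallyEq (hW.mono fun z hz => h0 _ hz)
  have h3 : q (fderiv ℝ u y v) = 0 := congrArg (fun L : V →L[ℝ] Alt V => L v) (h1.unique h2)
  rw [hq, LinearMap.sub_apply, sub_eq_zero] at h3
  rw [show fderiv ℝ u y v = _ from h3]
  exact Submodule.coe_mem _

/-- If the functionals `v ↦ a c(v) + b c(iv)` lie in `C`, for all real-linear `c`, then
`diffOp a b` maps forms with values in a subspace `W` to forms with values in `C ∧ W`. -/
theorem diffOp_mem (a b : ℂ) (C : Submodule ℂ (Covec V))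
    (hC : ∀ c g : Covec V, (∀ v, g v = a * c v + b * c (Complex.I • v)) → g ∈ C)
    (W : Submodule ℂ (Alt V)) {u : V → Alt V} {y : V}
    (hu : DifferentiableAt ℝ u y) (hW : ∀ᶠ z in 𝓝 y, u z ∈ W) :
    diffOp a b u y ∈ C.map (ExteriorAlgebra.ι ℂ) * W := by
  obtain ⟨T, hT⟩ := dirDeriv_linear a b u y
  rw [diffOp_eq]
  simp only [← hT]
  refine sum_dx_mul_mem W C T (fun v => ?_) (fun ℓ => ?_)
  · rw [hT]
    exact Submodule.add_mem _ (Submodule.smul_mem _ _ (fderiv_mem_submodule W hu hW _))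
      (Submodule.smul_mem _ _ (fderiv_mem_submodule W hu hW _))
  · refine hC (ℓ.restrictScalars ℝ ∘ₗ (fderiv ℝ u y : V →ₗ[ℝ] Alt V)) _ fun v => ?_
    change ℓ (T v) = a * ℓ (fderiv ℝ u y v) + b * ℓ (fderiv ℝ u y (Complex.I • v))
    rw [hT, dirDeriv, map_add, map_smul, map_smul, smul_eq_mul, smul_eq_mul]

/-- The part `(c(v) - i c(iv)) / 2` of a functional `c` is `ℂ`-linear. -/
theorem holo_part_mem {c g : Covec V}
    (hg : ∀ v, g v = 1 / 2 * c v + -Complex.I / 2 * c (Complex.I • v)) : g ∈ covec10 V := fun v => by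
  rw [hg, hg, smul_smul, Complex.I_mul_I, neg_one_smul, map_neg]
  linear_combination (1 / 2 * c (Complex.I • v)) * Complex.I_mul_I

/-- The part `(c(v) + i c(iv)) / 2` of a functional `c` is conjugate-linear. -/
theorem anti_part_mem {c g : Covec V}
    (hg : ∀ v, g v = 1 / 2 * c v + Complex.I / 2 * c (Complex.I • v)) : g ∈ covec01 V := fun v => by
  rw [hg, hg, smul_smul, Complex.I_mul_I, neg_one_smul, map_neg]
  linear_combination (1 / 2 * c (Complex.I • v)) * Complex.I_mul_I

end DiffOp

/-! ### Differential forms: Leibniz rules, types, conjugation and the circle action -/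

section FormCalculus

variable {V : Type*} [NormedAddCommGroup V] [NormedSpace ℂ V] [FiniteDimensional ℂ V]
variable {X : Type*} [TopologicalSpace X] [ChartedSpace V X] [IsManifold 𝓘(ℂ, V) ω X]

theorem rotAlt_one (a : Alt V) : rotAlt 1 a = a := by
  have h : scale V 1 = LinearMap.id := by ext v; simp [scale_apply]
  rw [rotAlt, h, pull_id]

theorem Form.ext {α β : Form V X} (h : ∀ x, α.1 x = β.1 x) : α = β := Subtype.ext (funext h)

/-- The expression of a form in the preferred chart at `x` determines its value at `x`. -/
theorem pull_localRep_self (β : PreForm V X) (x : X) :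
    pull ((derivFrom (chartAt V x) x).toLinearMap.restrictScalars ℝ)
      (localRep x β (chartAt V x x)) = β x := by
  have hx := mem_chart_source V x
  have hm : MDifferentiableAt 𝓘(ℂ, V) 𝓘(ℂ, V) (chartAt V x).symm (chartAt V x x) :=
    ((contMDiffOn_chart_symm (I := 𝓘(ℂ, V)) (n := ω) (x := x)).contMDiffAt
      ((chartAt V x).open_target.mem_nhds (mem_chart_target V x))).mdifferentiableAt (by simp)
  have hm' : MDifferentiableAt 𝓘(ℂ, V) 𝓘(ℂ, V) (chartAt V x) x :=
    ((contMDiffOn_chart (I := 𝓘(ℂ, V)) (n := ω) (x := x)).contMDiffAt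
      ((chartAt V x).open_source.mem_nhds hx)).mdifferentiableAt (by simp)
  have hid : (ContinuousLinearMap.id ℂ V) =
      (derivTo (chartAt V x).symm (chartAt V x x)).comp (derivFrom (chartAt V x) x) := by
    have h1 : (mfderiv 𝓘(ℂ, V) 𝓘(ℂ, V) ((chartAt V x).symm ∘ chartAt V x) x : V →L[ℂ] V) =
        (derivTo (chartAt V x).symm (chartAt V x x)).comp (derivFrom (chartAt V x) x) :=
      mfderiv_comp (I := 𝓘(ℂ, V)) (I' := 𝓘(ℂ, V)) (I'' := 𝓘(ℂ, V)) x hm hm'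
    rw [← h1]
    have h2 : (chartAt V x).symm ∘ chartAt V x =ᶠ[𝓝 x] id :=
      (chartAt V x).eventually_left_inverse hx
    have h3 : (mfderiv 𝓘(ℂ, V) 𝓘(ℂ, V) ((chartAt V x).symm ∘ chartAt V x) x : V →L[ℂ] V) =
      mfderiv 𝓘(ℂ, V) 𝓘(ℂ, V) id x := h2.mfderiv_eq
    rw [h3]
    exact mfderiv_id.symm
  have hpp : (chartAt V x).symm (chartAt V x x) = x := (chartAt V x).left_inv hx
  have := pull_comp_clm hid rfl (β x)
  rw [localRep, pullTo, hpp]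
  rw [← this]
  exact pull_id (β x)

/-- The action of `rotAlt u` on forms; for `|u| = 1` this is the circle action with weight `p - q`
on forms of type `(p,q)`, and for `u = -1` it is the parity involution. -/
def Form.rot (u : ℂ) : Form V X →ₐ[ℂ] Form V X where
  toFun α := ⟨fun x => rotAlt u (α.1 x), fun x₀ =>
    (contDiffOn_linear (α.2 x₀) ((rotAlt (V := V) u).toLinearMap.restrictScalars ℝ)).congr
      (fun _ _ => pull_rotAlt _ _ _)⟩
  map_one' := Form.ext fun _ => map_one (rotAlt u)
  map_mul' _ _ := Form.ext fun _ => map_mul (rotAlt u) _ _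
  map_zero' := Form.ext fun _ => map_zero (rotAlt u)
  map_add' _ _ := Form.ext fun _ => map_add (rotAlt u) _ _
  commutes' c := Form.ext fun _ => (rotAlt (V := V) u).commutes c

theorem Form.rot_ofFun (u : ℂ) (f : SmoothFun V X) : Form.rot u (Form.ofFun f) = Form.ofFun f :=
  Form.ext fun x => (rotAlt (V := V) u).commutes (f.1 x)

theorem Form.rot_of_mem {p q : ℕ} {α : Form V X} (hα : α ∈ Form.ofType V X p q) (u : ℂ) :
    Form.rot u α = (u ^ p * starRingEnd ℂ u ^ q) • α :=
  Form.ext fun x => rotAlt_of_mem (hα x) u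

theorem Form.rot_neg_one_of_mem {j : ℕ} {α : Form V X} (hα : α ∈ Form.ofDegree V X j) :
    Form.rot (-1) α = (-1 : ℂ) ^ j • α :=
  Form.ext fun x => (rotAlt_neg_one (α.1 x)).trans (involute_of_mem (hα x))

theorem Form.star_mul (α β : Form V X) : Form.star (α * β) = Form.star β * Form.star α :=
  Form.ext fun _ => starAlt_mul _ _

theorem Form.star_star (α : Form V X) : Form.star (Form.star α) = α :=
  Form.ext fun _ => starAlt_starAlt _

theorem Form.star_ofFun (f : SmoothFun V X) :
    Form.star (Form.ofFun f) = Form.ofFun (SmoothFun.conj f) :=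
  Form.ext fun _ => starAlt_algebraMap _

theorem Form.star_one : Form.star (1 : Form V X) = 1 :=
  Form.ext fun _ => by
    have := starAlt_algebraMap (V := V) 1
    rwa [map_one, map_one, map_one] at this

theorem Form.star_const_smul (c : ℂ) (α : Form V X) :
    Form.star (c • α) = starRingEnd ℂ c • Form.star α :=
  Form.ext fun _ => starAlt_smul _ _

theorem Form.star_rot (u : ℂ) (α : Form V X) : Form.star (Form.rot u α) = Form.rot u (Form.star α) :=
  Form.ext fun _ => starAlt_rotAlt _ _

theorem Form.star_mem_ofType {p q : ℕ} {α : Form V X} (hα : α ∈ Form.ofType V X p q) :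
    Form.star α ∈ Form.ofType V X q p := fun x => starAlt_mem_altType (hα x)

theorem Form.mul_mem_ofType {p q p' q' : ℕ} {α β : Form V X} (hα : α ∈ Form.ofType V X p q)
    (hβ : β ∈ Form.ofType V X p' q') : α * β ∈ Form.ofType V X (p + p') (q + q') :=
  fun x => mul_mem_altType (hα x) (hβ x)

/-- The graded Leibniz rule. -/
theorem Form.diff_mul (a b : ℂ) (α β : Form V X) :
    Form.diff a b (α * β) = Form.diff a b α * β + Form.rot (-1) α * Form.diff a b β :=
  Form.ext fun x => by
    have h : localRep x (α * β).1 = fun z => localRep x α.1 z * localRep x β.1 z :=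
      funext fun z => pullTo_mul _ _ _ _
    change preDiff a b (α * β).1 x =
      preDiff a b α.1 x * β.1 x + rotAlt (-1) (α.1 x) * preDiff a b β.1 x
    have h2 : rotAlt (-1) (α.1 x) = pull ((derivFrom (chartAt V x) x).toLinearMap.restrictScalars ℝ)
        (CliffordAlgebra.involute (localRep x α.1 (chartAt V x x))) := by
      rw [← rotAlt_neg_one, pull_rotAlt, pull_localRep_self]
    rw [preDiff, h, diffOp_mul a b (localRep_differentiableAt α.2 x)
      (localRep_differentiableAt β.2 x), map_add, map_mul, map_mul, h2, pull_localRep_self]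
    rfl

theorem Form.diff_diff (a b : ℂ) (α : Form V X) : Form.diff a b (Form.diff a b α) = 0 :=
  Form.ext fun x => by
    change preDiff a b (preDiff a b α.1) x = 0
    have hx := mem_chart_target V x
    have h : localRep x (preDiff a b α.1) =ᶠ[𝓝 (chartAt V x x)] diffOp a b (localRep x α.1) := by
      filter_upwards [(chartAt V x).open_target.mem_nhds hx] with z hz
      exact localRep_preDiff a b α.2 hz
    rw [preDiff, diffOp_congr a b h, diffOp_diffOp a b (chartAt V x).open_target (α.2 x) hx,
      map_zero]

theorem Form.rot_neg_one_diff (a b : ℂ) (α : Form V X) :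
    Form.rot (-1) (Form.diff a b α) = -Form.diff a b (Form.rot (-1) α) :=
  Form.ext fun x => by
    change rotAlt (-1) (preDiff a b α.1 x) = -preDiff a b (Form.rot (-1) α).1 x
    have h : localRep x (Form.rot (-1) α).1 = fun z => rotAlt (-1) (localRep x α.1 z) :=
      funext fun z => pull_rotAlt _ _ _
    rw [preDiff, preDiff, h, ← map_neg, ← involute_diffOp a b (localRep_differentiableAt α.2 x),
      pull_rotAlt]

theorem Form.star_diff (a b : ℂ) (α : Form V X) :
    Form.star (Form.diff a b α) =
      -Form.diff (starRingEnd ℂ a) (starRingEnd ℂ b) (Form.rot (-1) (Form.star α)) :=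
  Form.ext fun x => by
    change starAlt (preDiff a b α.1 x) =
      -preDiff (starRingEnd ℂ a) (starRingEnd ℂ b) (Form.rot (-1) (Form.star α)).1 x
    have hs : ∀ (A : V →ₗ[ℝ] V) (w : Alt V), pull A (starAlt w) = starAlt (pull A w) :=
      fun A w => by rw [starAlt, starAlt, pull_conj, pull_weight]
    have h : localRep x (Form.rot (-1) (Form.star α)).1 =
        fun z => rotAlt (-1) (starAlt (localRep x α.1 z)) :=
      funext fun z => by
        change pull _ (rotAlt (-1) (starAlt _)) = _
        rw [pull_rotAlt, hs]
        rfl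
    rw [preDiff, preDiff, h, ← map_neg, ← starAlt_diffOp a b (localRep_differentiableAt α.2 x), hs]

/-- If the functionals `v ↦ a c(v) + b c(iv)` lie in `C`, then `diff a b` changes types of forms in
the same way as multiplication by `C`. -/
theorem Form.diff_mem_ofType (a b : ℂ) {C : Submodule ℂ (Covec V)}
    (hC : ∀ c g : Covec V, (∀ v, g v = a * c v + b * c (Complex.I • v)) → g ∈ C)
    {p q p' q' : ℕ} (hpq : C.map (ExteriorAlgebra.ι ℂ) * altType V p q ≤ altType V p' q')
    {α : Form V X} (hα : α ∈ Form.ofType V X p q) : Form.diff a b α ∈ Form.ofType V X p' q' :=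
  fun x => pull_mem_altType _ <| hpq <| diffOp_mem a b C hC _ (localRep_differentiableAt α.2 x)
    (Filter.Eventually.of_forall fun _ => pull_mem_altType _ (hα _))

theorem del_mem_ofType {p q : ℕ} {α : Form V X} (hα : α ∈ Form.ofType V X p q) :
    del α ∈ Form.ofType V X (p + 1) q := by
  refine Form.diff_mem_ofType _ _ (fun c g hg => holo_part_mem hg) ?_ hα
  have h := altType_mul (V := V) 1 0 p q
  rw [add_comm 1 p, zero_add] at h
  rw [← h]
  refine mul_le_mul' ?_ le_rfl
  rw [altType, pow_one, pow_zero, mul_one]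

theorem delbar_mem_ofType {p q : ℕ} {α : Form V X} (hα : α ∈ Form.ofType V X p q) :
    delbar α ∈ Form.ofType V X p (q + 1) := by
  refine Form.diff_mem_ofType _ _ (fun c g hg => anti_part_mem hg) ?_ hα
  have h := altType_mul (V := V) 0 1 p q
  rw [add_comm 1 q, zero_add] at h
  rw [← h]
  refine mul_le_mul' ?_ le_rfl
  rw [altType, pow_one, pow_zero, one_mul]

theorem extD_eq (α : Form V X) : extD α = del α + delbar α :=
  Form.ext fun x => by
    change preDiff 1 0 α.1 x = preDiff _ _ α.1 x + preDiff _ _ α.1 x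
    simp only [preDiff]
    rw [← map_add, diffOp, diffOp, diffOp, ← Finset.sum_add_distrib]
    congr 1
    refine Finset.sum_congr rfl fun j _ => ?_
    rw [← mul_add]
    congr 1
    module

theorem Form.star_delbar (α : Form V X) :
    Form.star (delbar α) = -del (Form.rot (-1) (Form.star α)) := by
  rw [delbar, del, Form.star_diff]
  congr 4 <;> simp [Complex.conj_ofNat]

theorem Form.star_del (α : Form V X) :
    Form.star (del α) = -delbar (Form.rot (-1) (Form.star α)) := by
  rw [delbar, del, Form.star_diff]
  congr 4 <;> simp [Complex.conj_ofNat]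

theorem Form.fun_smul_eq (f : SmoothFun V X) (α : Form V X) : f • α = Form.ofFun f * α :=
  Algebra.smul_def f α

theorem Form.ofFun_comm (f : SmoothFun V X) (α : Form V X) :
    Form.ofFun f * α = α * Form.ofFun f := Algebra.commutes f α

/-- The sign operator `twist k` is the `k`-th power of the parity involution. -/
theorem Form.twist_eq_rot (k : ℤ) (α : Form V X) :
    Form.twist k α = Form.rot ((-1) ^ k) α :=
  Form.ext fun x => by
    change ChernSuper.weight (fun j : ℕ => (-1) ^ (k * j)) (α.1 x) = rotAlt ((-1) ^ k) (α.1 x)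
    generalize α.1 x = a
    induction a using alt_induction with
    | h0 => rw [map_zero, map_zero]
    | hadd a b ha hb => rw [map_add, map_add, ha, hb]
    | hom j a ha =>
      rw [weight_of_mem _ ha, zpow_mul, zpow_natCast]
      rcases Int.even_or_odd k with hk | hk
      · rw [hk.neg_one_zpow, one_pow, one_smul]
        exact (rotAlt_one a).symm
      · rw [hk.neg_one_zpow, rotAlt_neg_one, involute_of_mem ha]

theorem Form.rot_rot (u v : ℂ) (α : Form V X) : Form.rot u (Form.rot v α) = Form.rot (u * v) α :=
  Form.ext fun x => by
    have h : scale V (u * v) = scale V v ∘ₗ scale V u := by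
      ext w
      simp [scale_apply, smul_smul, mul_comm]
    change rotAlt u (rotAlt v (α.1 x)) = rotAlt (u * v) (α.1 x)
    rw [rotAlt, rotAlt, rotAlt, h, pull_comp]

theorem Form.rot_one (α : Form V X) : Form.rot 1 α = α := Form.ext fun x => rotAlt_one (α.1 x)

theorem Form.twist_twist (k : ℤ) (α : Form V X) : Form.twist k (Form.twist k α) = α := by
  rw [Form.twist_eq_rot, Form.twist_eq_rot, Form.rot_rot, ← mul_zpow]
  simp only [neg_mul_neg, one_mul, one_zpow, Form.rot_one]

theorem Form.twist_of_mem {p q : ℕ} {α : Form V X} (hα : α ∈ Form.ofType V X p q) (k : ℤ) :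
    Form.twist k α = ((-1 : ℂ) ^ (k * ((p + q : ℕ) : ℤ))) • α :=
  Form.ext fun x => weight_of_mem _ (altType_le_degree p q (hα x))

end FormCalculus

/-! ### Finite frames of vector bundles -/

section Frames

variable {V : Type*} [NormedAddCommGroup V] [NormedSpace ℂ V]
variable {X : Type*} [TopologicalSpace X] [ChartedSpace V X]

/-- A smooth cut-off function with support in a given neighbourhood. -/
theorem exists_cutoff [FiniteDimensional ℂ V] [T2Space X] [IsManifold 𝓘(ℂ, V) ω X] (x₀ : X)
    {U : Set X} (hU : U ∈ 𝓝 x₀) : ∃ χ : SmoothFun V X, χ.1 x₀ = 1 ∧ tsupport χ.1 ⊆ U := by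
  have : FiniteDimensional ℝ V := FiniteDimensional.complexToReal V
  obtain ⟨f, -, hf⟩ := (SmoothBumpFunction.nhds_basis_tsupport (I := 𝓘(ℝ, V)) x₀).mem_iff.1 hU
  refine ⟨⟨fun x => ((f x : ℝ) : ℂ), Complex.ofRealCLM.contDiff.contMDiff.comp f.contMDiff⟩, ?_, ?_⟩
  · change ((f x₀ : ℝ) : ℂ) = 1
    rw [f.eq_one, Complex.ofReal_one]
  · refine subset_trans (closure_mono ?_) hf
    intro x hx
    simpa using hx

theorem smoothOn_cutoff {G : Type*} [NormedAddCommGroup G] [NormedSpace ℂ G] (χ : SmoothFun V X)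
    {U B : Set X} (hU : IsOpen U) (hB : IsOpen B) (hχ : tsupport χ.1 ⊆ U) {φ : X → G}
    (hφ : SmoothOn V φ (U ∩ B)) : SmoothOn V (fun x => χ.1 x • φ x) B := fun x hx => by
  refine ContMDiffAt.contMDiffWithinAt ?_
  by_cases hxU : x ∈ U
  · have h1 : SmoothOn V (fun x => χ.1 x • φ x) (U ∩ B) := SmoothOn.smul χ.2.contMDiffOn hφ
    exact h1.contMDiffAt ((hU.inter hB).mem_nhds ⟨hxU, hx⟩)
  · have h1 : χ.1 =ᶠ[𝓝 x] 0 := notMem_tsupport_iff_eventuallyEq.1 fun h => hxU (hχ h)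
    refine (contMDiffAt_const (c := (0 : G))).congr_of_eventuallyEq (h1.mono fun z hz => ?_)
    simp only [hz, Pi.zero_apply, zero_smul]

variable {F : Type*} [NormedAddCommGroup F] [NormedSpace ℂ F]
  {E : X → Type*} [∀ x, AddCommGroup (E x)] [∀ x, Module ℂ (E x)]
  [TopologicalSpace (Bundle.TotalSpace F E)] [∀ x, TopologicalSpace (E x)]
  [FiberBundle F E] [VectorBundle ℂ F E]

theorem smoothOn_transition [SmoothComplexBundle V F E]
    (e e' : Bundle.Trivialization F (Bundle.TotalSpace.proj (E := E)))
    [MemTrivializationAtlas e] [MemTrivializationAtlas e'] (v : F) :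
    SmoothOn V (fun x => e'.linearMapAt ℂ x (e.symmₗ ℂ x v)) (e.baseSet ∩ e'.baseSet) := by
  have h := ((ContinuousLinearMap.apply ℂ F v).restrictScalars ℝ).contDiff.contMDiff.comp_contMDiffOn
    (SmoothComplexBundle.smoothOn_coordChangeL (V := V) e e')
  refine h.congr fun x hx => ?_
  change _ = e.coordChangeL ℂ e' x v
  rw [Bundle.Trivialization.coordChangeL_apply _ _ hx, Bundle.Trivialization.linearMapAt_apply,
    if_pos hx.2, Bundle.Trivialization.symmₗ_apply _ hx.1]

/-- The product of a local section which is constant in a trivialization with a cut-off function,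
as a global section. -/
def cutoffSection [SmoothComplexBundle V F E]
    (e : Bundle.Trivialization F (Bundle.TotalSpace.proj (E := E))) [MemTrivializationAtlas e]
    (χ : SmoothFun V X) (hχ : tsupport χ.1 ⊆ e.baseSet) (v : F) : Sect V F E :=
  ⟨fun x => χ.1 x • e.symmₗ ℂ x v, fun e' _ => by
    simp only [map_smul]
    exact smoothOn_cutoff χ e.open_baseSet e'.open_baseSet hχ (smoothOn_transition e e' v)⟩

variable [FiniteDimensional ℂ F]

/-- The Riesz representation of functionals on the fibres. -/
theorem HermitianMetric.exists_riesz (h : HermitianMetric V F E) (x : X) (φ : E x →ₗ[ℂ] ℂ) :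
    ∃ g : E x, ∀ v, h.form x g v = φ v := by
  have e := (trivializationAt F E x).linearEquivAt ℂ x (mem_baseSet_trivializationAt F E x)
  have : FiniteDimensional ℂ (E x) := e.symm.finiteDimensional
  have : FiniteDimensional ℝ (E x) := FiniteDimensional.complexToReal _
  have : FiniteDimensional ℝ (Module.Dual ℂ (E x)) := FiniteDimensional.complexToReal _
  -- the conjugate-linear map `g ↦ h(g, ·)`, regarded as a real-linear map between spaces of the
  -- same real dimension
  let Φ : E x →ₗ[ℝ] Module.Dual ℂ (E x) :=
    { toFun := fun g => h.form x g
      map_add' := map_add _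
      map_smul' := fun r g => by
        change h.form x ((r : ℂ) • g) = (r : ℂ) • h.form x g
        rw [LinearMap.map_smulₛₗ, Complex.conj_ofReal] }
  have hinj : Function.Injective Φ := by
    rw [← LinearMap.ker_eq_bot, LinearMap.ker_eq_bot']
    intro g hg
    exact h.definite (congrArg (fun φ : Module.Dual ℂ (E x) => φ g) hg)
  have hsurj : Function.Surjective Φ := by
    refine (LinearMap.injective_iff_surjective_of_finrank_eq_finrank ?_).1 hinj
    rw [finrank_real_of_complex, finrank_real_of_complex, Subspace.dual_finrank_eq]
  obtain ⟨g, hg⟩ := hsurj φ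
  exact ⟨g, fun v => congrArg (fun φ : Module.Dual ℂ (E x) => φ v) hg⟩

/-- A smooth family of functionals on the fibres is represented by a smooth section. -/
theorem HermitianMetric.exists_sect (h : HermitianMetric V F E) (φ : (x : X) → E x →ₗ[ℂ] ℂ)
    (hφ : ∀ (e : Bundle.Trivialization F (Bundle.TotalSpace.proj (E := E)))
      [MemTrivializationAtlas e] (v : F), SmoothOn V (fun x => φ x (e.symmₗ ℂ x v)) e.baseSet) :
    ∃ f : Sect V F E, ∀ x v, h.form x (f.1 x) v = φ x v := by
  choose g hg using fun x => h.exists_riesz x (φ x)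
  refine ⟨⟨g, fun e _ => h.smoothOn_of_pair e subset_rfl fun v => ?_⟩, hg⟩
  refine (hφ e v).conj.congr fun x _ => ?_
  rw [h.symm, hg]

/-- A finite family of sections `e_i` with dual sections `f_i`: every vector `v` in a fibre is
`∑_i h(f_i, v) e_i`. The sections need not be linearly independent. -/
structure Frame (h : HermitianMetric V F E) where
  /-- the number of sections -/
  n : ℕ
  /-- the generating sections -/
  e : Fin n → Sect V F E
  /-- the dual sections -/
  f : Fin n → Sect V F E
  expand : ∀ x v, v = ∑ i, h.form x ((f i).1 x) v • (e i).1 x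

/-- The generating sections and the dual sections of a frame may be exchanged. -/
theorem Frame.expand_dual {h : HermitianMetric V F E} (B : Frame h) (x : X) (v : E x) :
    v = ∑ i, h.form x ((B.e i).1 x) v • (B.f i).1 x := by
  refine h.nondeg fun w => ?_
  conv_lhs => rw [B.expand x w]
  rw [map_sum, map_sum, LinearMap.sum_apply]
  refine Finset.sum_congr rfl fun i _ => ?_
  rw [LinearMap.map_smulₛₗ, map_smul, LinearMap.smul_apply, ← h.symm, smul_eq_mul, smul_eq_mul,
    mul_comm]

/-- Frames exist over a compact base: finitely many local frames, cut off by functions `χ_a`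
without common zeros, generate all fibres, and the coefficients are normalized by
`∑_a |χ_a|²`. -/
theorem exists_frame [FiniteDimensional ℂ V] [T2Space X] [CompactSpace X] [IsManifold 𝓘(ℂ, V) ω X]
    [SmoothComplexBundle V F E] (h : HermitianMetric V F E) : Nonempty (Frame h) := by
  classical
  choose χ hχ1 hχ using fun x₀ : X => exists_cutoff (V := V) x₀
    ((trivializationAt F E x₀).open_baseSet.mem_nhds (mem_baseSet_trivializationAt F E x₀))
  have hcont : ∀ a, Continuous (χ a).1 := fun a => (χ a).2.continuous
  obtain ⟨t, ht⟩ := isCompact_univ.elim_finite_subcover (fun a : X => {x | (χ a).1 x ≠ 0})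
    (fun a => isOpen_ne_fun (hcont a) continuous_const)
    (fun x _ => Set.mem_iUnion.2 ⟨x, by simp [hχ1 x]⟩)
  set N : X → ℂ := fun x => ∑ a ∈ t, starRingEnd ℂ ((χ a).1 x) * (χ a).1 x with hN
  have hN0 : ∀ x, N x ≠ 0 := fun x h0 => by
    obtain ⟨a, ha, hax⟩ := Set.mem_iUnion₂.1 (ht (Set.mem_univ x))
    have h1 : N x = ((∑ a ∈ t, Complex.normSq ((χ a).1 x) : ℝ) : ℂ) := by
      rw [hN, Complex.ofReal_sum]
      exact Finset.sum_congr rfl fun a _ => (Complex.normSq_eq_conj_mul_self).symm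
    rw [h1, Complex.ofReal_eq_zero,
      Finset.sum_eq_zero_iff_of_nonneg (fun a _ => Complex.normSq_nonneg _)] at h0
    exact hax (Complex.normSq_eq_zero.1 (h0 a ha))
  have hNs : SmoothOn V N Set.univ := SmoothOn.sum _ fun a _ =>
    SmoothOn.mul (SmoothOn.conj (χ a).2.contMDiffOn) (χ a).2.contMDiffOn
  have hNi : SmoothOn V (fun x => (N x)⁻¹) Set.univ := hNs.inv fun x _ => hN0 x
  set b := Module.finBasis ℂ F
  -- the coefficient of `v` with respect to the section with index `(a, i)`
  let φ : X → Fin (Module.finrank ℂ F) → (x : X) → E x →ₗ[ℂ] ℂ := fun a i x =>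
    ((N x)⁻¹ * starRingEnd ℂ ((χ a).1 x)) •
      (b.coord i ∘ₗ (trivializationAt F E a).linearMapAt ℂ x)
  have hφ : ∀ a i (e : Bundle.Trivialization F (Bundle.TotalSpace.proj (E := E)))
      [MemTrivializationAtlas e] (v : F),
      SmoothOn V (fun x => φ a i x (e.symmₗ ℂ x v)) e.baseSet := fun a i e _ v => by
    have h1 : SmoothOn V (fun x => (SmoothFun.conj (χ a)).1 x • b.coord i
        ((trivializationAt F E a).linearMapAt ℂ x (e.symmₗ ℂ x v))) e.baseSet := by
      refine smoothOn_cutoff (SmoothFun.conj (χ a)) (trivializationAt F E a).open_baseSet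
        e.open_baseSet (subset_trans (closure_mono fun x hx => ?_) (hχ a)) ?_
      · intro h0
        apply hx
        change starRingEnd ℂ ((χ a).1 x) = 0
        rw [h0, map_zero]
      · refine SmoothOn.coord ?_ _
        rw [Set.inter_comm]
        exact smoothOn_transition e (trivializationAt F E a) v
    refine (SmoothOn.mul (hNi.mono (Set.subset_univ _)) h1).congr fun x _ => ?_
    exact mul_assoc _ _ _
  choose f hf using fun a i => h.exists_sect (φ a i) (fun e _ v => hφ a i e v)
  let J := t × Fin (Module.finrank ℂ F)
  let σ := (Fintype.equivFin J).symm
  refine ⟨⟨Fintype.card J, fun j => cutoffSection (trivializationAt F E (σ j).1.1) (χ (σ j).1.1)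
    (hχ (σ j).1.1) (b (σ j).2), fun j => f (σ j).1.1 (σ j).2, fun x v => ?_⟩⟩
  rw [Equiv.sum_comp σ (fun j : J => h.form x ((f j.1.1 j.2).1 x) v •
    (cutoffSection (trivializationAt F E j.1.1) (χ j.1.1) (hχ j.1.1) (b j.2)).1 x),
    Fintype.sum_prod_type]
  have key : ∀ a : X, ∑ i, h.form x ((f a i).1 x) v •
      (cutoffSection (trivializationAt F E a) (χ a) (hχ a) (b i)).1 x =
      ((N x)⁻¹ * (starRingEnd ℂ ((χ a).1 x) * (χ a).1 x)) • v := fun a => by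
    have h1 : ∀ i, h.form x ((f a i).1 x) v •
        (cutoffSection (trivializationAt F E a) (χ a) (hχ a) (b i)).1 x =
        ((N x)⁻¹ * (starRingEnd ℂ ((χ a).1 x) * (χ a).1 x)) •
          (b.coord i ((trivializationAt F E a).linearMapAt ℂ x v) •
            (trivializationAt F E a).symmₗ ℂ x (b i)) := fun i => by
      rw [hf]
      change ((N x)⁻¹ * starRingEnd ℂ ((χ a).1 x) * _) • (χ a).1 x • _ = _
      rw [smul_smul, smul_smul]
      congr 1
      simp only [LinearMap.comp_apply]
      ring
    rw [Finset.sum_congr rfl fun i _ => h1 i, ← Finset.smul_sum]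
    by_cases hx : x ∈ (trivializationAt F E a).baseSet
    · rw [← sect_expand _ hx v]
    · have h0 : (χ a).1 x = 0 := by
        by_contra hne
        exact hx (hχ a (subset_closure hne))
      rw [h0, mul_zero, mul_zero, zero_smul, zero_smul]
  rw [Finset.sum_congr rfl fun a _ => key a.1, ← Finset.sum_smul, ← Finset.mul_sum,
    Finset.sum_coe_sort t (fun a => starRingEnd ℂ ((χ a).1 x) * (χ a).1 x)]
  change v = ((N x)⁻¹ * N x) • v
  rw [inv_mul_cancel₀ (hN0 x), one_smul]

/-- Sections of a bundle of rank zero vanish. -/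
theorem sect_eq_zero [Subsingleton F] (s : Sect V F E) : s = 0 :=
  Subtype.ext (funext fun x => by
    rw [sect_expand (trivializationAt F E x) (mem_baseSet_trivializationAt F E x) (s.1 x)]
    refine Finset.sum_eq_zero fun i _ => ?_
    rw [Subsingleton.elim (Module.finBasis ℂ F i) 0, map_zero, smul_zero])

end Frames

/-! ### Forms with values in a graded bundle -/

section GradedForms

variable {V : Type u} [NormedAddCommGroup V] [NormedSpace ℂ V] [FiniteDimensional ℂ V]
variable {X : Type v} [TopologicalSpace X] [ChartedSpace V X] [IsManifold 𝓘(ℂ, V) ω X]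
variable {E : GradedBundle.{u, v, w, z} V X}

open GradedBundle

theorem forms_induction {P : E.Forms → Prop} (h0 : P 0) (hadd : ∀ s t, P s → P t → P (s + t))
    (htmul : ∀ k e α, P (tmul k e α)) (s : E.Forms) : P s := by
  refine DirectSum.induction_on (motive := P) s h0 (fun k x => ?_) hadd
  change P (E.ofForm k x)
  induction x using TensorProduct.induction_on with
  | zero => rw [map_zero]; exact h0
  | tmul e α => exact htmul k e α
  | add x y hx hy => rw [map_add]; exact hadd _ _ hx hy

theorem tmul_zero_form (k : ℤ) (e : E.Sec k) : tmul k e (0 : Form V X) = 0 := by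
  rw [tmul, TensorProduct.tmul_zero, map_zero]

theorem zero_tmul_sec (k : ℤ) (α : Form V X) : tmul k (0 : E.Sec k) α = 0 := by
  rw [tmul, TensorProduct.zero_tmul, map_zero]

theorem tmul_sum_sec {ι : Type*} (I : Finset ι) (k : ℤ) (e : ι → E.Sec k) (α : Form V X) :
    tmul k (∑ i ∈ I, e i) α = ∑ i ∈ I, tmul k (e i) α := by
  rw [tmul, TensorProduct.sum_tmul, map_sum]
  rfl

theorem const_smul_tmul (c : ℂ) (k : ℤ) (e : E.Sec k) (α : Form V X) :
    c • tmul k e α = tmul k e (c • α) := by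
  change algebraMap ℂ (SmoothFun V X) c • tmul k e α = _
  rw [fun_smul_tmul, algebraMap_smul]

theorem Form.ofFun_algebraMap (c : ℂ) :
    Form.ofFun (algebraMap ℂ (SmoothFun V X) c) = algebraMap ℂ (Form V X) c := by
  have h := algebraMap_smul (SmoothFun V X) c (1 : Form V X)
  rw [Form.fun_smul_eq, mul_one] at h
  rw [h, Algebra.algebraMap_eq_smul_one]

theorem const_smul_eq_rmul (c : ℂ) (s : E.Forms) : c • s = rmul (algebraMap ℂ (Form V X) c) s := by
  rw [← Form.ofFun_algebraMap, rmul_ofFun]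
  rfl

theorem rmul_tmul_one (k : ℤ) (e : E.Sec k) (α : Form V X) : tmul k e α = rmul α (tmul k e 1) := by
  rw [rmul_tmul, one_mul]

/-! ### The circle action on forms with values in a graded bundle -/

/-- The action of a complex number `u` on `A^•(X, E^•)`, combining the action on forms with
multiplication by `u^{-k}` on `E^k`. For `|u| = 1` it is multiplication by `u^{-n}` on elements of
exotic degree `n`, and for `u = -1` it is the parity involution `s ↦ (-1)^{|s|} s`. -/
def rotE (u : ℂ) : E.Forms →+ E.Forms :=
  liftForms fun k => ((E.ofForm k) ∘ₗ (LinearMap.lTensor (E.Sec k)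
    ({ toFun := fun α => u ^ (-k) • Form.rot u α
       map_add' := fun α β => by rw [map_add, smul_add]
       map_smul' := fun f α => by
        rw [Form.fun_smul_eq, map_mul, Form.rot_ofFun, ← mul_smul_comm, ← Form.fun_smul_eq]
        rfl } : Form V X →ₗ[SmoothFun V X] Form V X))).toAddMonoidHom

theorem rotE_tmul (u : ℂ) (k : ℤ) (e : E.Sec k) (α : Form V X) :
    rotE u (tmul k e α) = tmul k e (u ^ (-k) • Form.rot u α) :=
  liftForms_of _ _ _

theorem rotE_rmul (u : ℂ) (α : Form V X) (s : E.Forms) :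
    rotE u (rmul α s) = rmul (Form.rot u α) (rotE u s) := by
  induction s using forms_induction with
  | h0 => simp only [map_zero]
  | hadd s t hs ht => simp only [map_add, hs, ht]
  | htmul k e β => rw [rmul_tmul, rotE_tmul, rotE_tmul, rmul_tmul, map_mul, smul_mul_assoc]

theorem rotE_const_smul (u c : ℂ) (s : E.Forms) : rotE u (c • s) = c • rotE u s := by
  rw [const_smul_eq_rmul, rotE_rmul, AlgHom.commutes, const_smul_eq_rmul]

theorem rotE_rotE_neg_one (s : E.Forms) : rotE (-1) (rotE (-1) s) = s := by
  induction s using forms_induction with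
  | h0 => simp only [map_zero]
  | hadd s t hs ht => simp only [map_add, hs, ht]
  | htmul k e β =>
    rw [rotE_tmul, rotE_tmul, map_smul, Form.rot_rot, smul_smul, ← mul_zpow]
    simp [Form.rot_one]

theorem rotE_of_exoticDegree {u : ℂ} (hu : starRingEnd ℂ u * u = 1) {n : ℤ} {s : E.Forms}
    (hs : s ∈ E.exoticDegree n) : rotE u s = u ^ (-n) • s := by
  have hu0 : u ≠ 0 := by
    rintro rfl
    simp at hu
  induction hs using Submodule.span_induction with
  | mem s h =>
    obtain ⟨k, p, q, e, α, hα, hn, rfl⟩ := h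
    have h1 : starRingEnd ℂ u = u ^ (-1 : ℤ) := by
      rw [zpow_neg_one]; exact eq_inv_of_mul_eq_one_left hu
    rw [rotE_tmul, Form.rot_of_mem hα, const_smul_tmul, smul_smul, h1, ← zpow_natCast,
      ← zpow_natCast, ← zpow_mul, ← zpow_add₀ hu0, ← zpow_add₀ hu0, ← hn]
    congr 3
    ring
  | zero => rw [map_zero, smul_zero]
  | add s t _ _ hs ht => rw [map_add, hs, ht, smul_add]
  | smul c s _ hs => rw [rotE_const_smul, hs, smul_comm]

theorem rotE_of_totalDegree {n : ℤ} {s : E.Forms} (hs : s ∈ E.totalDegree n) :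
    rotE (-1) s = (-1 : ℂ) ^ n • s := by
  induction hs using Submodule.span_induction with
  | mem s h =>
    obtain ⟨k, j, e, α, hα, rfl, rfl⟩ := h
    rw [rotE_tmul, Form.rot_neg_one_of_mem hα, const_smul_tmul, smul_smul,
      zpow_add₀ (by norm_num), zpow_natCast, zpow_neg, ← inv_zpow, inv_neg_one]
  | zero => rw [map_zero, smul_zero]
  | add s t _ _ hs ht => rw [map_add, hs, ht, smul_add]
  | smul c s _ hs => rw [rotE_const_smul, hs, smul_comm]

/-! ### The pairing defined by a graded metric -/

variable (h : GradedMetric E)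

theorem component_ofForm (k : ℤ) (x : E.Sec k ⊗[SmoothFun V X] Form V X) :
    E.component k (E.ofForm k x) = x := DirectSum.component.lof_self _ _ _

theorem component_ofForm_ne {k l : ℤ} (hkl : k ≠ l) (x : E.Sec l ⊗[SmoothFun V X] Form V X) :
    E.component k (E.ofForm l x) = 0 :=
  (DirectSum.component.of (R := SmoothFun V X)
    (M := fun k => E.Sec k ⊗[SmoothFun V X] Form V X) k l x).trans
    (dif_neg hkl.symm)

theorem pairing_tmul (k : ℤ) (e f : E.Sec k) (α β : Form V X) :
    h.pairing (tmul k e α) (tmul k f β) = Form.star α * Form.ofFun ((h k).pair e f) * β := by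
  rw [GradedMetric.pairing, tmul, liftForms_of]
  change formPairing (h k) (e ⊗ₜ α) (E.component k (E.ofForm k (f ⊗ₜ β))) = _
  rw [component_ofForm]
  rfl

theorem pairing_tmul_ne {k l : ℤ} (hkl : k ≠ l) (e : E.Sec k) (f : E.Sec l) (α β : Form V X) :
    h.pairing (tmul k e α) (tmul l f β) = 0 := by
  rw [GradedMetric.pairing, tmul, liftForms_of]
  change formPairing (h k) (e ⊗ₜ α) (E.component k (E.ofForm l (f ⊗ₜ β))) = _
  rw [component_ofForm_ne hkl, map_zero]

theorem pairing_rmul_right (s t : E.Forms) (β : Form V X) :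
    h.pairing s (rmul β t) = h.pairing s t * β := by
  induction s using forms_induction with
  | h0 => simp only [map_zero, AddMonoidHom.zero_apply, zero_mul]
  | hadd s s' hs hs' => simp only [map_add, AddMonoidHom.add_apply, hs, hs', add_mul]
  | htmul k e α =>
    induction t using forms_induction with
    | h0 => simp only [map_zero, zero_mul]
    | hadd t t' ht ht' => simp only [map_add, ht, ht', add_mul]
    | htmul l f γ =>
      rw [rmul_tmul]
      rcases eq_or_ne k l with rfl | hkl
      · simp only [pairing_tmul, mul_assoc]
      · rw [pairing_tmul_ne h hkl, pairing_tmul_ne h hkl, zero_mul]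

theorem conj_pair (k : ℤ) (e f : E.Sec k) : SmoothFun.conj ((h k).pair e f) = (h k).pair f e :=
  Subtype.ext (funext fun x => ((h k).symm x (f.1 x) (e.1 x)).symm)

theorem star_pairing (s t : E.Forms) : Form.star (h.pairing s t) = h.pairing t s := by
  induction s using forms_induction with
  | h0 => simp only [map_zero, AddMonoidHom.zero_apply]
  | hadd s s' hs hs' => simp only [map_add, AddMonoidHom.add_apply, hs, hs']
  | htmul k e α =>
    induction t using forms_induction with
    | h0 => simp only [map_zero, AddMonoidHom.zero_apply]
    | hadd t t' ht ht' => simp only [map_add, AddMonoidHom.add_apply, ht, ht']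
    | htmul l f γ =>
      rcases eq_or_ne k l with rfl | hkl
      · rw [pairing_tmul, pairing_tmul, Form.star_mul, Form.star_mul, Form.star_star,
          Form.star_ofFun, conj_pair, mul_assoc]
      · rw [pairing_tmul_ne h hkl, pairing_tmul_ne h hkl.symm, map_zero]

theorem pairing_rmul_left (s t : E.Forms) (α : Form V X) :
    h.pairing (rmul α s) t = Form.star α * h.pairing s t := by
  rw [← star_pairing, pairing_rmul_right, Form.star_mul, star_pairing]

theorem pairing_const_smul_right (c : ℂ) (s t : E.Forms) :
    h.pairing s (c • t) = c • h.pairing s t := by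
  rw [const_smul_eq_rmul, pairing_rmul_right, ← Algebra.commutes, Algebra.smul_def]

theorem pairing_const_smul_left (c : ℂ) (s t : E.Forms) :
    h.pairing (c • s) t = starRingEnd ℂ c • h.pairing s t := by
  rw [← star_pairing, pairing_const_smul_right, Form.star_const_smul, star_pairing]

/-- The pairing is equivariant for the circle action. -/
theorem rot_pairing {u : ℂ} (hu : starRingEnd ℂ u * u = 1) (s t : E.Forms) :
    Form.rot u (h.pairing s t) = h.pairing (rotE u s) (rotE u t) := by
  induction s using forms_induction with
  | h0 => simp only [map_zero, AddMonoidHom.zero_apply]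
  | hadd s s' hs hs' => simp only [map_add, AddMonoidHom.add_apply, hs, hs']
  | htmul k e α =>
    induction t using forms_induction with
    | h0 => simp only [map_zero]
    | hadd t t' ht ht' => simp only [map_add, ht, ht']
    | htmul l f γ =>
      rw [rotE_tmul, rotE_tmul]
      rcases eq_or_ne k l with rfl | hkl
      · rw [pairing_tmul, pairing_tmul, map_mul, map_mul, Form.rot_ofFun, Form.star_const_smul,
          Form.star_rot, smul_mul_assoc, smul_mul_smul_comm, map_zpow₀, ← mul_zpow, hu, one_zpow,
          one_smul]
      · rw [pairing_tmul_ne h hkl, pairing_tmul_ne h hkl, map_zero]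

theorem pairing_tmul_one (k : ℤ) (e f : E.Sec k) (β : Form V X) :
    h.pairing (tmul k e 1) (tmul k f β) = Form.ofFun ((h k).pair e f) * β := by
  rw [pairing_tmul, Form.star_one, one_mul]

/-! ### Expansion with respect to frames -/

variable (E) in
/-- The finite set of degrees in which the bundle does not vanish. -/
def degrees : Finset ℤ := E.finite.toFinset

theorem sec_eq_zero {k : ℤ} (hk : k ∉ degrees E) (e : E.Sec k) : e = 0 := by
  have h1 : ¬Nontrivial (E.fib k) := fun h => hk (E.finite.mem_toFinset.2 h)
  have := not_nontrivial_iff_subsingleton.1 h1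
  exact sect_eq_zero e

variable {h} (B : ∀ k, Frame (h k))

theorem sum_sec_apply {k : ℤ} {ι : Type*} (I : Finset ι) (s : ι → E.Sec k) (x : X) :
    (∑ i ∈ I, s i).1 x = ∑ i ∈ I, (s i).1 x := by
  classical
  induction I using Finset.induction_on with
  | empty => rfl
  | insert i I hi ih =>
    rw [Finset.sum_insert hi, Finset.sum_insert hi, ← ih]
    rfl

theorem sec_expand {k : ℤ} (s : E.Sec k) :
    s = ∑ i, (h k).pair ((B k).f i) s • (B k).e i :=
  Subtype.ext (funext fun x => ((B k).expand x (s.1 x)).trans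
    (sum_sec_apply Finset.univ (fun i => (h k).pair ((B k).f i) s • (B k).e i) x).symm)

theorem sec_expand_dual {k : ℤ} (s : E.Sec k) :
    s = ∑ i, (h k).pair ((B k).e i) s • (B k).f i :=
  Subtype.ext (funext fun x => ((B k).expand_dual x (s.1 x)).trans
    (sum_sec_apply Finset.univ (fun i => (h k).pair ((B k).e i) s • (B k).f i) x).symm)

theorem forms_expand (s : E.Forms) :
    s = ∑ l ∈ degrees E, ∑ i, tmul l ((B l).e i) (h.pairing (tmul l ((B l).f i) 1) s) := by
  induction s using forms_induction with
  | h0 => simp only [map_zero, tmul_zero_form, Finset.sum_const_zero]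
  | hadd s t hs ht =>
    simp only [map_add, tmul_add_form, Finset.sum_add_distrib]
    rw [← hs, ← ht]
  | htmul k e α =>
    have h1 : ∀ l ∈ degrees E, l ≠ k →
        ∑ i, tmul l ((B l).e i) (h.pairing (tmul l ((B l).f i) 1) (tmul k e α)) = 0 :=
      fun l _ hl => Finset.sum_eq_zero fun i _ => by
        rw [pairing_tmul_ne h hl, tmul_zero_form]
    by_cases hk : k ∈ degrees E
    · rw [Finset.sum_eq_single_of_mem k hk h1]
      conv_lhs => rw [sec_expand B e, tmul_sum_sec]
      refine Finset.sum_congr rfl fun i _ => ?_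
      rw [pairing_tmul_one, smul_tmul_fun, Form.fun_smul_eq]
    · rw [Finset.sum_eq_zero fun l hl => h1 l hl fun h => hk (h ▸ hl), sec_eq_zero hk e,
        zero_tmul_sec]

include B in
/-- Non-degeneracy of the pairing: an element is determined by its pairings with sections. -/
theorem pairing_nondeg {s t : E.Forms}
    (hst : ∀ k (f : E.Sec k), h.pairing (tmul k f 1) s = h.pairing (tmul k f 1) t) : s = t := by
  rw [forms_expand B s, forms_expand B t]
  simp only [hst]

include B in
theorem pairing_nondeg_left {s t : E.Forms}
    (hst : ∀ k (f : E.Sec k), h.pairing s (tmul k f 1) = h.pairing t (tmul k f 1)) : s = t :=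
  pairing_nondeg B fun k f => by rw [← star_pairing, hst, star_pairing]

end GradedForms

section Connections

variable {V : Type u} [NormedAddCommGroup V] [NormedSpace ℂ V] [FiniteDimensional ℂ V]
variable {X : Type v} [TopologicalSpace X] [ChartedSpace V X] [IsManifold 𝓘(ℂ, V) ω X]
variable {E : GradedBundle.{u, v, w, z} V X}

open GradedBundle

/-! ### Superconnections as odd derivations -/

theorem neg_one_zpow_neg (k : ℤ) : (-1 : ℂ) ^ (-k) = (-1) ^ k := by
  rw [zpow_neg, ← inv_zpow, inv_neg_one]

theorem rmul_zero_form (s : E.Forms) : rmul (0 : Form V X) s = 0 := by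
  have h := rmul_add (0 : Form V X) 0 s
  rw [add_zero] at h
  exact left_eq_add.1 h

theorem rmul_one_form (s : E.Forms) : rmul (1 : Form V X) s = s := by
  rw [← map_one (Form.ofFun (V := V) (X := X)), rmul_ofFun, one_smul]

theorem rmul_smul_form (c : ℂ) (α : Form V X) (s : E.Forms) : rmul (c • α) s = c • rmul α s := by
  rw [const_smul_eq_rmul, rmul_rmul, ← Algebra.commutes, Algebra.smul_def]

/-- An odd operator `P` on `A^•(X, E^•)` with `P(s ∧ α) = P s ∧ α + (-1)^{|s|} s ∧ δ α`. -/
structure IsOddDerivation (δ : Form V X →ₗ[ℂ] Form V X) (P : E.Forms →+ E.Forms) : Prop where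
  leibniz : ∀ α s, P (rmul α s) = rmul α (P s) + rmul (δ α) (rotE (-1) s)
  odd : ∀ s, rotE (-1) (P s) = -P (rotE (-1) s)

theorem Form.diff_one (a b : ℂ) : Form.diff a b (1 : Form V X) = 0 := by
  have h := Form.diff_mul a b (1 : Form V X) 1
  rw [mul_one, mul_one, map_one (Form.rot (V := V) (X := X) (-1)), one_mul] at h
  exact left_eq_add.1 h

theorem Superconnection.extend_tmul_one {a b : ℂ}
    (hδ : ∀ (f : SmoothFun V X) (α : Form V X), Form.diff a b (f • α) =
      Form.diff a b (Form.ofFun f) * α + f • Form.diff a b α)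
    (D : Superconnection E (Form.diff a b)) (k : ℤ) (e : E.Sec k) :
    D.extend hδ (tmul k e 1) = D.toLin (E.ofSec k e) := by
  rw [Superconnection.extend_tmul, Form.diff_one, tmul_zero_form, smul_zero, add_zero,
    rmul_one_form]

/-- A superconnection which is odd on sections extends to an odd derivation. -/
theorem Superconnection.extend_isOddDerivation {a b : ℂ}
    (hδ : ∀ (f : SmoothFun V X) (α : Form V X), Form.diff a b (f • α) =
      Form.diff a b (Form.ofFun f) * α + f • Form.diff a b α)
    (D : Superconnection E (Form.diff a b))
    (hD : ∀ k e, rotE (-1) (D.toLin (E.ofSec k e)) = -((-1 : ℂ) ^ k • D.toLin (E.ofSec k e))) :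
    IsOddDerivation (Form.diff a b) (D.extend hδ) where
  leibniz α s := by
    induction s using forms_induction with
    | h0 => simp only [map_zero, add_zero]
    | hadd s t hs ht => simp only [map_add, hs, ht]; abel
    | htmul k e β =>
      rw [rmul_tmul, Superconnection.extend_tmul, Superconnection.extend_tmul, Form.diff_mul,
        tmul_add_form, smul_add, map_add, rmul_rmul, rmul_smul, rmul_tmul, rotE_tmul,
        rmul_tmul, neg_one_zpow_neg, smul_mul_assoc, ← const_smul_tmul, add_assoc]
  odd s := by
    induction s using forms_induction with
    | h0 => simp only [map_zero, neg_zero]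
    | hadd s t hs ht => simp only [map_add, hs, ht, neg_add]
    | htmul k e β =>
      rw [rotE_tmul, Superconnection.extend_tmul, Superconnection.extend_tmul, map_add, rotE_rmul,
        hD, rotE_const_smul, rotE_tmul, neg_one_zpow_neg, map_smul (Form.diff a b),
        rmul_smul_form, map_neg, rmul_smul, Form.rot_neg_one_diff, neg_add]
      congr 1
      rw [const_smul_tmul, const_smul_tmul, smul_neg, smul_neg]
      rw [eq_neg_iff_add_eq_zero, ← tmul_add_form, neg_add_cancel, tmul_zero_form]

theorem IsOddDerivation.add {δ δ' δ'' : Form V X →ₗ[ℂ] Form V X} {P Q : E.Forms →+ E.Forms}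
    (hP : IsOddDerivation δ P) (hQ : IsOddDerivation δ' Q) (hδ : ∀ α, δ'' α = δ α + δ' α) :
    IsOddDerivation δ'' (P + Q) where
  leibniz α s := by
    simp only [AddMonoidHom.add_apply, hP.leibniz, hQ.leibniz, hδ, rmul_add, map_add]
    abel
  odd s := by
    simp only [AddMonoidHom.add_apply, map_add, hP.odd, hQ.odd, neg_add]

/-- The square of an odd derivation over a differential is linear over forms. -/
theorem IsOddDerivation.sq_rmul {δ : Form V X →ₗ[ℂ] Form V X} {P : E.Forms →+ E.Forms}
    (hP : IsOddDerivation δ P) (hδ : ∀ α, δ (δ α) = 0) (α : Form V X) (s : E.Forms) :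
    P (P (rmul α s)) = rmul α (P (P s)) := by
  rw [hP.leibniz, map_add, hP.leibniz, hP.leibniz, hδ, hP.odd, rmul_zero_form, map_neg]
  abel

theorem tmul_mem_exoticDegree {k n : ℤ} {p q : ℕ} (e : E.Sec k) {α : Form V X}
    (hα : α ∈ Form.ofType V X p q) (hn : -(p : ℤ) + q + k = n) : tmul k e α ∈ E.exoticDegree n :=
  Submodule.subset_span ⟨k, p, q, e, α, hα, hn, rfl⟩

theorem tmul_one_mem_exoticDegree (k : ℤ) (e : E.Sec k) : tmul k e 1 ∈ E.exoticDegree k :=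
  tmul_mem_exoticDegree e one_mem_ofType (by simp)

theorem rmul_mem_exoticDegree {n m : ℤ} {p q : ℕ} {s : E.Forms} (hs : s ∈ E.exoticDegree n)
    {α : Form V X} (hα : α ∈ Form.ofType V X p q) (hm : -(p : ℤ) + q + n = m) :
    rmul α s ∈ E.exoticDegree m := by
  induction hs using Submodule.span_induction with
  | mem s h =>
    obtain ⟨k, p', q', e, β, hβ, hn, rfl⟩ := h
    rw [rmul_tmul]
    exact tmul_mem_exoticDegree e (Form.mul_mem_ofType hβ hα) (by push_cast; linarith)
  | zero => rw [map_zero]; exact Submodule.zero_mem _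
  | add s t _ _ hs ht => rw [map_add]; exact Submodule.add_mem _ hs ht
  | smul c s _ hs => rw [rmul_smul]; exact Submodule.smul_mem _ c hs

theorem Superconnection.extend_const_smul {δ : Form V X →ₗ[ℂ] Form V X}
    (hδ : ∀ (f : SmoothFun V X) (α : Form V X), δ (f • α) = δ (Form.ofFun f) * α + f • δ α)
    (D : Superconnection E δ) (c : ℂ) (s : E.Forms) :
    D.extend hδ (c • s) = c • D.extend hδ s := by
  induction s using forms_induction with
  | h0 => simp only [map_zero, smul_zero]
  | hadd s t hs ht => simp only [map_add, smul_add, hs, ht]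
  | htmul k e β =>
    rw [const_smul_tmul, Superconnection.extend_tmul, Superconnection.extend_tmul, map_smul,
      rmul_smul_form, smul_add, ← const_smul_tmul, smul_comm]

/-- If `D` shifts the exotic degree of sections by `m` and `δ` shifts `q - p` by `m`, then the
extension of `D` shifts the exotic degree by `m`. -/
theorem Superconnection.extend_mem_exoticDegree {δ : Form V X →ₗ[ℂ] Form V X}
    (hδ : ∀ (f : SmoothFun V X) (α : Form V X), δ (f • α) = δ (Form.ofFun f) * α + f • δ α)
    (D : Superconnection E δ) {m : ℤ}
    (hD : ∀ k e, D.toLin (E.ofSec k e) ∈ E.exoticDegree (k + m))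
    (hδm : ∀ (p q : ℕ) (α : Form V X), α ∈ Form.ofType V X p q → ∃ p' q' : ℕ,
      δ α ∈ Form.ofType V X p' q' ∧ -(p' : ℤ) + q' = -(p : ℤ) + q + m)
    {n : ℤ} {s : E.Forms} (hs : s ∈ E.exoticDegree n) :
    D.extend hδ s ∈ E.exoticDegree (n + m) := by
  induction hs using Submodule.span_induction with
  | mem s h =>
    obtain ⟨k, p, q, e, β, hβ, hn, rfl⟩ := h
    rw [Superconnection.extend_tmul]
    obtain ⟨p', q', hβ', hpq⟩ := hδm p q β hβ
    exact Submodule.add_mem _ (rmul_mem_exoticDegree (hD k e) hβ (by linarith))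
      (Submodule.smul_mem _ _ (tmul_mem_exoticDegree e hβ' (by linarith)))
  | zero => rw [map_zero]; exact Submodule.zero_mem _
  | add s t _ _ hs ht => rw [map_add]; exact Submodule.add_mem _ hs ht
  | smul c s _ hs => rw [Superconnection.extend_const_smul]; exact Submodule.smul_mem _ c hs

theorem rotE_neg_one_of_shift {k m : ℤ} {s : E.Forms} (hs : s ∈ E.exoticDegree (k + m))
    (hm : Odd m) : rotE (-1) s = -((-1 : ℂ) ^ k • s) := by
  rw [rotE_of_exoticDegree (by simp) hs, neg_one_zpow_neg, zpow_add₀ (by norm_num),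
    hm.neg_one_zpow, mul_neg_one, neg_smul]

/-! ### The exotic degree of a cohesive structure -/

section Cohesive

variable {h : GradedMetric E}

/-- The coefficients of an element of `A^{0,•}(X, E^•)` are sums of forms of types `(0,q)`. -/
theorem pairing_anti {s : E.Forms} (hs : s ∈ E.antiForms) (l : ℤ) (f : E.Sec l) (x : X) :
    (h.pairing (tmul l f 1) s).1 x ∈ ⨆ q, altType V 0 q := by
  induction hs using Submodule.span_induction with
  | mem s hs =>
    obtain ⟨k, q, e, α, hα, rfl⟩ := hs
    rcases eq_or_ne l k with rfl | hlk
    · rw [pairing_tmul_one]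
      exact Submodule.mem_iSup_of_mem q
        (zero_add q ▸ Form.mul_mem_ofType (Form.ofFun_mem_ofType _) hα x)
    · rw [pairing_tmul_ne h hlk]
      exact Submodule.zero_mem _
  | zero => rw [map_zero]; exact Submodule.zero_mem _
  | add s t _ _ hs ht => rw [map_add]; exact Submodule.add_mem _ hs ht
  | smul c s _ hs => rw [pairing_const_smul_right]; exact Submodule.smul_mem _ c hs

/-- The components of an element of total degree `n` in `E^l` are forms of degree `n - l`. Since
`toNat` is `0` at negative integers, the vanishing for `n < l` is a separate claim. -/
theorem pairing_totalDegree {n : ℤ} {s : E.Forms} (hs : s ∈ E.totalDegree n) (l : ℤ)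
    (f : E.Sec l) : h.pairing (tmul l f 1) s ∈ Form.ofDegree V X (n - l).toNat ∧
      (n < l → h.pairing (tmul l f 1) s = 0) := by
  induction hs using Submodule.span_induction with
  | mem s hs =>
    obtain ⟨k, j, e, α, hα, rfl, rfl⟩ := hs
    rcases eq_or_ne l k with rfl | hlk
    · rw [pairing_tmul_one, ← Form.fun_smul_eq]
      refine ⟨fun x => ?_, fun hlt => absurd hlt (by omega)⟩
      rw [show (l + (j : ℤ) - l).toNat = j by omega, Form.fun_smul_apply]
      exact Submodule.smul_mem _ _ (hα x)
    · rw [pairing_tmul_ne h hlk]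
      exact ⟨Submodule.zero_mem _, fun _ => rfl⟩
  | zero => rw [map_zero]; exact ⟨Submodule.zero_mem _, fun _ => rfl⟩
  | add s t _ _ hs ht =>
    rw [map_add]
    exact ⟨Submodule.add_mem _ hs.1 ht.1, fun hlt => by rw [hs.2 hlt, ht.2 hlt, add_zero]⟩
  | smul c s _ hs =>
    rw [pairing_const_smul_right]
    exact ⟨Submodule.smul_mem _ c hs.1, fun hlt => by rw [hs.2 hlt, smul_zero]⟩

variable (D'' : CohesiveStructure E)

theorem CohesiveStructure.op_tmul_one (k : ℤ) (e : E.Sec k) :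
    D''.op (tmul k e 1) = D''.toSuperconnection.toLin (E.ofSec k e) :=
  Superconnection.extend_tmul_one _ _ _ _

theorem Superconnection.opDel_tmul_one (D' : Superconnection E (del (V := V) (X := X))) (k : ℤ)
    (e : E.Sec k) : D'.opDel (tmul k e 1) = D'.toLin (E.ofSec k e) :=
  Superconnection.extend_tmul_one _ _ _ _

theorem tmul_one_mem_totalDegree (k : ℤ) (e : E.Sec k) : tmul k e 1 ∈ E.totalDegree k :=
  Submodule.subset_span ⟨k, 0, e, 1, fun x => by
    have h1 := altType_le_degree (V := V) 0 0 (one_mem_ofType (V := V) (X := X) x)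
    exact h1, by simp, rfl⟩

/-- The component of `E'' e` in `E^l`, for `e` in `E^k`, is of type `(0, k + 1 - l)`: it is a form
of degree `k + 1 - l` and a sum of forms of types `(0,q)`. -/
theorem CohesiveStructure.pairing_mem (k l : ℤ) (e : E.Sec k) (f : E.Sec l) :
    h.pairing (tmul l f 1) (D''.op (tmul k e 1)) ∈ Form.ofType V X 0 (k + 1 - l).toNat ∧
      (k + 1 < l → h.pairing (tmul l f 1) (D''.op (tmul k e 1)) = 0) := by
  have h1 := D''.op_eq ⟨tmul k e 1, tmul_mem_antiForms e one_mem_ofType⟩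
  have h2 := D''.total_degree k ⟨tmul k e 1, tmul_mem_antiForms e one_mem_ofType⟩
    (tmul_one_mem_totalDegree k e)
  rw [show D''.op (tmul k e 1) = _ from h1]
  have h3 := pairing_totalDegree (h := h) h2 l f
  exact ⟨fun x => mem_altType_of_degree (h3.1 x) (pairing_anti (Subtype.coe_prop _) l f x), h3.2⟩

/-- A cohesive structure raises the exotic degree of sections by one, which on `A^{0,•}(X, E^•)` is
the total degree. -/
theorem CohesiveStructure.mem_exoticDegree (B : ∀ k, Frame (h k)) (k : ℤ) (e : E.Sec k) :
    D''.toSuperconnection.toLin (E.ofSec k e) ∈ E.exoticDegree (k + 1) := by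
  rw [← CohesiveStructure.op_tmul_one, forms_expand B (D''.op (tmul k e 1))]
  refine Submodule.sum_mem _ fun l _ => Submodule.sum_mem _ fun i _ => ?_
  have h1 := D''.pairing_mem (h := h) k l e ((B l).f i)
  rcases lt_or_ge (k + 1) l with hlt | hle
  · rw [h1.2 hlt, tmul_zero_form]
    exact Submodule.zero_mem _
  · exact tmul_mem_exoticDegree _ h1.1 (by rw [Int.toNat_of_nonneg (by omega)]; push_cast; ring)

theorem CohesiveStructure.isOddDerivation (B : ∀ k, Frame (h k)) :
    IsOddDerivation (delbar (V := V) (X := X)) D''.op :=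
  Superconnection.extend_isOddDerivation _ _ fun k e =>
    rotE_neg_one_of_shift (D''.mem_exoticDegree B k e) odd_one

theorem CohesiveStructure.op_mem_exoticDegree (B : ∀ k, Frame (h k)) {n : ℤ} {s : E.Forms}
    (hs : s ∈ E.exoticDegree n) : D''.op s ∈ E.exoticDegree (n + 1) :=
  Superconnection.extend_mem_exoticDegree _ _ (D''.mem_exoticDegree B)
    (fun p q _ hα => ⟨p, q + 1, delbar_mem_ofType hα, by push_cast; ring⟩) hs

/-- `E''` squares to zero on all of `A^•(X, E^•)`, since its square vanishes on sections and is linear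
over forms. -/
theorem CohesiveStructure.op_op (B : ∀ k, Frame (h k)) (s : E.Forms) : D''.op (D''.op s) = 0 := by
  induction s using forms_induction with
  | h0 => simp only [map_zero]
  | hadd s t hs ht => simp only [map_add, hs, ht, add_zero]
  | htmul k e α =>
    have h1 := D''.op_eq ⟨tmul k e 1, tmul_mem_antiForms e one_mem_ofType⟩
    have h2 := D''.op_eq (D''.toLin ⟨tmul k e 1, tmul_mem_antiForms e one_mem_ofType⟩)
    rw [rmul_tmul_one, (D''.isOddDerivation B).sq_rmul (Form.diff_diff _ _),
      show D''.op (tmul k e 1) = _ from h1, h2, D''.flat]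
    exact map_zero _

end Cohesive

end Connections

section Chern

variable {V : Type u} [NormedAddCommGroup V] [NormedSpace ℂ V] [FiniteDimensional ℂ V]
variable {X : Type v} [TopologicalSpace X] [ChartedSpace V X] [IsManifold 𝓘(ℂ, V) ω X]
variable {E : GradedBundle.{u, v, w, z} V X}

open GradedBundle

/-! ### The adjoint of a cohesive structure -/

/-- The form `h(e, E'' f) - (-1)^{|e|} ∂̄ h(e, f)` for sections `e`, `f`. The Chern superconnection
is determined by the condition that `h(E' e, f)` is this form. -/
def chernFun (D'' : CohesiveStructure E) (h : GradedMetric E) (k l : ℤ) (e : E.Sec k)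
    (f : E.Sec l) : Form V X :=
  h.pairing (tmul k e 1) (D''.op (tmul l f 1)) -
    (-1 : ℂ) ^ k • delbar (h.pairing (tmul k e 1) (tmul l f 1))

variable {h : GradedMetric E} (D'' : CohesiveStructure E)

theorem chernFun_add_left (k l : ℤ) (e e' : E.Sec k) (f : E.Sec l) :
    chernFun D'' h k l (e + e') f = chernFun D'' h k l e f + chernFun D'' h k l e' f := by
  simp only [chernFun, tmul_add_sec, map_add, AddMonoidHom.add_apply, smul_add]
  abel

theorem chernFun_add_right (k l : ℤ) (e : E.Sec k) (f f' : E.Sec l) :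
    chernFun D'' h k l e (f + f') = chernFun D'' h k l e f + chernFun D'' h k l e f' := by
  simp only [chernFun, tmul_add_sec, map_add, smul_add]
  abel

theorem chernFun_zero_right (k l : ℤ) (e : E.Sec k) : chernFun D'' h k l e (0 : E.Sec l) = 0 := by
  simp only [chernFun, zero_tmul_sec, map_zero, smul_zero, sub_zero]

theorem chernFun_sum_right (k l : ℤ) (e : E.Sec k) {ι : Type*} (I : Finset ι) (f : ι → E.Sec l) :
    chernFun D'' h k l e (∑ i ∈ I, f i) = ∑ i ∈ I, chernFun D'' h k l e (f i) :=
  map_sum (AddMonoidHom.mk' (chernFun D'' h k l e) (chernFun_add_right D'' k l e)) f I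

theorem smul_tmul_one (k : ℤ) (e : E.Sec k) (g : SmoothFun V X) :
    tmul k (g • e) 1 = rmul (Form.ofFun g) (tmul k e 1) := by
  rw [smul_tmul_fun, Form.fun_smul_eq, mul_one, rmul_tmul_one]

/-- The functional `chernFun e` is linear over functions: the derivatives of a function `g` cancel
in its value at `g f`. -/
theorem chernFun_smul_right (B : ∀ k, Frame (h k)) (k l : ℤ) (e : E.Sec k) (f : E.Sec l)
    (g : SmoothFun V X) :
    chernFun D'' h k l e (g • f) = chernFun D'' h k l e f * Form.ofFun g := by
  have h1 := Form.diff_mul (1 / 2) (Complex.I / 2) (h.pairing (tmul k e 1) (tmul l f 1))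
    (Form.ofFun g)
  rw [← delbar, rot_pairing h (by simp), rotE_of_exoticDegree (by simp)
    (tmul_one_mem_exoticDegree k e), rotE_of_exoticDegree (by simp)
    (tmul_one_mem_exoticDegree l f), neg_one_zpow_neg, neg_one_zpow_neg] at h1
  rw [chernFun, smul_tmul_one, (D''.isOddDerivation B).leibniz, pairing_rmul_right, map_add, h1,
    pairing_rmul_right, pairing_rmul_right, rotE_of_exoticDegree (by simp)
    (tmul_one_mem_exoticDegree l f), neg_one_zpow_neg, pairing_const_smul_left,
    pairing_const_smul_right, chernFun, sub_mul, smul_add, smul_mul_assoc, smul_mul_assoc,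
    smul_mul_assoc, smul_smul, smul_smul, map_zpow₀, map_neg, map_one, ← mul_zpow, neg_mul_neg,
    one_mul, one_zpow, one_mul, smul_mul_assoc]
  abel

/-- The failure of linearity over functions in `e` is the Leibniz rule for `E'`. -/
theorem chernFun_smul_left (k l : ℤ) (e : E.Sec k) (f : E.Sec l) (g : SmoothFun V X) :
    chernFun D'' h k l (g • e) f = Form.ofFun (SmoothFun.conj g) * chernFun D'' h k l e f -
      (-1 : ℂ) ^ k • (delbar (Form.ofFun (SmoothFun.conj g)) *
        h.pairing (tmul k e 1) (tmul l f 1)) := by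
  rw [chernFun, smul_tmul_one, pairing_rmul_left, pairing_rmul_left, Form.star_ofFun,
    ← Form.fun_smul_eq _ (h.pairing (tmul k e 1) (tmul l f 1)), delbar_fun_smul, chernFun, mul_sub,
    mul_smul_comm, smul_add, Form.fun_smul_eq]
  abel

theorem delbar_pairing_mem (k : ℤ) (e f : E.Sec k) :
    delbar (h.pairing (tmul k e 1) (tmul k f 1)) ∈ Form.ofType V X 0 1 := by
  rw [pairing_tmul_one, mul_one]
  exact delbar_mem_ofType (Form.ofFun_mem_ofType _)

theorem del_pairing_mem (k : ℤ) (e f : E.Sec k) :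
    del (h.pairing (tmul k e 1) (tmul k f 1)) ∈ Form.ofType V X 1 0 := by
  rw [pairing_tmul_one, mul_one]
  exact del_mem_ofType (Form.ofFun_mem_ofType _)

/-- `h(E' e, f)` is of type `(0, l + 1 - k)` for `e` in `E^k` and `f` in `E^l`; so the component of
`E' e` in `E^l` is of type `(l + 1 - k, 0)`. -/
theorem chernFun_mem (k l : ℤ) (e : E.Sec k) (f : E.Sec l) :
    chernFun D'' h k l e f ∈ Form.ofType V X 0 (l + 1 - k).toNat ∧
      (l + 1 < k → chernFun D'' h k l e f = 0) := by
  have h1 := D''.pairing_mem (h := h) l k f e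
  rcases eq_or_ne k l with rfl | hkl
  · rw [chernFun]
    refine ⟨Submodule.sub_mem _ h1.1 (Submodule.smul_mem _ _ ?_), fun hlt => absurd hlt (by omega)⟩
    rw [show (k + 1 - k).toNat = 1 by omega]
    exact delbar_pairing_mem k e f
  · rw [chernFun, pairing_tmul_ne h hkl, map_zero, smul_zero, sub_zero]
    exact h1

/-! ### Construction of the Chern superconnection -/

/-- The additive map on `A^0(X, E^•)` with given restrictions to the sections of the `E^k`. -/
def liftSections {M : Type*} [AddCommMonoid M] (φ : ∀ k : ℤ, E.Sec k →+ M) : E.Sections →+ M :=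
  DirectSum.toAddMonoid φ

theorem liftSections_ofSec {M : Type*} [AddCommMonoid M] (φ : ∀ k : ℤ, E.Sec k →+ M) (k : ℤ)
    (e : E.Sec k) : liftSections φ (E.ofSec k e) = φ k e := DirectSum.toAddMonoid_of φ k e

theorem sections_induction {P : E.Sections → Prop} (h0 : P 0)
    (hadd : ∀ s t, P s → P t → P (s + t)) (hof : ∀ k e, P (E.ofSec k e)) (s : E.Sections) : P s :=
  DirectSum.induction_on (motive := P) s h0 hof hadd

/-- The Chern superconnection on sections of `E^k`: the expansion in the frames of the element
`E' e` with `h(E' e, f) = chernFun e f`. -/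
def chernSec (B : ∀ k, Frame (h k)) (k : ℤ) : E.Sec k →+ E.Forms :=
  AddMonoidHom.mk' (fun e => ∑ l ∈ degrees E, ∑ i,
      tmul l ((B l).e i) (Form.star (chernFun D'' h k l e ((B l).f i))))
    (fun e e' => by
      simp only [chernFun_add_left, map_add, tmul_add_form, Finset.sum_add_distrib])

theorem chernSec_apply (B : ∀ k, Frame (h k)) (k : ℤ) (e : E.Sec k) :
    chernSec D'' B k e = ∑ l ∈ degrees E, ∑ i,
      tmul l ((B l).e i) (Form.star (chernFun D'' h k l e ((B l).f i))) := rfl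

theorem pairing_chernSec (B : ∀ k, Frame (h k)) (k l : ℤ) (e : E.Sec k) (f : E.Sec l) :
    h.pairing (chernSec D'' B k e) (tmul l f 1) = chernFun D'' h k l e f := by
  rw [chernSec_apply, map_sum, AddMonoidHom.finsetSum_apply]
  simp only [map_sum, AddMonoidHom.finsetSum_apply]
  by_cases hl : l ∈ degrees E
  · rw [Finset.sum_eq_single_of_mem l hl fun m _ hm => Finset.sum_eq_zero fun i _ => by
      rw [pairing_tmul_ne h hm]]
    conv_rhs => rw [sec_expand_dual B f, chernFun_sum_right]
    refine Finset.sum_congr rfl fun i _ => ?_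
    rw [pairing_tmul, Form.star_star, mul_one, chernFun_smul_right D'' B]
  · rw [sec_eq_zero hl f, chernFun_zero_right]
    simp only [zero_tmul_sec, map_zero, Finset.sum_const_zero]

theorem chernSec_smul (B : ∀ k, Frame (h k)) (k : ℤ) (e : E.Sec k) (g : SmoothFun V X) :
    chernSec D'' B k (g • e) = rmul (Form.ofFun g) (chernSec D'' B k e) +
      (-1 : ℂ) ^ k • tmul k e (del (Form.ofFun g)) := by
  refine pairing_nondeg_left B fun l f => ?_
  rw [pairing_chernSec, chernFun_smul_left, map_add, AddMonoidHom.add_apply, pairing_rmul_left,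
    pairing_chernSec, Form.star_ofFun, pairing_const_smul_left, rmul_tmul_one k e (del _),
    pairing_rmul_left, Form.star_del, Form.star_ofFun, Form.rot_ofFun, neg_mul, smul_neg,
    map_zpow₀, map_neg, map_one, sub_eq_add_neg]

/-- The Chern superconnection of a cohesive structure and a metric. -/
def chernConnection (B : ∀ k, Frame (h k)) : Superconnection E (del (V := V) (X := X)) where
  toLin :=
    { toFun := liftSections (chernSec D'' B)
      map_add' := map_add _
      map_smul' := fun c s => by
        rw [RingHom.id_apply]
        induction s using sections_induction with
        | h0 => rw [smul_zero, map_zero, smul_zero]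
        | hadd s t hs ht => rw [smul_add, map_add, map_add, smul_add, hs, ht]
        | hof k e =>
          have h1 : c • E.ofSec k e = E.ofSec k (algebraMap ℂ (SmoothFun V X) c • e) := by
            rw [map_smul]
            rfl
          rw [h1, liftSections_ofSec, liftSections_ofSec, chernSec_smul, Form.ofFun_algebraMap,
            Algebra.algebraMap_eq_smul_one, map_smul, del, Form.diff_one, smul_zero,
            tmul_zero_form, smul_zero, add_zero, rmul_smul_form, rmul_one_form] }
  leibniz k e f := by
    change liftSections (chernSec D'' B) (E.ofSec k (f • e)) =
      rmul (Form.ofFun f) (liftSections (chernSec D'' B) (E.ofSec k e)) +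
        (-1 : ℂ) ^ k • tmul k e (del (Form.ofFun f))
    rw [liftSections_ofSec, liftSections_ofSec, chernSec_smul]

theorem chernConnection_ofSec (B : ∀ k, Frame (h k)) (k : ℤ) (e : E.Sec k) :
    (chernConnection D'' B).toLin (E.ofSec k e) = chernSec D'' B k e :=
  liftSections_ofSec _ _ _

theorem chernSec_mem (B : ∀ k, Frame (h k)) (k : ℤ) (e : E.Sec k) :
    chernSec D'' B k e ∈ E.holoForms ∧ chernSec D'' B k e ∈ E.exoticDegree (k - 1) := by
  have h1 := fun l i => chernFun_mem (h := h) D'' k l e ((B l).f i)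
  constructor
  · exact Submodule.sum_mem _ fun l _ => Submodule.sum_mem _ fun i _ =>
      Submodule.subset_span ⟨l, _, _, _, Form.star_mem_ofType (h1 l i).1, rfl⟩
  · refine Submodule.sum_mem _ fun l _ => Submodule.sum_mem _ fun i _ => ?_
    rcases lt_or_ge (l + 1) k with hlt | hle
    · rw [(h1 l i).2 hlt, map_zero, tmul_zero_form]
      exact Submodule.zero_mem _
    · exact tmul_mem_exoticDegree _ (Form.star_mem_ofType (h1 l i).1)
        (by rw [Int.toNat_of_nonneg (by omega)]; push_cast; ring)

/-! ### Unitarity and its components -/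

variable {D''} {D' : Superconnection E (del (V := V) (X := X))}

/-- `E'` is adjoint to `E''` on sections: `h(E' e, f) = h(e, E'' f) - (-1)^{|e|} ∂̄ h(e, f)`. -/
def IsAdjoint (D'' : CohesiveStructure E) (h : GradedMetric E)
    (D' : Superconnection E (del (V := V) (X := X))) : Prop :=
  ∀ k l (e : E.Sec k) (f : E.Sec l),
    h.pairing (D'.toLin (E.ofSec k e)) (tmul l f 1) = chernFun D'' h k l e f

theorem Superconnection.opDel_isOddDerivation
    (hD : ∀ k e, D'.toLin (E.ofSec k e) ∈ E.exoticDegree (k - 1)) :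
    IsOddDerivation (del (V := V) (X := X)) D'.opDel :=
  Superconnection.extend_isOddDerivation _ _ fun k e =>
    rotE_neg_one_of_shift (m := -1) (hD k e) (by decide)

theorem Superconnection.opDel_mem_exoticDegree
    (hD : ∀ k e, D'.toLin (E.ofSec k e) ∈ E.exoticDegree (k - 1)) {n : ℤ} {s : E.Forms}
    (hs : s ∈ E.exoticDegree n) : D'.opDel s ∈ E.exoticDegree (n - 1) :=
  Superconnection.extend_mem_exoticDegree (m := -1) _ _ hD
    (fun p q _ hα => ⟨p + 1, q, del_mem_ofType hα, by push_cast; ring⟩) hs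

/-- The `∂̄`-part of the unitarity condition on all of `A^•(X, E^•)`: if it holds on sections, it
extends by the Leibniz rules. -/
theorem IsAdjoint.delbar_pairing (hA : IsAdjoint D'' h D') (B : ∀ k, Frame (h k))
    (hD : ∀ k e, D'.toLin (E.ofSec k e) ∈ E.exoticDegree (k - 1)) (s t : E.Forms) :
    delbar (h.pairing (rotE (-1) s) t) = -h.pairing (D'.opDel s) t + h.pairing s (D''.op t) := by
  have hP := Superconnection.opDel_isOddDerivation hD
  have hQ := D''.isOddDerivation B
  -- the identity for `(s, t)` implies it for `(s, t ∧ β)` and for `(s ∧ α, t)`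
  have right : ∀ s t β, delbar (h.pairing (rotE (-1) s) t) =
      -h.pairing (D'.opDel s) t + h.pairing s (D''.op t) →
      delbar (h.pairing (rotE (-1) s) (rmul β t)) =
        -h.pairing (D'.opDel s) (rmul β t) + h.pairing s (D''.op (rmul β t)) := fun s t β ih => by
    have h1 := Form.diff_mul (1 / 2) (Complex.I / 2) (h.pairing (rotE (-1) s) t) β
    rw [← delbar, ih, rot_pairing h (by simp), rotE_rotE_neg_one] at h1
    rw [pairing_rmul_right, h1, hQ.leibniz, map_add, pairing_rmul_right, pairing_rmul_right,
      pairing_rmul_right]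
    noncomm_ring
  have left : ∀ s t α, delbar (h.pairing (rotE (-1) s) t) =
      -h.pairing (D'.opDel s) t + h.pairing s (D''.op t) →
      delbar (h.pairing (rotE (-1) (rmul α s)) t) =
        -h.pairing (D'.opDel (rmul α s)) t + h.pairing (rmul α s) (D''.op t) := fun s t α ih => by
    have h1 := Form.diff_mul (1 / 2) (Complex.I / 2) (Form.rot (-1) (Form.star α))
      (h.pairing (rotE (-1) s) t)
    rw [← delbar, ih, Form.rot_rot, neg_mul_neg, one_mul, Form.rot_one] at h1
    rw [rotE_rmul, pairing_rmul_left, Form.star_rot, h1, hP.leibniz, map_add,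
      AddMonoidHom.add_apply, pairing_rmul_left, pairing_rmul_left, pairing_rmul_left,
      Form.star_del]
    noncomm_ring
  induction s using forms_induction with
  | h0 => simp only [map_zero, AddMonoidHom.zero_apply, neg_zero, add_zero]
  | hadd s s' hs hs' => simp only [map_add, AddMonoidHom.add_apply, hs, hs', neg_add]; abel
  | htmul k e α =>
    rw [rmul_tmul_one]
    refine left _ _ _ ?_
    induction t using forms_induction with
    | h0 => simp only [map_zero, neg_zero, add_zero]
    | hadd t t' ht ht' => simp only [map_add, ht, ht', neg_add]; abel
    | htmul l f β =>
      rw [rmul_tmul_one l]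
      refine right _ _ _ ?_
      rw [Superconnection.opDel_tmul_one, hA k l e f, chernFun, rotE_of_exoticDegree (by simp)
        (tmul_one_mem_exoticDegree k e), neg_one_zpow_neg, pairing_const_smul_left, map_smul,
        map_zpow₀, map_neg, map_one]
      abel

/-- The `∂`-part of the unitarity condition, which is conjugate to the `∂̄`-part. -/
theorem IsAdjoint.del_pairing (hA : IsAdjoint D'' h D') (B : ∀ k, Frame (h k))
    (hD : ∀ k e, D'.toLin (E.ofSec k e) ∈ E.exoticDegree (k - 1)) (s t : E.Forms) :
    del (h.pairing (rotE (-1) s) t) = -h.pairing (D''.op s) t + h.pairing s (D'.opDel t) := by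
  have h1 := congrArg Form.star (hA.delbar_pairing B hD t s)
  rw [Form.star_delbar, map_add, map_neg, star_pairing, star_pairing, star_pairing,
    rot_pairing h (by simp), rotE_rotE_neg_one] at h1
  rw [← neg_inj, h1]
  abel

/-- Unitarity for all elements, written with the parity involution. -/
theorem IsAdjoint.extD_pairing (hA : IsAdjoint D'' h D') (B : ∀ k, Frame (h k))
    (hD : ∀ k e, D'.toLin (E.ofSec k e) ∈ E.exoticDegree (k - 1)) (s t : E.Forms) :
    extD (h.pairing (rotE (-1) s) t) =
      -h.pairing (totalOp D' D'' s) t + h.pairing s (totalOp D' D'' t) := by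
  rw [extD_eq, hA.delbar_pairing B hD, hA.del_pairing B hD]
  simp only [totalOp, AddMonoidHom.add_apply, map_add]
  abel

theorem IsAdjoint.isUnitary (hA : IsAdjoint D'' h D') (B : ∀ k, Frame (h k))
    (hD : ∀ k e, D'.toLin (E.ofSec k e) ∈ E.exoticDegree (k - 1)) :
    IsUnitary h (totalOp D' D'') := fun n s t hs => by
  rw [← hA.extD_pairing B hD, rotE_of_totalDegree hs, pairing_const_smul_left, map_smul, map_zpow₀,
    map_neg, map_one]

/-- The pairing of elements of exotic degrees `m` and `n` is an eigenvector of the circle action. -/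
theorem rot_pairing_exoticDegree {u : ℂ} (hu : starRingEnd ℂ u * u = 1) {m n : ℤ} {s t : E.Forms}
    (hs : s ∈ E.exoticDegree m) (ht : t ∈ E.exoticDegree n) :
    Form.rot u (h.pairing s t) = u ^ (m - n) • h.pairing s t := by
  have hu0 : u ≠ 0 := by
    rintro rfl
    simp at hu
  have h1 : starRingEnd ℂ u = u ^ (-1 : ℤ) := by
    rw [zpow_neg_one]; exact eq_inv_of_mul_eq_one_left hu
  rw [rot_pairing h hu, rotE_of_exoticDegree hu hs, rotE_of_exoticDegree hu ht,
    pairing_const_smul_right, pairing_const_smul_left, smul_smul, map_zpow₀, h1, ← zpow_mul,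
    ← zpow_add₀ hu0]
  congr 2
  ring

/-- A unitary superconnection satisfies the `∂̄`-part of the unitarity condition on sections: under
the action of `i`, the `∂̄`-part and the `∂`-part have opposite eigenvalues. -/
theorem IsChern.isAdjoint (hD' : IsChern D'' h D') (B : ∀ k, Frame (h k)) :
    IsAdjoint D'' h D' := fun k l e f => by
  have hu := hD'.unitary k (tmul k e 1) (tmul l f 1) (tmul_one_mem_totalDegree k e)
  have hI : starRingEnd ℂ Complex.I * Complex.I = 1 := by simp
  have hI2 : Complex.I ^ (k + 1 - l) = -Complex.I ^ (k - 1 - l) := by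
    rw [show k + 1 - l = (k - 1 - l) + 2 by ring, zpow_add₀ Complex.I_ne_zero]
    simp
  have mP : ∀ k (e : E.Sec k), D'.opDel (tmul k e 1) ∈ E.exoticDegree (k - 1) := fun k e =>
    (D'.opDel_tmul_one k e).symm ▸ hD'.exotic_degree k e
  have mQ : ∀ k (e : E.Sec k), D''.op (tmul k e 1) ∈ E.exoticDegree (k + 1) := fun k e =>
    (D''.op_tmul_one k e).symm ▸ D''.mem_exoticDegree B k e
  have m1 := fun k (e : E.Sec k) => tmul_one_mem_exoticDegree k e
  set β := h.pairing (tmul k e 1) (tmul l f 1) with hβ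
  have r1 := rot_pairing_exoticDegree (h := h) hI (mP k e) (m1 l f)
  have r2 := rot_pairing_exoticDegree (h := h) hI (m1 k e) (mQ l f)
  have r3 := rot_pairing_exoticDegree (h := h) hI (mQ k e) (m1 l f)
  have r4 := rot_pairing_exoticDegree (h := h) hI (m1 k e) (mP l f)
  have r5 : Form.rot Complex.I (delbar β) = Complex.I ^ (k - 1 - l) • delbar β := by
    rcases eq_or_ne k l with rfl | hkl
    · rw [Form.rot_of_mem (show delbar β ∈ _ from delbar_pairing_mem k e f),
        show k - 1 - k = -1 by ring]
      simp
    · rw [hβ, pairing_tmul_ne h hkl, map_zero, map_zero, smul_zero]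
  have r6 : Form.rot Complex.I (del β) = Complex.I ^ (k + 1 - l) • del β := by
    rcases eq_or_ne k l with rfl | hkl
    · rw [Form.rot_of_mem (show del β ∈ _ from del_pairing_mem k e f),
        show k + 1 - k = 1 by ring]
      simp
    · rw [hβ, pairing_tmul_ne h hkl, map_zero, map_zero, smul_zero]
  rw [show k - (l + 1) = k - 1 - l by ring] at r2
  rw [show k - (l - 1) = k + 1 - l by ring] at r4
  rw [hI2] at r3 r4 r6
  rw [extD_eq] at hu
  simp only [totalOp, AddMonoidHom.add_apply, map_add] at hu
  rw [chernFun, ← D'.opDel_tmul_one]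
  set a := h.pairing (D'.opDel (tmul k e 1)) (tmul l f 1)
  set b := h.pairing (tmul k e 1) (D''.op (tmul l f 1))
  set c := h.pairing (D''.op (tmul k e 1)) (tmul l f 1)
  set d := h.pairing (tmul k e 1) (D'.opDel (tmul l f 1))
  set μ := Complex.I ^ (k - 1 - l)
  have hμ : μ ≠ 0 := zpow_ne_zero _ Complex.I_ne_zero
  -- `y` is the `∂̄`-part, with eigenvalue `μ`, and `z` is the `∂`-part, with eigenvalue `-μ`
  set y := -a + b - (-1 : ℂ) ^ k • delbar β with hy
  set z := -c + d - (-1 : ℂ) ^ k • del β with hz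
  have hyz : y + z = 0 := by
    have : y + z = (-(a + c) + (b + d)) - (-1 : ℂ) ^ k • (del β + delbar β) := by
      rw [hy, hz, smul_add]; abel
    rw [this, hu]
    abel
  have hry : Form.rot Complex.I y = μ • y := by
    rw [hy, map_sub, map_add, map_neg, map_smul, r1, r2, r5]
    module
  have hrz : Form.rot Complex.I z = -μ • z := by
    rw [hz, map_sub, map_add, map_neg, map_smul, r3, r4, r6]
    module
  have h1 := congrArg (Form.rot Complex.I) hyz
  rw [map_add, map_zero, hry, hrz, eq_neg_of_add_eq_zero_right hyz] at h1
  have h2 : (2 * μ) • y = 0 := by rw [← h1]; module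
  have h3 : y = 0 := by
    have := congrArg (fun t => (2 * μ)⁻¹ • t) h2
    simpa [smul_smul, hμ] using this
  rw [hy] at h3
  rw [← sub_eq_zero, ← neg_eq_zero, ← h3]
  abel

theorem Superconnection.ext_of_ofSec {δ : Form V X →ₗ[ℂ] Form V X} {D₁ D₂ : Superconnection E δ}
    (hD : ∀ k e, D₁.toLin (E.ofSec k e) = D₂.toLin (E.ofSec k e)) : D₁ = D₂ := by
  have h1 : D₁.toLin = D₂.toLin := LinearMap.ext fun s => by
    induction s using sections_induction with
    | h0 => rw [map_zero, map_zero]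
    | hadd s t hs ht => rw [map_add, map_add, hs, ht]
    | hof k e => exact hD k e
  cases D₁
  cases D₂
  congr

variable (D'') in
/-- Existence and uniqueness of the Chern superconnection. -/
theorem existsUnique_isChern (B : ∀ k, Frame (h k)) :
    ∃! D' : Superconnection E (del (V := V) (X := X)), IsChern D'' h D' := by
  have hex : ∀ k (e : E.Sec k), (chernConnection D'' B).toLin (E.ofSec k e) ∈
      E.exoticDegree (k - 1) := fun k e =>
    (chernConnection_ofSec D'' B k e).symm ▸ (chernSec_mem D'' B k e).2
  have hadj : IsAdjoint D'' h (chernConnection D'' B) := fun k l e f =>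
    (chernConnection_ofSec D'' B k e).symm ▸ pairing_chernSec D'' B k l e f
  refine ⟨chernConnection D'' B, ⟨fun s => ?_, hex, hadj.isUnitary B hex⟩, fun D' hD' => ?_⟩
  · induction s using sections_induction with
    | h0 => rw [map_zero]; exact Submodule.zero_mem _
    | hadd s t hs ht => rw [map_add]; exact Submodule.add_mem _ hs ht
    | hof k e => exact (chernConnection_ofSec D'' B k e).symm ▸ (chernSec_mem D'' B k e).1
  · refine Superconnection.ext_of_ofSec fun k e => pairing_nondeg_left B fun l f => ?_
    rw [hD'.isAdjoint B k l e f, hadj k l e f]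

/-- Flatness of `E'` follows from flatness of `E''` by adjunction. -/
theorem IsAdjoint.opDel_opDel (hA : IsAdjoint D'' h D') (B : ∀ k, Frame (h k))
    (hD : ∀ k e, D'.toLin (E.ofSec k e) ∈ E.exoticDegree (k - 1)) (s : E.Forms) :
    D'.opDel (D'.opDel s) = 0 := by
  have hP := Superconnection.opDel_isOddDerivation hD
  refine pairing_nondeg_left B fun l f => ?_
  -- apply `∂̄` to the adjunction of `s` and `f`, and expand both terms by adjunction again
  have h1 := hA.delbar_pairing B hD (D'.opDel s) (tmul l f 1)
  have h2 := hA.delbar_pairing B hD s (D''.op (tmul l f 1))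
  have h3 := congrArg delbar (hA.delbar_pairing B hD (rotE (-1) s) (tmul l f 1))
  rw [rotE_rotE_neg_one, delbar, Form.diff_diff, ← delbar, map_add, map_neg, h2,
    D''.op_op B, map_zero, add_zero] at h3
  rw [hP.odd, map_neg, AddMonoidHom.neg_apply, map_neg] at h1
  rw [map_zero, AddMonoidHom.zero_apply]
  rw [neg_eq_iff_eq_neg.1 (h1.trans (by rfl))] at h3
  rw [← neg_eq_zero]
  have h4 : -h.pairing (D'.opDel (D'.opDel s)) (tmul l f 1) = 0 := by
    rw [h3]
    abel
  exact h4

end Chern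

section Curvature

variable {V : Type u} [NormedAddCommGroup V] [NormedSpace ℂ V] [FiniteDimensional ℂ V]
variable {X : Type v} [TopologicalSpace X] [ChartedSpace V X] [IsManifold 𝓘(ℂ, V) ω X]
variable {E : GradedBundle.{u, v, w, z} V X}

open GradedBundle

/-! ### Operators linear over forms and endomorphism-valued forms -/

theorem endForms_induction {P : E.EndForms → Prop} (h0 : P 0)
    (hadd : ∀ R R', P R → P R' → P (R + R')) (htmul : ∀ k l L τ, P (endTmul k l L τ))
    (R : E.EndForms) : P R := by
  refine DirectSum.induction_on (motive := P) R h0 (fun p x => ?_) hadd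
  change P (E.ofEndForm p.1 p.2 x)
  induction x using TensorProduct.induction_on with
  | zero => rw [map_zero]; exact h0
  | tmul L τ => exact htmul p.1 p.2 L τ
  | add x y hx hy => rw [map_add]; exact hadd _ _ hx hy

theorem liftEndForms_of {M : Type*} [AddCommMonoid M]
    (φ : ∀ k l : ℤ, (E.Hom k l ⊗[SmoothFun V X] Form V X) →+ M) (k l : ℤ)
    (x : E.Hom k l ⊗[SmoothFun V X] Form V X) : liftEndForms φ (E.ofEndForm k l x) = φ k l x :=
  DirectSum.toAddMonoid_of (fun p : ℤ × ℤ => φ p.1 p.2) (k, l) x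

theorem endTmul_zero_form (k l : ℤ) (L : E.Hom k l) : endTmul k l L (0 : Form V X) = 0 := by
  rw [endTmul, TensorProduct.tmul_zero, map_zero]

theorem endTmul_add_form (k l : ℤ) (L : E.Hom k l) (τ τ' : Form V X) :
    endTmul k l L (τ + τ') = endTmul k l L τ + endTmul k l L τ' := by
  rw [endTmul, TensorProduct.tmul_add, map_add]
  rfl

theorem zero_endTmul (k l : ℤ) (τ : Form V X) : endTmul k l (0 : E.Hom k l) τ = 0 := by
  rw [endTmul, TensorProduct.zero_tmul, map_zero]

theorem sum_endTmul {ι : Type*} (I : Finset ι) (k l : ℤ) (L : ι → E.Hom k l) (τ : Form V X) :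
    endTmul k l (∑ i ∈ I, L i) τ = ∑ i ∈ I, endTmul k l (L i) τ := by
  rw [endTmul, TensorProduct.sum_tmul, map_sum]
  rfl

theorem smul_endTmul (k l : ℤ) (L : E.Hom k l) (f : SmoothFun V X) (τ : Form V X) :
    endTmul k l (f • L) τ = endTmul k l L (Form.ofFun f * τ) := by
  rw [endTmul, TensorProduct.smul_tmul, Form.fun_smul_eq]
  rfl

theorem endAct_tmul (k l : ℤ) (L : E.Hom k l) (τ : Form V X) (e : E.Sec k) (α : Form V X) :
    endAct (endTmul k l L τ) (tmul k e α) = tmul l (HomSect.app L e) (Form.twist k τ * α) := by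
  rw [endAct, endTmul, liftEndForms_of]
  change E.ofForm l (homFormAct k l (L ⊗ₜ τ) (E.component k (E.ofForm k (e ⊗ₜ α)))) = _
  rw [component_ofForm]
  rfl

theorem endAct_tmul_ne {k k' : ℤ} (hk : k ≠ k') (l : ℤ) (L : E.Hom k l) (τ : Form V X)
    (e : E.Sec k') (α : Form V X) : endAct (endTmul k l L τ) (tmul k' e α) = 0 := by
  rw [endAct, endTmul, liftEndForms_of]
  change E.ofForm l (homFormAct k l (L ⊗ₜ τ) (E.component k (E.ofForm k' (e ⊗ₜ α)))) = _
  rw [component_ofForm_ne hk, map_zero, map_zero]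

theorem endAct_rmul (R : E.EndForms) (α : Form V X) (s : E.Forms) :
    endAct R (rmul α s) = rmul α (endAct R s) := by
  induction R using endForms_induction with
  | h0 => simp only [map_zero, AddMonoidHom.zero_apply]
  | hadd R R' hR hR' => simp only [map_add, AddMonoidHom.add_apply, hR, hR']
  | htmul k l L τ =>
    induction s using forms_induction with
    | h0 => simp only [map_zero]
    | hadd s t hs ht => simp only [map_add, hs, ht]
    | htmul k' e β =>
      rw [rmul_tmul]
      rcases eq_or_ne k k' with rfl | hk
      · rw [endAct_tmul, endAct_tmul, rmul_tmul, mul_assoc]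
      · rw [endAct_tmul_ne hk, endAct_tmul_ne hk, map_zero]

variable {h : GradedMetric E}

variable (h) in
/-- The homomorphism `v ↦ h(f, v) e` for sections `e` of `E^l` and `f` of `E^k`. -/
def rankOne (k l : ℤ) (e : E.Sec l) (f : E.Sec k) : E.Hom k l :=
  ⟨fun x => ((h k).form x (f.1 x)).smulRight (e.1 x), fun b b' _ _ v => by
    have h1 : SmoothOn V (fun x => (h k).form x (f.1 x) (b.symmₗ ℂ x v) • b'.linearMapAt ℂ x (e.1 x))
        (b.baseSet ∩ b'.baseSet) :=
      SmoothOn.smul ((h k).smoothOn_pair b Set.inter_subset_left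
        ((f.2 b).mono Set.inter_subset_left)
        ((contMDiffOn_const (c := v)).congr fun x hx => b.linearMapAt_symmₗ (R := ℂ) hx.1 v))
        ((e.2 b').mono Set.inter_subset_right)
    refine h1.congr fun x _ => ?_
    exact map_smul (b'.linearMapAt ℂ x) _ _⟩

theorem rankOne_app (k l : ℤ) (e : E.Sec l) (f g : E.Sec k) :
    HomSect.app (rankOne h k l e f) g = (h k).pair f g • e := rfl

theorem sum_hom_apply {k l : ℤ} {ι : Type*} (I : Finset ι) (L : ι → E.Hom k l) (x : X) :
    (∑ i ∈ I, L i).1 x = ∑ i ∈ I, (L i).1 x := by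
  classical
  induction I using Finset.induction_on with
  | empty => rfl
  | insert i I hi ih =>
    rw [Finset.sum_insert hi, Finset.sum_insert hi, ← ih]
    rfl

/-- A homomorphism is the sum of its matrix entries in the frames times rank-one homomorphisms. -/
theorem hom_expand (B : ∀ k, Frame (h k)) {k l : ℤ} (L : E.Hom k l) :
    L = ∑ i, ∑ j, (h l).pair ((B l).f j) (HomSect.app L ((B k).e i)) •
      rankOne h k l ((B l).e j) ((B k).f i) := by
  refine Subtype.ext (funext fun x => LinearMap.ext fun v => ?_)
  have h1 : ∀ i, (∑ j, (h l).pair ((B l).f j) (HomSect.app L ((B k).e i)) •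
      rankOne h k l ((B l).e j) ((B k).f i)).1 x v =
      (h k).form x (((B k).f i).1 x) v • L.1 x (((B k).e i).1 x) := fun i => by
    conv_rhs => rw [(B l).expand x (L.1 x (((B k).e i).1 x)), Finset.smul_sum]
    rw [sum_hom_apply, LinearMap.sum_apply]
    exact Finset.sum_congr rfl fun j _ => smul_comm _ _ _
  conv_lhs => rw [(B k).expand x v, map_sum]
  refine Eq.trans ?_ (congrArg (fun T : E.bundle k x →ₗ[ℂ] E.bundle l x => T v)
    (sum_hom_apply _ _ x).symm)
  rw [LinearMap.sum_apply]
  refine Finset.sum_congr rfl fun i _ => ?_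
  rw [h1, map_smul]

/-- The endomorphism-valued form which represents an operator `P` linear over forms: its
coefficients are the matrix entries `h(f_j, P e_i)` of `P` in the frames, and the sign `twist k`
undoes the sign in the action on `E^k`. -/
def symbol (B : ∀ k, Frame (h k)) (P : E.Forms →+ E.Forms) : E.EndForms :=
  ∑ k ∈ degrees E, ∑ l ∈ degrees E, ∑ i, ∑ j, endTmul k l (rankOne h k l ((B l).e j) ((B k).f i))
    (Form.twist k (h.pairing (tmul l ((B l).f j) 1) (P (tmul k ((B k).e i) 1))))

theorem endAct_sum {ι : Type*} (I : Finset ι) (R : ι → E.EndForms) (s : E.Forms) :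
    endAct (∑ i ∈ I, R i) s = ∑ i ∈ I, endAct (R i) s := by
  rw [map_sum, AddMonoidHom.finsetSum_apply]

theorem endAct_symbol (B : ∀ k, Frame (h k)) {P : E.Forms →+ E.Forms}
    (hP : ∀ α s, P (rmul α s) = rmul α (P s)) (s : E.Forms) : endAct (symbol B P) s = P s := by
  induction s using forms_induction with
  | h0 => simp only [map_zero]
  | hadd s t hs ht => simp only [map_add, hs, ht]
  | htmul k e α =>
    rw [rmul_tmul_one, endAct_rmul, hP]
    congr 1
    by_cases hk : k ∈ degrees E
    · rw [symbol, endAct_sum, Finset.sum_eq_single_of_mem k hk fun m _ hm => by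
        simp only [endAct_sum, endAct_tmul_ne hm, Finset.sum_const_zero]]
      simp only [endAct_sum, endAct_tmul, rankOne_app, Form.twist_twist, mul_one]
      have h1 : P (tmul k e 1) = ∑ i, rmul (Form.ofFun ((h k).pair ((B k).f i) e))
          (P (tmul k ((B k).e i) 1)) := by
        conv_lhs => rw [sec_expand B e, tmul_sum_sec, map_sum]
        exact Finset.sum_congr rfl fun i _ => by rw [smul_tmul_one, hP]
      rw [h1, Finset.sum_comm]
      refine Finset.sum_congr rfl fun i _ => ?_
      conv_rhs => rw [forms_expand B (P (tmul k ((B k).e i) 1)), map_sum]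
      refine Finset.sum_congr rfl fun l _ => ?_
      rw [map_sum]
      refine Finset.sum_congr rfl fun j _ => ?_
      rw [rmul_tmul, smul_tmul_fun, Form.fun_smul_eq, Form.ofFun_comm]
    · rw [sec_eq_zero hk e, zero_tmul_sec, map_zero, map_zero]

theorem hom_eq_zero {k l : ℤ} (hkl : ¬(k ∈ degrees E ∧ l ∈ degrees E)) (B : ∀ k, Frame (h k))
    (L : E.Hom k l) : L = 0 := by
  rw [hom_expand B L]
  refine Finset.sum_eq_zero fun i _ => Finset.sum_eq_zero fun j _ => ?_
  have h1 : rankOne h k l ((B l).e j) ((B k).f i) = 0 :=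
    Subtype.ext (funext fun x => LinearMap.ext fun v => by
      change (h k).form x (((B k).f i).1 x) v • ((B l).e j).1 x = 0
      by_cases hk : k ∈ degrees E
      · rw [sec_eq_zero (fun hl => hkl ⟨hk, hl⟩) ((B l).e j)]
        exact smul_zero _
      · rw [sec_eq_zero hk ((B k).f i)]
        change (h k).form x 0 v • _ = 0
        rw [map_zero, LinearMap.zero_apply, zero_smul])
  rw [h1, smul_zero]

theorem symbol_endAct (B : ∀ k, Frame (h k)) (R : E.EndForms) : symbol B (endAct R) = R := by
  induction R using endForms_induction with
  | h0 =>
    simp only [symbol, map_zero, AddMonoidHom.zero_apply, endTmul_zero_form, Finset.sum_const_zero]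
  | hadd R R' hR hR' =>
    conv_rhs => rw [← hR, ← hR']
    simp only [symbol, map_add, AddMonoidHom.add_apply, endTmul_add_form, Finset.sum_add_distrib]
  | htmul k l L τ =>
    by_cases hkl : k ∈ degrees E ∧ l ∈ degrees E
    · rw [symbol, Finset.sum_eq_single_of_mem k hkl.1 fun m _ hm => by
        simp only [endAct_tmul_ne hm.symm, map_zero, endTmul_zero_form, Finset.sum_const_zero],
        Finset.sum_eq_single_of_mem l hkl.2 fun m _ hm => by
          simp only [endAct_tmul, pairing_tmul_ne h hm, map_zero, endTmul_zero_form,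
            Finset.sum_const_zero]]
      conv_rhs => rw [hom_expand B L, sum_endTmul]
      refine Finset.sum_congr rfl fun i _ => ?_
      rw [sum_endTmul]
      refine Finset.sum_congr rfl fun j _ => ?_
      rw [endAct_tmul, mul_one, pairing_tmul_one, ← Form.fun_smul_eq, map_smul, Form.twist_twist,
        smul_endTmul, Form.fun_smul_eq]
    · rw [hom_eq_zero hkl B L, zero_endTmul]
      simp only [symbol, map_zero, AddMonoidHom.zero_apply, endTmul_zero_form,
        Finset.sum_const_zero]

theorem endAct_injective (B : ∀ k, Frame (h k)) {R R' : E.EndForms}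
    (hR : ∀ s, endAct R s = endAct R' s) : R = R' := by
  rw [← symbol_endAct B R, ← symbol_endAct B R', AddMonoidHom.ext hR]

/-! ### Adjoints and exotic degrees of endomorphism-valued forms -/

theorem star_endTmul (k l : ℤ) (L : E.Hom k l) (τ : Form V X) :
    GradedMetric.star h (endTmul k l L τ) = endTmul l k (HomSect.adjoint (h k) (h l) L)
      (Form.star (Form.twist (l - k) τ)) :=
  liftEndForms_of _ _ _ _

theorem pair_app (k l : ℤ) (L : E.Hom k l) (e : E.Sec k) (f : E.Sec l) :
    (h l).pair (HomSect.app L e) f =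
      (h k).pair e (HomSect.app (HomSect.adjoint (h k) (h l) L) f) :=
  Subtype.ext (funext fun x => HomSect.adjoint_spec (h k) (h l) L x (e.1 x) (f.1 x))

/-- The involution on endomorphism-valued forms is the adjoint of their action. -/
theorem pairing_endAct (R : E.EndForms) (s t : E.Forms) :
    h.pairing (endAct R s) t = h.pairing s (endAct (GradedMetric.star h R) t) := by
  induction R using endForms_induction with
  | h0 => simp only [map_zero, AddMonoidHom.zero_apply]
  | hadd R R' hR hR' => simp only [map_add, AddMonoidHom.add_apply, hR, hR']
  | htmul k l L τ =>
    rw [star_endTmul]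
    induction s using forms_induction with
    | h0 => simp only [map_zero, AddMonoidHom.zero_apply]
    | hadd s s' hs hs' => simp only [map_add, AddMonoidHom.add_apply, hs, hs']
    | htmul k' e α =>
      induction t using forms_induction with
      | h0 => simp only [map_zero]
      | hadd t t' ht ht' => simp only [map_add, ht, ht']
      | htmul l' f β =>
        rcases eq_or_ne l l' with rfl | hl
        · rcases eq_or_ne k k' with rfl | hk
          · rw [endAct_tmul, endAct_tmul, pairing_tmul, pairing_tmul, pair_app, Form.star_mul,
              Form.twist_eq_rot k, Form.twist_eq_rot l, Form.twist_eq_rot, Form.star_rot,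
              Form.star_rot, Form.rot_rot, ← zpow_add₀ (by norm_num),
              show l + (l - k) = l + l + -k by ring, zpow_add₀ (by norm_num),
              ← two_mul, zpow_mul, neg_one_zpow_neg]
            simp only [mul_assoc]
            rw [Form.ofFun_comm, ← mul_assoc _ _ β, Form.ofFun_comm]
            simp only [zpow_ofNat, even_two, Even.neg_pow, one_pow, one_zpow, one_mul, mul_assoc]
            rw [Form.ofFun_comm]
          · rw [endAct_tmul_ne hk, endAct_tmul, pairing_tmul_ne h hk.symm, map_zero,
              AddMonoidHom.zero_apply]
        · rw [endAct_tmul_ne hl, map_zero]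
          rcases eq_or_ne k k' with rfl | hk
          · rw [endAct_tmul, pairing_tmul_ne h hl]
          · rw [endAct_tmul_ne hk, map_zero, AddMonoidHom.zero_apply]

theorem endTmul_const_smul (c : ℂ) (k l : ℤ) (L : E.Hom k l) (τ : Form V X) :
    endTmul k l L (c • τ) = c • endTmul k l L τ := by
  change _ = algebraMap ℂ (SmoothFun V X) c • endTmul k l L τ
  rw [endTmul, endTmul, ← map_smul, ← TensorProduct.tmul_smul, algebraMap_smul]

/-- The coefficients of an element of exotic degree `n` contribute elements of exotic degree
`n - k` to the symbol. -/
theorem endTmul_pairing_mem {n : ℤ} {s : E.Forms} (hs : s ∈ E.exoticDegree n) (k l : ℤ)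
    (L : E.Hom k l) (f : E.Sec l) :
    endTmul k l L (Form.twist k (h.pairing (tmul l f 1) s)) ∈ E.endExoticDegree (n - k) := by
  induction hs using Submodule.span_induction with
  | mem s hs =>
    obtain ⟨m, p, q, e, α, hα, hn, rfl⟩ := hs
    rcases eq_or_ne l m with rfl | hlm
    · rw [pairing_tmul_one, ← Form.fun_smul_eq, map_smul, Form.twist_of_mem hα, Form.fun_smul_eq,
        ← smul_endTmul, endTmul_const_smul]
      exact Submodule.smul_mem _ _ (Submodule.subset_span
        ⟨k, l, p, q, _, α, hα, by linarith, rfl⟩)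
    · rw [pairing_tmul_ne h hlm, map_zero, endTmul_zero_form]
      exact Submodule.zero_mem _
  | zero => rw [map_zero, map_zero, endTmul_zero_form]; exact Submodule.zero_mem _
  | add s t _ _ hs ht =>
    rw [map_add, map_add, endTmul_add_form]
    exact Submodule.add_mem _ hs ht
  | smul c s _ hs =>
    rw [pairing_const_smul_right, Form.twist_eq_rot, map_smul, ← Form.twist_eq_rot,
      endTmul_const_smul]
    exact Submodule.smul_mem _ c hs

theorem symbol_mem (B : ∀ k, Frame (h k)) {P : E.Forms →+ E.Forms}
    (hP : ∀ k (e : E.Sec k), P (tmul k e 1) ∈ E.exoticDegree k) :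
    symbol B P ∈ E.endExoticDegree 0 := by
  refine Submodule.sum_mem _ fun k _ => Submodule.sum_mem _ fun l _ => Submodule.sum_mem _ fun i _ =>
    Submodule.sum_mem _ fun j _ => ?_
  have h1 := endTmul_pairing_mem (h := h) (hP k ((B k).e i)) k l
    (rankOne h k l ((B l).e j) ((B k).f i)) ((B l).f j)
  rwa [sub_self] at h1

/-! ### The curvature of the Chern superconnection -/

variable {D'' : CohesiveStructure E} {D' : Superconnection E (del (V := V) (X := X))}

/-- The square of a unitary superconnection is self-adjoint, since `d² = 0`. -/
theorem IsAdjoint.pairing_sq (hA : IsAdjoint D'' h D') (B : ∀ k, Frame (h k))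
    (hD : ∀ k e, D'.toLin (E.ofSec k e) ∈ E.exoticDegree (k - 1)) (s t : E.Forms) :
    h.pairing (totalOp D' D'' (totalOp D' D'' s)) t =
      h.pairing s (totalOp D' D'' (totalOp D' D'' t)) := by
  have hodd : IsOddDerivation extD (totalOp D' D'') :=
    (Superconnection.opDel_isOddDerivation hD).add (D''.isOddDerivation B) extD_eq
  -- apply `d` to the unitarity condition and expand both terms by unitarity again
  have h1 := hA.extD_pairing B hD (totalOp D' D'' s) t
  have h2 := hA.extD_pairing B hD s (totalOp D' D'' t)
  have h3 := congrArg extD (hA.extD_pairing B hD (rotE (-1) s) t)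
  rw [rotE_rotE_neg_one, extD, Form.diff_diff, ← extD, map_add, map_neg, h2] at h3
  rw [hodd.odd, map_neg, AddMonoidHom.neg_apply, map_neg] at h1
  rw [h1, eq_comm, ← sub_eq_zero] at h3
  rw [eq_comm, ← sub_eq_zero, ← h3]
  abel

/-- The curvature is the action of a unique endomorphism-valued form, which is self-adjoint and of
exotic degree zero, and it is the supercommutator of `E'` and `E''`. -/
theorem IsChern.curvature (hD' : IsChern D'' h D') (B : ∀ k, Frame (h k)) :
    ∃ R : E.EndForms,
      (∀ s, endAct R s = totalOp D' D'' (totalOp D' D'' s)) ∧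
      (∀ R' : E.EndForms, (∀ s, endAct R' s = totalOp D' D'' (totalOp D' D'' s)) → R' = R) ∧
      GradedMetric.star h R = R ∧
      (∀ s, endAct R s = D'.opDel (D''.op s) + D''.op (D'.opDel s)) ∧
      R ∈ E.endExoticDegree 0 := by
  have hD := hD'.exotic_degree
  have hA := hD'.isAdjoint B
  have hodd : IsOddDerivation extD (totalOp D' D'') :=
    (Superconnection.opDel_isOddDerivation hD).add (D''.isOddDerivation B) extD_eq
  have hcomm : ∀ s, totalOp D' D'' (totalOp D' D'' s) =
      D'.opDel (D''.op s) + D''.op (D'.opDel s) := fun s => by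
    simp only [totalOp, AddMonoidHom.add_apply, map_add]
    rw [hA.opDel_opDel B hD, D''.op_op B]
    abel
  have hR := endAct_symbol B (P := (totalOp D' D'').comp (totalOp D' D''))
    (hodd.sq_rmul (Form.diff_diff _ _))
  refine ⟨symbol B ((totalOp D' D'').comp (totalOp D' D'')), hR, fun R' hR' => ?_, ?_,
    fun s => (hR s).trans (hcomm s), symbol_mem B fun k e => ?_⟩
  · exact endAct_injective B fun s => (hR' s).trans (hR s).symm
  · refine endAct_injective B fun t => pairing_nondeg B fun k f => ?_
    rw [← pairing_endAct, hR, hR]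
    exact hA.pairing_sq B hD _ _
  · have m1 := D''.op_mem_exoticDegree B (tmul_one_mem_exoticDegree k e)
    have m2 := Superconnection.opDel_mem_exoticDegree hD (tmul_one_mem_exoticDegree k e)
    have m3 := Superconnection.opDel_mem_exoticDegree hD m1
    have m4 := D''.op_mem_exoticDegree B m2
    rw [add_sub_cancel_right] at m3
    rw [sub_add_cancel] at m4
    exact (hcomm _).symm ▸ Submodule.add_mem _ m3 m4

end Curvature

end ChernSuper

end

theorem mainTheorem2 {V : Type*} [NormedAddCommGroup V] [NormedSpace ℂ V] [FiniteDimensional ℂ V]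
    {X : Type*} [TopologicalSpace X] [T2Space X] [CompactSpace X] [ChartedSpace V X]
    [IsManifold 𝓘(ℂ, V) ω X]
    (E : ChernSuper.GradedBundle V X) (D'' : ChernSuper.CohesiveStructure E)
    (h : ChernSuper.GradedMetric E) :
    (∃! D' : ChernSuper.Superconnection E (ChernSuper.del (V := V) (X := X)),
      ChernSuper.IsChern D'' h D') ∧
    ∀ D' : ChernSuper.Superconnection E (ChernSuper.del (V := V) (X := X)),
      ChernSuper.IsChern D'' h D' →
      (∀ s, D'.opDel (D'.opDel s) = 0) ∧
      ∃ R : E.EndForms,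
        (∀ s, ChernSuper.endAct R s =
          ChernSuper.totalOp D' D'' (ChernSuper.totalOp D' D'' s)) ∧
        (∀ R' : E.EndForms, (∀ s, ChernSuper.endAct R' s =
          ChernSuper.totalOp D' D'' (ChernSuper.totalOp D' D'' s)) → R' = R) ∧
        ChernSuper.GradedMetric.star h R = R ∧
        (∀ s, ChernSuper.endAct R s = D'.opDel (D''.op s) + D''.op (D'.opDel s)) ∧
        R ∈ E.endExoticDegree 0 := by
  have B : ∀ k, ChernSuper.Frame (h k) := fun k => (ChernSuper.exists_frame (h k)).some
  exact ⟨ChernSuper.existsUnique_isChern D'' B, fun D' hD' =>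
    ⟨(hD'.isAdjoint B).opDel_opDel B hD'.exotic_degree, hD'.curvature B⟩⟩
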